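/- **Setting.** Let $C(m,z;l,w)=\tfrac12 (m+l-1)!\,(-1)^m (z-w)^{-m-l}=\partial_z^{m-1}\partial_w^{l-1}\bigl(-\tfrac12 (z-w)^{-2}\bigr)$ for integers $m,l\ge 1$ and $z\ne w$ in $\mathbb C$, and let $D=\{|z|<1\}$. *The Hilbert space.* Let $\Upsilon$ be the free algebra with basis the symbols $[z_1,\dots,z_n]$ ($n\ge 0$, $z_i\in\mathbb C$) and juxtaposition as product. For non-coinciding points put $\langle[z_1,\dots,z_n]\rangle=\sum_P\prod_{\{\alpha,\beta\}\in P}C(1,z_\alpha;1,z_\beta)$, the sum over all pairings $P$ of $\{1,\dots,n\}$, and extend linearly. For nonzero points let $\Theta$ be the antilinear map with $\Theta[z_1,\dots,z_n]=\prod_i(-\bar z_i^{-2})\,[\bar z_1^{-1},\dots,\bar z_n^{-1}]$. Let $\Upsilon_{0,D-\{0\}}$ be the span of the symbols with non-coinciding points in $D-\{0\}$. The form $\langle(\Theta F)G\rangle$ on it is Hermitian and positive semidefinite; $\mathcal H$ is the completion of its quotient by the null space, and $\nu_0:\Upsilon_{0,D-\{0\}}\to\mathcal H$ is the canonical map. *Wick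 products.* Let $\Upsilon^w$ be the free algebra generated by the non-empty symbols $:\![m_1,z_1,\dots,m_n,z_n]\!:$ with $m_i\ge 1$, $z_i\in\mathbb C$. For a product $:\!Z^1\!:\cdots:\!Z^s\!:$ of symbols $:\!Z^i\!:\,=\,:\![m^i_1,z^i_1,\dots,m^i_{n_i},z^i_{n_i}]\!:$ in which no points coincide between different symbols put $$\langle :\!Z^1\!:\cdots:\!Z^s\!:\rangle=\sum_{P'}\prod_{\{(i,\alpha),(j,\beta)\}\in P'}C(m^i_\alpha,z^i_\alpha;m^j_\beta,z^j_\beta),$$ the sum over all pairings of all the fields that contain no pair with $i=j$, and extend linearly. Let $\Upsilon^w_{0,D}$ be the span of such products with all points in $D$ (points may coincide inside one symbol). Identify $[z_1,\dots,z_n]$ with $:\![1,z_1]\!:\cdots:\![1,z_n]\!:$. Let $\nu:\Upsilon^w_{0,D}\to\mathcal H$ be the unique linear map with $(\nu_0(G),\nu(F))=\langle(\Theta G)F\rangle$ for all $G\in\Upsilon_{0,D-\{0\}}$, $F\in\Upsilon^w_{0,D}$, and let $\mathcal D=\nu(\Upsilon^w_{0,D})$. *Discs.* Let $r\ge 1$,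 let $D_i=\{z:|z-a_i|<R_i\}$, $1\le i\le r$, $R_i>0$, be disjoint discs in $\mathbb C$ parametrized by $j_i(z)=a_i+q_iz$ with $|q_i|=R_i$, and let $J_i$ be the algebra automorphism of $\Upsilon^w$ with $$J_i:\![m_1,z_1,\dots,m_n,z_n]\!:\;=\;\Bigl(\prod_k q_i^{m_k}\Bigr):\![m_1,a_i+q_iz_1,\dots,m_n,a_i+q_iz_n]\!:.$$ Put $R=\sup_iR_i$ and $d=\inf_{i\ne j}|a_i-a_j|$ ($d=\infty$ if $r=1$). **Theorem.** The map $\nu$ exists, and $\mathcal D$ is dense in $\mathcal H$. If $d/R>4\sqrt r$, then there is a well-defined multilinear functional $\mathcal A_r$ on $\mathcal D\times\cdots\times\mathcal D$ ($r$ factors) with $$\mathcal A_r(\nu(F_1),\dots,\nu(F_r))=\langle(J_1F_1)\cdots(J_rF_r)\rangle\qquad(F_i\in\Upsilon^w_{0,D}),$$ and it is Hilbert–Schmidt: there is an orthonormal basis $\{\phi_\alpha\}$ of $\mathcal H$ with all $\phi_\alpha\in\mathcal D$ such that $$\|\mathcal A_r\|_{HS}^2=\sum_{\alpha_1,\dots,\alpha_r}|\mathcal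 A_r(\phi_{\alpha_1},\dots,\phi_{\alpha_r})|^2<\infty .$$ Hence $|\mathcal A_r(\mathcal F_1,\dots,\mathcal F_r)|\le\|\mathcal A_r\|_{HS}\,\|\mathcal F_1\|\cdots\|\mathcal F_r\|$ on $\mathcal D\times\cdots\times\mathcal D$, and $\mathcal A_r$ extends to a bounded multilinear functional on $\mathcal H\times\cdots\times\mathcal H$ that satisfies the same bound and is still Hilbert–Schmidt, with the same value of the Hilbert–Schmidt norm in every orthonormal basis of $\mathcal H$. -/

import Mathlib

open scoped ComplexConjugate BigOperators

noncomputable section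

namespace BosonSphere

/-! ### Pairings -/

/-- All pairings (perfect matchings) of the entries of a list: the head is paired with one of the
other entries, and the remaining entries are paired among themselves. A list of odd length has no
pairing, the empty list has exactly one. -/
def pairings {ι : Type*} : List ι → List (List (ι × ι))
  | [] => [[]]
  | x :: L => (List.finRange L.length).flatMap fun (i : Fin L.length) =>
      (pairings (L.eraseIdx i)).map fun P => (x, L.get i) :: P
termination_by L => L.length
decreasing_by
  simp [List.length_eraseIdx]

/-- The Gaussian (Wick) sum `∑_P ∏_{(x, y) ∈ P} c x y` over all pairings `P` of `L`. -/
def pairingSum {ι : Type*} (c : ι → ι → ℂ) (L : List ι) : ℂ :=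
  ((pairings L).map fun P => (P.map fun p => c p.1 p.2).prod).sum

/-! ### The algebra of products of first derivatives and its expectation -/

/-- The two-point function `⟨∂X(z) ∂X(w)⟩ = -(1/2) (z - w)⁻²` (used for `z ≠ w` only). -/
def twoPoint (z w : ℂ) : ℂ := -(1 / 2) / (z - w) ^ 2

/-- The free algebra on symbols `[z₁, …, zₙ]`, with juxtaposition as product; `[z₁, …, zₙ]` stands
for `∂X(z₁) ⋯ ∂X(zₙ)`. -/
abbrev Ups : Type := MonoidAlgebra ℂ (FreeMonoid ℂ)

/-- The expectation: the linear functional with `⟨[z₁, …, zₙ]⟩ = ∑_P ∏_{(α,β) ∈ P} C(z_α, z_β)`.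
It is meaningful on combinations of symbols with non-coinciding points. -/
def expect : Ups →ₗ[ℂ] ℂ :=
  Finsupp.linearCombination ℂ (fun Z : FreeMonoid ℂ => pairingSum twoPoint Z.toList) ∘ₗ
    (MonoidAlgebra.coeffLinearEquiv ℂ).toLinearMap

/-- The radial reflection: the antilinear map with
`Θ [z₁, …, zₙ] = (∏ i, -1 / (conj zᵢ)²) [1 / conj z₁, …, 1 / conj zₙ]`
(meaningful for symbols with nonzero points). -/
def Theta (F : Ups) : Ups :=
  F.coeff.sum fun Z c => MonoidAlgebra.single (Z.map fun z => 1 / conj z)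
    (conj c * (Z.toList.map fun z => -1 / (conj z) ^ 2).prod)

/-- Symbols `[z₁, …, zₙ]` with non-coinciding points in the punctured unit disc. -/
def puncturedWords : Set (FreeMonoid ℂ) :=
  {Z | Z.toList.Nodup ∧ ∀ z ∈ Z.toList, z ≠ 0 ∧ ‖z‖ < 1}

/-- The span of the symbols with non-coinciding points in the punctured unit disc. -/
def upsPunctured : Submodule ℂ Ups := MonoidAlgebra.supported ℂ ℂ puncturedWords

/-- The sesquilinear form `⟨(Θ F) G⟩`. -/
def reflForm (F G : Ups) : ℂ := expect (Theta F * G)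

/-! ### Reflection positivity -/

section Positivity

variable {ι κ : Type*}

/-- All ways of picking one entry of a list, with the list of the other entries. -/
def picks (L : List ι) : List (ι × List ι) :=
  (List.finRange L.length).map fun i => (L.get i, L.eraseIdx i)

lemma picks_cons (x : ι) (L : List ι) :
    picks (x :: L) = (x, L) :: (picks L).map fun p => (p.1, x :: p.2) := by
  simp [picks, List.finRange_succ, Function.comp_def]

lemma picks_map (f : ι → κ) (L : List ι) :
    picks (L.map f) = (picks L).map fun p => (f p.1, p.2.map f) := by
  induction L with
  | nil => simp [picks]
  | cons x L ih => simp [picks_cons, ih]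

lemma picks_append (A B : List ι) :
    picks (A ++ B) = ((picks A).map fun p => (p.1, p.2 ++ B)) ++
      ((picks B).map fun p => (p.1, A ++ p.2)) := by
  induction A with
  | nil => simp [picks]
  | cons x A ih => simp [picks_cons, ih, Function.comp_def]

lemma picks_length {L : List ι} {p : ι × List ι} (h : p ∈ picks L) :
    p.2.length + 1 = L.length := by
  induction L generalizing p with
  | nil => simp [picks] at h
  | cons x L ih =>
    simp only [picks_cons, List.mem_cons, List.mem_map] at h
    rcases h with rfl | ⟨q, hq, rfl⟩
    · simp
    · simp [← ih hq]

lemma picks_perm {L : List ι} {p : ι × List ι} (h : p ∈ picks L) : (p.1 :: p.2).Perm L := by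
  induction L generalizing p with
  | nil => simp [picks] at h
  | cons x L ih =>
    simp only [picks_cons, List.mem_cons, List.mem_map] at h
    rcases h with rfl | ⟨q, hq, rfl⟩
    · simp
    · exact (List.Perm.swap _ _ _).trans ((ih hq).cons x)

lemma picks_swap {M : Type*} [AddCommMonoid M] (f : ι → ι → List ι → M) (L : List ι) :
    ((picks L).map fun p => ((picks p.2).map fun q => f p.1 q.1 q.2).sum).sum =
      ((picks L).map fun p => ((picks p.2).map fun q => f q.1 p.1 q.2).sum).sum := by
  induction L generalizing f with
  | nil => simp [picks]
  | cons x L ih =>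
    simp only [picks_cons, List.map_cons, List.sum_cons, List.map_map, Function.comp_def,
      List.sum_map_add]
    rw [ih fun a b l => f a b (x :: l)]
    abel

lemma pairingSum_nil (c : ι → ι → ℂ) : pairingSum c [] = 1 := by
  simp [pairingSum, pairings]

lemma sum_flatMap_aux {α β : Type*} (l : List α) (f : α → List β) (g : β → ℂ) :
    ((l.flatMap f).map g).sum = (l.map fun a => ((f a).map g).sum).sum := by
  induction l with
  | nil => simp
  | cons a l ih => simp [ih]

lemma pairingSum_cons (c : ι → ι → ℂ) (x : ι) (L : List ι) :
    pairingSum c (x :: L) = ((picks L).map fun p => c x p.1 * pairingSum c p.2).sum := by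
  simp only [pairingSum, picks]
  rw [pairings, sum_flatMap_aux]
  simp [Function.comp_def, List.sum_map_mul_left]

lemma pairingSum_map (c : κ → κ → ℂ) (f : ι → κ) (L : List ι) :
    pairingSum c (L.map f) = pairingSum (fun x y => c (f x) (f y)) L := by
  induction h : L.length using Nat.strong_induction_on generalizing L with
  | _ n ih =>
  cases L with
  | nil => simp [pairingSum_nil]
  | cons x L =>
    rw [List.map_cons, pairingSum_cons, pairingSum_cons, picks_map, List.map_map]
    congr 1
    refine List.map_congr_left fun p hp => ?_
    have := picks_length hp
    simp only [List.length_cons] at h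
    simp only [Function.comp_apply]
    rw [ih p.2.length (by omega) p.2 rfl]

lemma pairingSum_congr {c c' : ι → ι → ℂ} {s : Set ι} (hc : ∀ x ∈ s, ∀ y ∈ s, c x y = c' x y)
    (L : List ι) (hL : ∀ x ∈ L, x ∈ s) : pairingSum c L = pairingSum c' L := by
  induction h : L.length using Nat.strong_induction_on generalizing L with
  | _ n ih =>
  cases L with
  | nil => simp [pairingSum_nil]
  | cons x L =>
    rw [pairingSum_cons, pairingSum_cons]
    congr 1
    refine List.map_congr_left fun p hp => ?_
    have h1 := picks_length hp
    have h2 := picks_perm hp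
    simp only [List.length_cons] at h
    have hm : ∀ y ∈ p.1 :: p.2, y ∈ s := fun y hy =>
      hL y (List.mem_cons_of_mem _ (h2.subset hy))
    rw [ih p.2.length (by omega) p.2 (fun y hy => hm y (List.mem_cons_of_mem _ hy)) rfl,
      hc x (hL x List.mem_cons_self) p.1 (hm _ List.mem_cons_self)]

lemma pairingSum_weight (c : ι → ι → ℂ) (w : ι → ℂ) (L : List ι) :
    pairingSum (fun x y => w x * w y * c x y) L = (L.map w).prod * pairingSum c L := by
  induction h : L.length using Nat.strong_induction_on generalizing L with
  | _ n ih =>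
  cases L with
  | nil => simp [pairingSum_nil]
  | cons x L =>
    rw [pairingSum_cons, pairingSum_cons, List.map_cons, List.prod_cons, ← List.sum_map_mul_left]
    congr 1
    refine List.map_congr_left fun p hp => ?_
    have h1 := picks_length hp
    simp only [List.length_cons] at h
    rw [ih p.2.length (by omega) p.2 rfl, ← ((picks_perm hp).map w).prod_eq, List.map_cons,
      List.prod_cons]
    ring

lemma tendsto_pairingSum {c : ℕ → ι → ι → ℂ} {c' : ι → ι → ℂ} {s : Set ι}
    (hc : ∀ x ∈ s, ∀ y ∈ s, Filter.Tendsto (fun N => c N x y) Filter.atTop (nhds (c' x y)))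
    (L : List ι) (hL : ∀ x ∈ L, x ∈ s) :
    Filter.Tendsto (fun N => pairingSum (c N) L) Filter.atTop (nhds (pairingSum c' L)) := by
  induction h : L.length using Nat.strong_induction_on generalizing L with
  | _ n ih =>
  cases L with
  | nil => simp [pairingSum_nil]
  | cons x L =>
    simp only [pairingSum_cons]
    refine tendsto_list_sum _ fun p hp => ?_
    have h1 := picks_length hp
    have h2 := picks_perm hp
    simp only [List.length_cons] at h
    have hm : ∀ y ∈ p.1 :: p.2, y ∈ s := fun y hy =>
      hL y (List.mem_cons_of_mem _ (h2.subset hy))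
    exact (hc x (hL x List.mem_cons_self) p.1 (hm _ List.mem_cons_self)).mul
      (ih p.2.length (by omega) p.2 (fun y hy => hm y (List.mem_cons_of_mem _ hy)) rfl)

/-- The weight `∏ k, (α k)!`. -/
def multiFact (α : ℕ →₀ ℕ) : ℝ := α.prod fun _ n => (n.factorial : ℝ)

lemma multiFact_nonneg (α : ℕ →₀ ℕ) : 0 ≤ multiFact α :=
  Finset.prod_nonneg fun _ _ => by positivity

lemma multiFact_add_single (α : ℕ →₀ ℕ) (i : ℕ) :
    multiFact (α + Finsupp.single i 1) = multiFact α * (α i + 1) := by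
  classical
  have key : ∀ β : ℕ →₀ ℕ, β.support ⊆ insert i α.support →
      multiFact β = ∏ k ∈ insert i α.support, ((β k).factorial : ℝ) := fun β hβ =>
    Finsupp.prod_of_support_subset _ hβ _ (by simp)
  rw [key α (Finset.subset_insert _ _), key _ (by
    intro k hk
    by_cases hki : k = i
    · simp [hki]
    · have : α k ≠ 0 := by simpa [Finsupp.single_apply, Ne.symm hki] using hk
      simp [this])]
  rw [← Finset.mul_prod_erase _ _ (Finset.mem_insert_self i _),
    ← Finset.mul_prod_erase _ (fun k => ((α k).factorial : ℝ)) (Finset.mem_insert_self i _)]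
  have : ∏ k ∈ (insert i α.support).erase i, (((α + Finsupp.single i 1 : ℕ →₀ ℕ) k).factorial : ℝ) =
      ∏ k ∈ (insert i α.support).erase i, ((α k).factorial : ℝ) := by
    refine Finset.prod_congr rfl fun k hk => ?_
    have := (Finset.mem_erase.1 hk).1
    simp [Ne.symm this]
  rw [this]
  simp [Nat.factorial_succ]
  ring

/-- The Fock inner product on polynomials. -/
def fockInner (p q : MvPolynomial ℕ ℂ) : ℂ :=
  ∑ α ∈ p.support, (multiFact α : ℂ) * (conj (p.coeff α) * q.coeff α)

lemma fockInner_eq {p : MvPolynomial ℕ ℂ} (q : MvPolynomial ℕ ℂ) {s : Finset (ℕ →₀ ℕ)}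
    (h : p.support ⊆ s) :
    fockInner p q = ∑ α ∈ s, (multiFact α : ℂ) * (conj (p.coeff α) * q.coeff α) :=
  Finset.sum_subset h fun α _ hα => by simp [MvPolynomial.notMem_support_iff.1 hα]

lemma fockInner_add_left (p p' q : MvPolynomial ℕ ℂ) :
    fockInner (p + p') q = fockInner p q + fockInner p' q := by
  classical
  rw [fockInner_eq q MvPolynomial.support_add, fockInner_eq q Finset.subset_union_left,
    fockInner_eq q (Finset.subset_union_right (s₁ := p.support)), ← Finset.sum_add_distrib]
  refine Finset.sum_congr rfl fun α _ => ?_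
  simp
  ring

lemma fockInner_smul_left (a : ℂ) (p q : MvPolynomial ℕ ℂ) :
    fockInner (a • p) q = conj a * fockInner p q := by
  rw [fockInner_eq q (MvPolynomial.support_smul (a := a) (f := p)), fockInner, Finset.mul_sum]
  refine Finset.sum_congr rfl fun α _ => ?_
  simp
  ring

lemma fockInner_symm (p q : MvPolynomial ℕ ℂ) : conj (fockInner q p) = fockInner p q := by
  classical
  rw [fockInner_eq q (Finset.subset_union_left (s₂ := q.support)),
    fockInner_eq p (Finset.subset_union_right (s₁ := p.support)), map_sum]
  refine Finset.sum_congr rfl fun α _ => ?_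
  simp only [map_mul, Complex.conj_ofReal, Complex.conj_conj]
  ring

lemma fockInner_nonneg (p : MvPolynomial ℕ ℂ) : 0 ≤ (fockInner p p).re := by
  rw [fockInner, Complex.re_sum]
  refine Finset.sum_nonneg fun α _ => ?_
  rw [Complex.re_ofReal_mul, ← Complex.normSq_eq_conj_mul_self, Complex.ofReal_re]
  exact mul_nonneg (multiFact_nonneg _) (Complex.normSq_nonneg _)

/-- The Fock inner product as a linear functional of its second argument. -/
def fockLin (p : MvPolynomial ℕ ℂ) : MvPolynomial ℕ ℂ →ₗ[ℂ] ℂ where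
  toFun q := fockInner p q
  map_add' q q' := by simp [fockInner, mul_add, Finset.sum_add_distrib]
  map_smul' a q := by
    simp only [fockInner, MvPolynomial.coeff_smul, smul_eq_mul, RingHom.id_apply, Finset.mul_sum]
    exact Finset.sum_congr rfl fun α _ => by ring

lemma fockInner_X_mul (i : ℕ) (p q : MvPolynomial ℕ ℂ) :
    fockInner (MvPolynomial.X i * p) q = fockInner p (MvPolynomial.pderiv i q) := by
  induction p using MvPolynomial.induction_on' with
  | add p p' h h' => rw [mul_add, fockInner_add_left, fockInner_add_left, h, h']
  | monomial α a =>
    rw [mul_comm, MvPolynomial.X, MvPolynomial.monomial_mul, mul_one,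
      fockInner_eq q MvPolynomial.support_monomial_subset,
      fockInner_eq _ MvPolynomial.support_monomial_subset]
    simp [multiFact_add_single, MvPolynomial.coeff_pderiv]
    ring

/-- The one-particle vector with coefficients `b 0, …, b (N - 1)`. -/
def oneVec (N : ℕ) (b : ℕ → ℂ) : MvPolynomial ℕ ℂ :=
  ∑ k ∈ Finset.range N, b k • MvPolynomial.X k

/-- The annihilation operator of `oneVec N b`. -/
def annih (N : ℕ) (b : ℕ → ℂ) : MvPolynomial ℕ ℂ →ₗ[ℂ] MvPolynomial ℕ ℂ :=
  ∑ k ∈ Finset.range N, conj (b k) • (MvPolynomial.pderiv k).toLinearMap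

lemma fockInner_oneVec_mul (N : ℕ) (b : ℕ → ℂ) (p q : MvPolynomial ℕ ℂ) :
    fockInner (oneVec N b * p) q = fockInner p (annih N b q) := by
  have hl : ∀ f : ℕ → MvPolynomial ℕ ℂ, fockInner (∑ k ∈ Finset.range N, f k) q =
      ∑ k ∈ Finset.range N, fockInner (f k) q := fun f => by
    induction N with
    | zero => simp [fockInner]
    | succ n ih => rw [Finset.sum_range_succ, fockInner_add_left, ih, Finset.sum_range_succ]
  change _ = fockLin p _
  rw [oneVec, annih, Finset.sum_mul, hl, LinearMap.sum_apply, map_sum]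
  refine Finset.sum_congr rfl fun k _ => ?_
  rw [smul_mul_assoc, fockInner_smul_left, fockInner_X_mul, LinearMap.smul_apply, map_smul]
  rfl

lemma annih_oneVec_mul (N : ℕ) (b b' : ℕ → ℂ) (p : MvPolynomial ℕ ℂ) :
    annih N b (oneVec N b' * p) =
      (∑ k ∈ Finset.range N, conj (b k) * b' k) • p + oneVec N b' * annih N b p := by
  have h : ∀ k ∈ Finset.range N, MvPolynomial.pderiv k (oneVec N b') = MvPolynomial.C (b' k) := by
    intro k hk
    rw [oneVec, map_sum, Finset.sum_eq_single k]
    · simp [MvPolynomial.smul_eq_C_mul]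
    · intro j _ hj
      simp [MvPolynomial.pderiv_X_of_ne hj]
    · exact fun h => absurd hk h
  simp only [annih, LinearMap.sum_apply, LinearMap.smul_apply, Derivation.coeFn_coe,
    Derivation.leibniz, smul_add, Finset.sum_add_distrib, Finset.sum_smul, Finset.mul_sum,
    smul_eq_mul]
  rw [add_comm]
  congr 1
  · refine Finset.sum_congr rfl fun k hk => ?_
    rw [h k hk, mul_comm p, ← MvPolynomial.smul_eq_C_mul, smul_smul]
  · exact Finset.sum_congr rfl fun k _ => by rw [mul_smul_comm]

/-- The Fock vector of a product of fields. -/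
def fockVec (N : ℕ) (b : ι → ℕ → ℂ) (c : ι → ι → ℂ) : List ι → MvPolynomial ℕ ℂ
  | [] => 1
  | x :: L => oneVec N (b x) * fockVec N b c L +
      ((List.finRange L.length).map fun (i : Fin L.length) =>
        c x (L.get i) • fockVec N b c (L.eraseIdx i)).sum
termination_by L => L.length
decreasing_by
  · simp
  · have := i.isLt
    simp [List.length_eraseIdx]

lemma fockVec_cons (N : ℕ) (b : ι → ℕ → ℂ) (c : ι → ι → ℂ) (x : ι) (L : List ι) :
    fockVec N b c (x :: L) = oneVec N (b x) * fockVec N b c L +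
      ((picks L).map fun p => c x p.1 • fockVec N b c p.2).sum := by
  rw [fockVec, picks, List.map_map]
  rfl

lemma annih_fockVec (N : ℕ) (b : ι → ℕ → ℂ) (c : ι → ι → ℂ) (b' : ℕ → ℂ) (L : List ι) :
    annih N b' (fockVec N b c L) = ((picks L).map fun p =>
      (∑ k ∈ Finset.range N, conj (b' k) * b p.1 k) • fockVec N b c p.2).sum := by
  induction h : L.length using Nat.strong_induction_on generalizing L with
  | _ n ih =>
  cases L with
  | nil => simp [fockVec, picks, annih]
  | cons x L =>
    simp only [List.length_cons] at h
    set K : ι → ℂ := fun y => ∑ k ∈ Finset.range N, conj (b' k) * b y k with hK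
    have e1 : annih N b' (((picks L).map fun p => c x p.1 • fockVec N b c p.2).sum) =
        ((picks L).map fun p => ((picks p.2).map fun q =>
          (c x p.1 * K q.1) • fockVec N b c q.2).sum).sum := by
      rw [map_list_sum, List.map_map]
      congr 1
      refine List.map_congr_left fun p hp => ?_
      have := picks_length hp
      rw [Function.comp_apply, map_smul, ih p.2.length (by omega) p.2 rfl, List.smul_sum,
        List.map_map]
      simp [Function.comp_def, smul_smul, hK]
    rw [fockVec_cons, map_add, annih_oneVec_mul, e1, ih L.length (by omega) L rfl,
      picks_swap (fun y y' M => (c x y * K y') • fockVec N b c M), picks_cons, List.map_cons,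
      List.sum_cons, List.map_map]
    simp only [Function.comp_def, fockVec_cons, smul_add, List.sum_map_add, List.smul_sum,
      List.map_map, smul_smul, ← List.sum_map_mul_left, mul_smul_comm, add_assoc]
    simp only [hK, mul_comm]

/-- The contraction between reflected fields (left) and fields (right). -/
def mixed (N : ℕ) (b : ι → ℕ → ℂ) (c : ι → ι → ℂ) : ι ⊕ ι → ι ⊕ ι → ℂ
  | .inl z, .inl w => conj (c z w)
  | .inl z, .inr w => ∑ k ∈ Finset.range N, conj (b z k) * b w k
  | .inr w, .inl z => ∑ k ∈ Finset.range N, conj (b z k) * b w k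
  | .inr z, .inr w => c z w

lemma fockInner_fockVec (N : ℕ) (b : ι → ℕ → ℂ) (c : ι → ι → ℂ) (Z W : List ι) :
    fockInner (fockVec N b c Z) (fockVec N b c W) =
      pairingSum (mixed N b c) (Z.map Sum.inl ++ W.map Sum.inr) := by
  induction h : Z.length + W.length using Nat.strong_induction_on generalizing Z W with
  | _ n ih =>
  have hsumr : ∀ (p : MvPolynomial ℕ ℂ) (l : List (MvPolynomial ℕ ℂ)),
      fockInner p l.sum = (l.map fun q => fockInner p q).sum := fun p l =>
    map_list_sum (fockLin p) l
  have hsuml : ∀ (p : MvPolynomial ℕ ℂ) (l : List (MvPolynomial ℕ ℂ)),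
      fockInner l.sum p = (l.map fun q => fockInner q p).sum := fun p l => by
    induction l with
    | nil => simp [fockInner]
    | cons q l ihl => simp [fockInner_add_left, ihl]
  have hsmul : ∀ (p q : MvPolynomial ℕ ℂ) (a : ℂ), fockInner p (a • q) = a * fockInner p q :=
    fun p q a => map_smul (fockLin p) a q
  cases Z with
  | nil =>
    cases W with
    | nil =>
      have : fockInner 1 1 = 1 := by
        rw [fockInner_eq (s := {0}) _ MvPolynomial.support_one.le]
        simp [multiFact]
      simpa [fockVec, pairingSum_nil] using this
    | cons w W =>
      have h0 : fockInner (fockVec N b c []) (oneVec N (b w) * fockVec N b c W) = 0 := by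
        rw [← fockInner_symm, fockInner_oneVec_mul, annih_fockVec]
        simp [picks, fockInner]
      rw [fockVec_cons, show fockInner (fockVec N b c []) (oneVec N (b w) * fockVec N b c W +
          ((picks W).map fun p => c w p.1 • fockVec N b c p.2).sum) = fockInner (fockVec N b c [])
          (oneVec N (b w) * fockVec N b c W) + fockInner (fockVec N b c [])
          ((picks W).map fun p => c w p.1 • fockVec N b c p.2).sum from
          map_add (fockLin _) _ _, h0, zero_add, hsumr, List.map_map, List.map_nil, List.nil_append,
        List.map_cons, pairingSum_cons, picks_map, List.map_map]
      congr 1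
      refine List.map_congr_left fun p hp => ?_
      have h1 := picks_length hp
      simp only [List.length_cons, List.length_nil] at h
      simp only [Function.comp_apply]
      rw [hsmul, ih p.2.length (by omega) [] p.2 (by simp)]
      simp [mixed]
  | cons z Z =>
    simp only [List.length_cons] at h
    rw [fockVec_cons, fockInner_add_left, fockInner_oneVec_mul, annih_fockVec, hsumr, hsuml,
      List.map_map, List.map_map, List.map_cons, List.cons_append, pairingSum_cons, picks_append,
      picks_map, picks_map, List.map_append, List.sum_append, List.map_map, List.map_map,
      List.map_map, List.map_map, add_comm]
    congr 2
    · refine List.map_congr_left fun p hp => ?_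
      have h1 := picks_length hp
      simp only [Function.comp_apply]
      rw [fockInner_smul_left, ih (p.2.length + W.length) (by omega) p.2 W rfl]
      simp [mixed]
    · refine List.map_congr_left fun p hp => ?_
      have h1 := picks_length hp
      simp only [Function.comp_apply]
      rw [hsmul, ih (Z.length + p.2.length) (by omega) Z p.2 rfl]
      simp [mixed]

lemma fockInner_sum_left {τ : Type*} (s : Finset τ) (f : τ → MvPolynomial ℕ ℂ)
    (q : MvPolynomial ℕ ℂ) : fockInner (∑ i ∈ s, f i) q = ∑ i ∈ s, fockInner (f i) q := by
  classical
  induction s using Finset.induction_on with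
  | empty => simp [fockInner]
  | insert a s ha ih => rw [Finset.sum_insert ha, fockInner_add_left, ih, Finset.sum_insert ha]

/-- The one-particle coefficients `√((k + 1) / 2) z ^ k`. -/
def coeffVec (z : ℂ) (k : ℕ) : ℂ := (√(((k : ℝ) + 1) / 2) : ℝ) * z ^ k

lemma coeffVec_mul (z w : ℂ) (k : ℕ) :
    conj (coeffVec z k) * coeffVec w k = 1 / 2 * (((k + 1 : ℕ) : ℂ) * (conj z * w) ^ k) := by
  have h : ((√(((k : ℝ) + 1) / 2) : ℝ) : ℂ) * (√(((k : ℝ) + 1) / 2) : ℝ) = ((k : ℂ) + 1) / 2 := by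
    rw [← Complex.ofReal_mul, Real.mul_self_sqrt (by positivity)]
    push_cast
    rfl
  simp only [coeffVec, map_mul, Complex.conj_ofReal, map_pow]
  rw [mul_mul_mul_comm, h, mul_pow]
  push_cast
  ring

lemma tendsto_coeffVec {z w : ℂ} (hz : ‖z‖ < 1) (hw : ‖w‖ < 1) :
    Filter.Tendsto (fun N => ∑ k ∈ Finset.range N, conj (coeffVec z k) * coeffVec w k)
      Filter.atTop (nhds (1 / 2 / (1 - conj z * w) ^ 2)) := by
  have hzw : ‖conj z * w‖ < 1 := by
    rw [norm_mul, RCLike.norm_conj]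
    exact mul_lt_one_of_nonneg_of_lt_one_left (norm_nonneg _) hz hw.le
  have := ((hasSum_choose_mul_geometric_of_norm_lt_one 1 hzw).mul_left (1 / 2)).tendsto_sum_nat
  simp only [coeffVec_mul]
  simpa [div_eq_mul_inv] using this

/-- The matrix elements of the form `⟨(Θ F) G⟩` between symbols. -/
def kernel (Z W : List ℂ) : ℂ :=
  (Z.map fun z => -1 / (conj z) ^ 2).prod *
    pairingSum twoPoint ((Z.map fun z => 1 / conj z) ++ W)

lemma tendsto_kernel {Z W : List ℂ} (hZ : ∀ z ∈ Z, z ≠ 0 ∧ ‖z‖ < 1)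
    (hW : ∀ z ∈ W, z ≠ 0 ∧ ‖z‖ < 1) :
    Filter.Tendsto (fun N => fockInner (fockVec N coeffVec twoPoint Z)
      (fockVec N coeffVec twoPoint W)) Filter.atTop (nhds (kernel Z W)) := by
  let pt : ℂ ⊕ ℂ → ℂ := Sum.elim (fun z => 1 / conj z) id
  let wt : ℂ ⊕ ℂ → ℂ := Sum.elim (fun z => -1 / (conj z) ^ 2) fun _ => 1
  let s : Set (ℂ ⊕ ℂ) := {x | Sum.elim id id x ≠ 0 ∧ ‖Sum.elim id id x‖ < 1}
  have hk : kernel Z W = pairingSum (fun x y => wt x * wt y * twoPoint (pt x) (pt y))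
      (Z.map Sum.inl ++ W.map Sum.inr) := by
    rw [pairingSum_weight (fun x y => twoPoint (pt x) (pt y)) wt, ← pairingSum_map twoPoint pt,
      kernel]
    congr 1
    · simp [wt, Function.comp_def]
    · simp [pt, Function.comp_def]
  simp only [fockInner_fockVec]
  rw [hk]
  refine tendsto_pairingSum (s := s) ?_ _ ?_
  · have key : ∀ z w : ℂ, z ≠ 0 → -1 / (conj z) ^ 2 * twoPoint (1 / conj z) w =
        1 / 2 / (1 - conj z * w) ^ 2 := by
      intro z w hz
      have hz' : conj z ≠ 0 := by simpa using hz
      rw [twoPoint, show 1 / conj z - w = (1 - conj z * w) / conj z by field_simp, div_pow]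
      by_cases h : 1 - conj z * w = 0
      · simp [h]
      · field_simp
    rintro (z | z) ⟨hz0, hz1⟩ (w | w) ⟨hw0, hw1⟩
    · simp only [Sum.elim_inl, id] at hz0 hw0
      have hz' : conj z ≠ 0 := by simpa using hz0
      have hw' : conj w ≠ 0 := by simpa using hw0
      have : conj (twoPoint z w) = -1 / (conj z) ^ 2 * (-1 / (conj w) ^ 2) *
          twoPoint (1 / conj z) (1 / conj w) := by
        rw [twoPoint, twoPoint, show 1 / conj z - 1 / conj w = -(conj z - conj w) /
          (conj z * conj w) by field_simp; ring]
        simp only [map_div₀, map_neg, map_one, map_pow, map_sub, map_ofNat]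
        by_cases h : conj z - conj w = 0
        · simp [h]
        · field_simp
      simp only [mixed, wt, pt, Sum.elim_inl, this]
      exact tendsto_const_nhds
    · simp only [Sum.elim_inl, Sum.elim_inr, id] at hz0 hz1 hw1
      simp only [mixed, wt, pt, Sum.elim_inl, Sum.elim_inr, id, mul_one, key z w hz0]
      exact tendsto_coeffVec hz1 hw1
    · simp only [Sum.elim_inl, Sum.elim_inr, id] at hw0 hz1 hw1
      have hsymm : twoPoint z (1 / conj w) = twoPoint (1 / conj w) z := by
        rw [twoPoint, twoPoint, ← neg_sub, neg_sq]
      simp only [mixed, wt, pt, Sum.elim_inl, Sum.elim_inr, id, one_mul, hsymm, key w z hw0]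
      exact tendsto_coeffVec hw1 hz1
    · simp only [mixed, wt, pt, Sum.elim_inr, id, one_mul]
      exact tendsto_const_nhds
  · intro x hx
    simp only [List.mem_append, List.mem_map] at hx
    rcases hx with ⟨z, hz, rfl⟩ | ⟨z, hz, rfl⟩
    · exact hZ z hz
    · exact hW z hz

lemma expect_single (Z : FreeMonoid ℂ) (c : ℂ) :
    expect (MonoidAlgebra.single Z c) = c * pairingSum twoPoint Z.toList := by
  simp [expect]

lemma reflForm_eq (F G : Ups) : reflForm F G = ∑ Z ∈ F.coeff.support, ∑ W ∈ G.coeff.support,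
    conj (F.coeff Z) * (G.coeff W * kernel Z.toList W.toList) := by
  have hG : G = ∑ W ∈ G.coeff.support, MonoidAlgebra.single W (G.coeff W) :=
    (MonoidAlgebra.sum_coeff_single G).symm
  rw [reflForm, Theta, Finsupp.sum, Finset.sum_mul, map_sum]
  refine Finset.sum_congr rfl fun Z _ => ?_
  conv_lhs => rw [hG]
  rw [Finset.mul_sum, map_sum]
  refine Finset.sum_congr rfl fun W _ => ?_
  rw [MonoidAlgebra.single_mul_single, expect_single, kernel, FreeMonoid.toList_mul,
    FreeMonoid.toList_map]
  ring

/-- The Fock vector of an element of the algebra. -/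
def fockOf (N : ℕ) (F : Ups) : MvPolynomial ℕ ℂ :=
  ∑ Z ∈ F.coeff.support, F.coeff Z • fockVec N coeffVec twoPoint Z.toList

lemma tendsto_reflForm {F G : Ups} (hF : F ∈ upsPunctured) (hG : G ∈ upsPunctured) :
    Filter.Tendsto (fun N => fockInner (fockOf N F) (fockOf N G)) Filter.atTop
      (nhds (reflForm F G)) := by
  rw [reflForm_eq]
  have h : ∀ N, fockInner (fockOf N F) (fockOf N G) = ∑ Z ∈ F.coeff.support,
      ∑ W ∈ G.coeff.support, conj (F.coeff Z) * (G.coeff W *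
        fockInner (fockVec N coeffVec twoPoint Z.toList)
          (fockVec N coeffVec twoPoint W.toList)) := by
    intro N
    rw [fockOf, fockInner_sum_left]
    refine Finset.sum_congr rfl fun Z _ => ?_
    change fockLin _ _ = _
    rw [fockOf, map_sum]
    refine Finset.sum_congr rfl fun W _ => ?_
    rw [map_smul]
    change _ * fockInner _ _ = _
    rw [fockInner_smul_left]
    ring
  simp only [h]
  refine tendsto_finsetSum _ fun Z hZ => tendsto_finsetSum _ fun W hW => ?_
  exact ((tendsto_kernel (hF hZ).2 (hG hW).2).const_mul _).const_mul _

lemma reflForm_symm {F G : Ups} (hF : F ∈ upsPunctured) (hG : G ∈ upsPunctured) :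
    conj (reflForm G F) = reflForm F G := by
  refine tendsto_nhds_unique ?_ (tendsto_reflForm hF hG)
  have := (Complex.continuous_conj.tendsto _).comp (tendsto_reflForm hG hF)
  simpa [Function.comp_def, fockInner_symm] using this

/-- Reflection positivity. -/
lemma reflForm_nonneg {F : Ups} (hF : F ∈ upsPunctured) : 0 ≤ (reflForm F F).re :=
  ge_of_tendsto' ((Complex.continuous_re.tendsto _).comp (tendsto_reflForm hF hF))
    fun _ => fockInner_nonneg _

lemma Theta_add (F G : Ups) : Theta (F + G) = Theta F + Theta G := by
  rw [Theta, MonoidAlgebra.coeff_add, Finsupp.sum_add_index']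
  · rfl
  · simp
  · intro Z c d
    rw [map_add, add_mul, MonoidAlgebra.single_add]

lemma Theta_smul (a : ℂ) (F : Ups) : Theta (a • F) = conj a • Theta F := by
  rw [Theta, MonoidAlgebra.coeff_smul, Finsupp.sum_smul_index' (by simp), Theta, Finsupp.smul_sum]
  refine Finsupp.sum_congr fun Z _ => ?_
  simp [mul_assoc]

end Positivity

/-! ### The Hilbert space -/

/-- The span of the symbols with non-coinciding points in the punctured unit disc, to be equipped
with the form `⟨(Θ F) G⟩`. -/
def PreHilb : Type := upsPunctured

instance : AddCommGroup PreHilb := inferInstanceAs (AddCommGroup upsPunctured)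

instance : Module ℂ PreHilb := inferInstanceAs (Module ℂ upsPunctured)

/-- The underlying element of the algebra. -/
def PreHilb.val : PreHilb →ₗ[ℂ] Ups := upsPunctured.subtype

instance preHilbCore : PreInnerProductSpace.Core ℂ PreHilb where
  inner F G := reflForm F.val G.val
  conj_inner_symm F G := reflForm_symm F.2 G.2
  re_inner_nonneg F := reflForm_nonneg F.2
  add_left F G K := by simp [reflForm, Theta_add, add_mul]
  smul_left F G a := by simp [reflForm, Theta_smul]

instance : SeminormedAddCommGroup PreHilb :=
  InnerProductSpace.Core.toSeminormedAddCommGroup (𝕜 := ℂ)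

instance : InnerProductSpace ℂ PreHilb := InnerProductSpace.ofCore preHilbCore

/-- The Hilbert space: the completion of the quotient of the span of the symbols with
non-coinciding points in the punctured unit disc by the null space of the form `⟨(Θ F) G⟩`. -/
abbrev Hilb : Type := UniformSpace.Completion (SeparationQuotient PreHilb)

/-- The map `ν₀` to equivalence classes. -/
def nu0 : PreHilb →ₗ[ℂ] Hilb :=
  (UniformSpace.Completion.toComplL (𝕜 := ℂ) (E := SeparationQuotient PreHilb)).toLinearMap ∘ₗ
    (SeparationQuotient.mkCLM ℂ PreHilb).toLinearMap

lemma inner_nu0 (F G : PreHilb) : inner ℂ (nu0 F) (nu0 G) = expect (Theta F.val * G.val) := by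
  change inner ℂ ((SeparationQuotient.mk F : SeparationQuotient PreHilb) : Hilb)
    ((SeparationQuotient.mk G : SeparationQuotient PreHilb) : Hilb) = _
  rw [UniformSpace.Completion.inner_coe]
  rfl

/-! ### Wick products -/

/-- A field `∂^m X(z)` with `m ≥ 1`, encoded as the pair `(m, z)`. -/
abbrev Leg : Type := ℕ+ × ℂ

/-- The two-point function
`⟨∂^{m₁}X(z₁) ∂^{m₂}X(z₂)⟩ = ∂_{z₁}^{m₁-1} ∂_{z₂}^{m₂-1} (-(1/2) (z₁ - z₂)⁻²)
  = (1/2) (m₁ + m₂ - 1)! (-1)^{m₁} / (z₁ - z₂)^{m₁ + m₂}` (used for `z₁ ≠ z₂` only). -/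
def legTwoPoint (p q : Leg) : ℂ :=
  1 / 2 * (((p.1 : ℕ) + q.1 - 1).factorial : ℂ) * (-1) ^ (p.1 : ℕ) /
    (p.2 - q.2) ^ ((p.1 : ℕ) + q.1)

/-- Non-empty symbols `:[m₁, z₁, …, mₙ, zₙ]:`. -/
abbrev WickSymbol : Type := {Z : List Leg // Z ≠ []}

/-- The free algebra generated by the Wick symbols; its basis consists of the finite products
`:Z¹: ⋯ :Zʳ:`, the empty product included. -/
abbrev UpsW : Type := MonoidAlgebra ℂ (FreeMonoid WickSymbol)

/-- All fields of a product `:Z¹: ⋯ :Zʳ:`, each labelled with the position of its Wick symbol. -/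
def wickLegs (W : FreeMonoid WickSymbol) : List (ℕ × Leg) :=
  W.toList.zipIdx.flatMap fun p => p.1.1.map fun l => (p.2, l)

/-- The two-point function, with pairings inside one Wick product suppressed. -/
def wickTwoPoint (p q : ℕ × Leg) : ℂ := if p.1 = q.1 then 0 else legTwoPoint p.2 q.2

/-- The expectation on products of Wick symbols: the linear functional with
`⟨:Z¹: ⋯ :Zʳ:⟩ = ∑_P ∏_{((i,α),(j,β)) ∈ P} C(m^i_α, z^i_α, m^j_β, z^j_β)`, where `P` runs over the
pairings of all fields without pairs inside one Wick symbol. It is meaningful on combinations of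
products in which no points coincide between different Wick symbols. -/
def wickExpect : UpsW →ₗ[ℂ] ℂ :=
  Finsupp.linearCombination ℂ
      (fun W : FreeMonoid WickSymbol => pairingSum wickTwoPoint (wickLegs W)) ∘ₗ
    (MonoidAlgebra.coeffLinearEquiv ℂ).toLinearMap

/-- Products of Wick symbols with all points in the unit disc, in which no points coincide between
different Wick symbols (within a Wick symbol points may coincide). -/
def discWickWords : Set (FreeMonoid WickSymbol) :=
  {W | (∀ Z ∈ W.toList, ∀ l ∈ Z.1, ‖l.2‖ < 1) ∧
    W.toList.Pairwise fun Z Z' => ∀ l ∈ Z.1, ∀ l' ∈ Z'.1, l.2 ≠ l'.2}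

/-- The span of these products. -/
def upsWDisc : Submodule ℂ UpsW := MonoidAlgebra.supported ℂ ℂ discWickWords

/-- The symbol `[z₁, …, zₙ]` regarded as the product `:[1, z₁]: ⋯ :[1, zₙ]:`. -/
def toWick : Ups →ₐ[ℂ] UpsW :=
  MonoidAlgebra.lift ℂ UpsW (FreeMonoid ℂ) (FreeMonoid.lift fun z =>
    MonoidAlgebra.single (FreeMonoid.of (⟨[(1, z)], List.cons_ne_nil _ _⟩ : WickSymbol)) 1)

/-- `v` represents `F` if `(ν₀(G), v) = ⟨(Θ G) F⟩` for all `G`. As `ν₀` has dense range there is at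
most one such `v`. -/
def Represents (F : UpsW) (v : Hilb) : Prop :=
  ∀ G : PreHilb, inner ℂ (nu0 G) v = wickExpect (toWick (Theta G.val) * F)

open Classical in
/-- The vector `ν(:Z¹: ⋯ :Zʳ:)`: the vector that represents `:Z¹: ⋯ :Zʳ:` (it exists for
products in `discWickWords`; elsewhere the value is not used). -/
def nuWord (W : FreeMonoid WickSymbol) : Hilb :=
  if h : ∃ v, Represents (MonoidAlgebra.single W 1) v then h.choose else 0

/-- The linear map `ν`. -/
def nu : upsWDisc →ₗ[ℂ] Hilb :=
  Finsupp.linearCombination ℂ nuWord ∘ₗ (MonoidAlgebra.coeffLinearEquiv ℂ).toLinearMap ∘ₗ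
    upsWDisc.subtype

/-- The domain `𝒟`, the range of `ν`. -/
def dom : Submodule ℂ Hilb := LinearMap.range nu

/-! ### Transition amplitudes -/

/-- The automorphism `J` of the algebra induced by `z ↦ a + q z`:
`J :[m₁, z₁, …, mₙ, zₙ]: = (∏ i, q ^ mᵢ) :[m₁, a + q z₁, …, mₙ, a + q zₙ]:`. -/
def J (a q : ℂ) : UpsW →ₐ[ℂ] UpsW :=
  MonoidAlgebra.lift ℂ UpsW (FreeMonoid WickSymbol) (FreeMonoid.lift fun Z : WickSymbol =>
    MonoidAlgebra.single
      (FreeMonoid.of (⟨Z.1.map fun l => (l.1, a + q * l.2), by simpa using Z.2⟩ : WickSymbol))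
      (Z.1.map fun l => q ^ (l.1 : ℕ)).prod)

/-- The correlation `⟨(J₁F₁) ⋯ (J_rF_r)⟩`. -/
def correlation {r : ℕ} (a q : Fin r → ℂ) (F : Fin r → UpsW) : ℂ :=
  wickExpect (List.ofFn fun i => J (a i) (q i) (F i)).prod

/-- `A` is a Hilbert–Schmidt functional on `𝒟 × ⋯ × 𝒟` and `N ≥ 0` is its norm, computed in some
orthonormal basis of the Hilbert space that consists of vectors in `𝒟`. -/
def HasHilbertSchmidtNorm {r : ℕ} (A : MultilinearMap ℂ (fun _ : Fin r => dom) ℂ) (N : ℝ) : Prop :=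
  0 ≤ N ∧ ∃ (ι : Type) (φ : HilbertBasis ι ℂ Hilb) (hφ : ∀ i, φ i ∈ dom),
    HasSum (fun α : Fin r → ι => ‖A fun i => ⟨φ (α i), hφ (α i)⟩‖ ^ 2) (N ^ 2)

/-- The largest radius. -/
def maxRadius {r : ℕ} (R : Fin r → ℝ) : ENNReal := ⨆ i, ENNReal.ofReal (R i)

/-- The smallest distance between different centres (infinite if there is only one). -/
def minDist {r : ℕ} (a : Fin r → ℂ) : ENNReal := ⨅ i, ⨅ j, ⨅ _ : i ≠ j, edist (a i) (a j)

end BosonSphere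

end

/-!
The Hilbert space is identified with the bosonic Fock space over `ℓ²(ℕ)`. The field `∂^m X(z)` with
`‖z‖ < 1` has the one-particle vector `legVec`, and a product of Wick symbols has the Fock vector
`wordVec` obtained by summing over all partial contractions (`wickProd`). Inner products with
reflected products of first derivatives then reproduce the correlations (`inner_wordVec_wickWord`),
so the Fock vector represents the product, and `ν` exists (`nu_represents`). The products of first
derivatives at distinct points of the punctured disc span a dense subspace
(`eq_zero_of_forall_inner_wordVec`): the inner product of a vector with such a product is a power
series in each point, from whose coefficients one obtains the inner products with all occupation
number states. This yields the isometry `fockIso`, the density of `𝒟`, and an orthonormal basis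
`occBasis` of the Hilbert space that consists of normal ordered products at the origin, hence of
vectors in `𝒟`.

Expanded in the modes of the discs, the two-point function of fields in different discs is the
matrix `discCov`, and the expansion converges because the discs are disjoint (`tendsto_discCov`).
By Wick's theorem for a Gaussian functional (`gaussian_wickProd`) the correlation
`⟨(J₁F₁) ⋯ (J_rF_r)⟩` is the Gaussian contraction, with covariance `discCov`, of the Fock vectors of
`F₁, …, F_r` (`tsum_gaussMoment_fockCoeff`, `correlation_single_eq`). So the amplitude is determined
by the vectors `ν(F_i)`, and its coefficients in the occupation number basis are the normalized
Gaussian moments `amplitudeCoeff`.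

These are square summable if `d / R > 4 √r`. With `t = R / d` the entries of the covariance are at
most `v x * v y` with `v (i, k) = (2 t) ^ (k + 1)` (`norm_discCov_le`). As `n` fields have at most
`√n!` pairings, the square of the moment of `X ^ β` is at most `|β|! * v ^ (2 β)`
(`norm_gaussMoment_sq_le`); divided by `β!` and summed over all `β`, this is the geometric series
`∑ n, (∑ x, v x ^ 2) ^ n` by the multinomial theorem (`summable_multinomial`), and
`∑ x, v x ^ 2 ≤ 1 / 3` for `t ≤ 1 / (4 √r)`. Square summable coefficients define a bounded
multilinear functional (`exists_hilbertSchmidt`), whose Hilbert–Schmidt norm is the same in all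
orthonormal bases, because the bases can be exchanged in one argument after the other
(`tsum_enorm_multilinear_sq`).
-/

open scoped ComplexConjugate BigOperators

noncomputable section

namespace BosonSphere

/-! ### Wick expansions in a commutative algebra -/

section WickProd

variable {ι κ R S : Type*} [CommRing R] [Algebra ℂ R] [CommRing S] [Algebra ℂ S]

/-- The expansion of a product of fields as `∑ (∏ contractions) (∏ of the uncontracted u x)`: the
sum over all partial pairings of the list, with contractions `c`, in which every unpaired entry
`x` contributes the element `u x` of a commutative algebra. For `u x` one-particle polynomials
this is `fockVec`. -/
def wickProd (u : ι → R) (c : ι → ι → ℂ) : List ι → R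
  | [] => 1
  | x :: L => u x * wickProd u c L +
      ((List.finRange L.length).map fun (i : Fin L.length) =>
        c x (L.get i) • wickProd u c (L.eraseIdx i)).sum
termination_by L => L.length
decreasing_by
  · simp
  · have := i.isLt
    simp [List.length_eraseIdx]

lemma wickProd_nil (u : ι → R) (c : ι → ι → ℂ) : wickProd u c [] = 1 := by
  rw [wickProd]

lemma wickProd_cons (u : ι → R) (c : ι → ι → ℂ) (x : ι) (L : List ι) :
    wickProd u c (x :: L) = u x * wickProd u c L +
      ((picks L).map fun p => c x p.1 • wickProd u c p.2).sum := by
  rw [wickProd, picks, List.map_map]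
  rfl

/-- Induction over lists in which the picks of the tail are available as well. -/
lemma picks_induction {P : List ι → Prop} (nil : P [])
    (cons : ∀ x L, P L → (∀ p ∈ picks L, P p.2) → P (x :: L)) (L : List ι) : P L := by
  induction h : L.length using Nat.strong_induction_on generalizing L with
  | _ n ih =>
  cases L with
  | nil => exact nil
  | cons x L =>
    simp only [List.length_cons] at h
    refine cons x L (ih L.length (by omega) L rfl) fun p hp => ?_
    have := picks_length hp
    exact ih p.2.length (by omega) p.2 rfl

lemma mem_of_mem_picks {L : List ι} {p : ι × List ι} (h : p ∈ picks L) :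
    p.1 ∈ L ∧ ∀ y ∈ p.2, y ∈ L :=
  ⟨(picks_perm h).subset List.mem_cons_self,
    fun _ hy => (picks_perm h).subset (List.mem_cons_of_mem _ hy)⟩

lemma fockVec_eq_wickProd (N : ℕ) (b : ι → ℕ → ℂ) (c : ι → ι → ℂ) (L : List ι) :
    fockVec N b c L = wickProd (fun x => oneVec N (b x)) c L := by
  induction L using picks_induction with
  | nil => rw [fockVec, wickProd_nil]
  | cons x L ih ih' =>
    rw [fockVec_cons, wickProd_cons, ih]
    congr 2
    exact List.map_congr_left fun p hp => by rw [ih' p hp]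

lemma wickProd_map (u : κ → R) (c : κ → κ → ℂ) (f : ι → κ) (L : List ι) :
    wickProd u c (L.map f) = wickProd (fun x => u (f x)) (fun x y => c (f x) (f y)) L := by
  induction L using picks_induction with
  | nil => simp [wickProd_nil]
  | cons x L ih ih' =>
    rw [List.map_cons, wickProd_cons, wickProd_cons, ih, picks_map, List.map_map]
    congr 2
    exact List.map_congr_left fun p hp => by rw [Function.comp_apply, ih' p hp]

lemma wickProd_congr {u u' : ι → R} {c c' : ι → ι → ℂ} {s : Set ι} (hu : ∀ x ∈ s, u x = u' x)
    (hc : ∀ x ∈ s, ∀ y ∈ s, c x y = c' x y) (L : List ι) (hL : ∀ x ∈ L, x ∈ s) :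
    wickProd u c L = wickProd u' c' L := by
  induction L using picks_induction with
  | nil => simp [wickProd_nil]
  | cons x L ih ih' =>
    have hL' : ∀ y ∈ L, y ∈ s := fun y hy => hL y (List.mem_cons_of_mem _ hy)
    rw [wickProd_cons, wickProd_cons, ih hL', hu x (hL x List.mem_cons_self)]
    congr 2
    refine List.map_congr_left fun p hp => ?_
    have h2 := mem_of_mem_picks hp
    rw [ih' p hp fun y hy => hL' y (h2.2 y hy),
      hc x (hL x List.mem_cons_self) p.1 (hL' _ h2.1)]

lemma map_wickProd (φ : R →ₐ[ℂ] S) (u : ι → R) (c : ι → ι → ℂ) (L : List ι) :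
    φ (wickProd u c L) = wickProd (fun x => φ (u x)) c L := by
  induction L using picks_induction with
  | nil => simp [wickProd_nil]
  | cons x L ih ih' =>
    rw [wickProd_cons, wickProd_cons, map_add, map_mul, ih, map_list_sum, List.map_map]
    congr 2
    exact List.map_congr_left fun p hp => by rw [Function.comp_apply, map_smul, ih' p hp]

lemma wickProd_append {u : ι → R} {c : ι → ι → ℂ} {A B : List ι}
    (h : ∀ x ∈ A, ∀ y ∈ B, c x y = 0) :
    wickProd u c (A ++ B) = wickProd u c A * wickProd u c B := by
  induction A using picks_induction with
  | nil => simp [wickProd_nil]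
  | cons x L ih ih' =>
    have hL : ∀ y ∈ L, ∀ z ∈ B, c y z = 0 := fun y hy => h y (List.mem_cons_of_mem _ hy)
    have h0 : ((picks B).map fun p => c x p.1 • wickProd u c (L ++ p.2)).sum = 0 := by
      refine List.sum_eq_zero fun y hy => ?_
      obtain ⟨p, hp, rfl⟩ := List.mem_map.1 hy
      rw [h x List.mem_cons_self p.1 (mem_of_mem_picks hp).1, zero_smul]
    rw [List.cons_append, wickProd_cons, wickProd_cons, ih hL, picks_append, List.map_append,
      List.sum_append, List.map_map, List.map_map, add_mul, mul_assoc, ← List.sum_map_mul_right]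
    simp only [Function.comp_def, h0, add_zero]
    congr 2
    refine List.map_congr_left fun p hp => ?_
    rw [ih' p hp fun y hy => hL y ((mem_of_mem_picks hp).2 y hy), smul_mul_assoc]

lemma wickProd_flatten {u : ι → R} {c : ι → ι → ℂ} {Ls : List (List ι)}
    (h : Ls.Pairwise fun A B => ∀ x ∈ A, ∀ y ∈ B, c x y = 0) :
    wickProd u c Ls.flatten = (Ls.map (wickProd u c)).prod := by
  induction Ls with
  | nil => simp [wickProd_nil]
  | cons A Ls ih =>
    rw [List.pairwise_cons] at h
    rw [List.flatten_cons, wickProd_append, ih h.2, List.map_cons, List.prod_cons]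
    intro x hx y hy
    obtain ⟨B, hB, hy⟩ := List.mem_flatten.1 hy
    exact h.1 B hB x hx y hy

/-- A derivation that maps every `u x` to a scalar removes one field at a time. -/
lemma derivation_wickProd (D : Derivation ℂ R R) {u : ι → R} {K : ι → ℂ}
    (hD : ∀ x, D (u x) = algebraMap ℂ R (K x)) (c : ι → ι → ℂ) (L : List ι) :
    D (wickProd u c L) = ((picks L).map fun p => K p.1 • wickProd u c p.2).sum := by
  induction L using picks_induction with
  | nil => simp [wickProd_nil, picks]
  | cons x L ih ih' =>
    have e1 : D (((picks L).map fun p => c x p.1 • wickProd u c p.2).sum) =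
        ((picks L).map fun p => ((picks p.2).map fun q =>
          (c x p.1 * K q.1) • wickProd u c q.2).sum).sum := by
      rw [map_list_sum, List.map_map]
      congr 1
      refine List.map_congr_left fun p hp => ?_
      rw [Function.comp_apply, D.map_smul, ih' p hp, List.smul_sum, List.map_map]
      simp [Function.comp_def, smul_smul]
    rw [wickProd_cons, map_add, Derivation.leibniz, hD, e1, ih,
      picks_swap (fun y y' M => (c x y * K y') • wickProd u c M), picks_cons, List.map_cons,
      List.sum_cons, List.map_map]
    simp only [Function.comp_def, wickProd_cons, smul_add, List.sum_map_add, List.smul_sum,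
      List.map_map, smul_smul, ← List.sum_map_mul_left, mul_smul_comm, smul_eq_mul,
      mul_comm _ (algebraMap ℂ R _), ← Algebra.smul_def]
    simp only [mul_comm (K _)]
    abel

/-- **Wick's theorem** for a Gaussian functional `E`: if `E` satisfies the integration by parts
formula `E (u x * p) = E (D x p)` with derivations `D x` that map `u y` to the scalar `k x y`, then
the expectation of a Wick expansion is the sum over all pairings with the contractions `c + k`. -/
lemma gaussian_wickProd (E : R →ₗ[ℂ] ℂ) (hE : E 1 = 1) {u : ι → R} {k : ι → ι → ℂ}
    (D : ι → Derivation ℂ R R) (hD : ∀ x y, D x (u y) = algebraMap ℂ R (k x y))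
    (hED : ∀ x p, E (u x * p) = E (D x p)) (c : ι → ι → ℂ) (L : List ι) :
    E (wickProd u c L) = pairingSum (fun x y => c x y + k x y) L := by
  induction L using picks_induction with
  | nil => rw [wickProd_nil, hE, pairingSum_nil]
  | cons x L ih ih' =>
    rw [wickProd_cons, map_add, hED, derivation_wickProd (D x) (hD x), map_list_sum, map_list_sum,
      List.map_map, List.map_map, ← List.sum_map_add, pairingSum_cons]
    congr 1
    refine List.map_congr_left fun p hp => ?_
    simp only [Function.comp_apply, map_smul, ih' p hp, smul_eq_mul]
    ring

end WickProd

/-! ### Pairing sums: symmetry and size -/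

section PairingSum

variable {ι : Type*}

lemma sum_picks_perm {M : Type*} [AddCommMonoid M] {L L' : List ι} (h : L.Perm L')
    (g : ι → List ι → M)
    (hg : ∀ x A B, A.length < L.length → A.Perm B → g x A = g x B) :
    ((picks L).map fun p => g p.1 p.2).sum = ((picks L').map fun p => g p.1 p.2).sum := by
  induction h generalizing g with
  | nil => rfl
  | @cons x A B hAB ih =>
    simp only [picks_cons, List.map_cons, List.sum_cons, List.map_map, Function.comp_def]
    rw [hg x A B (by simp) hAB, ih (fun y C => g y (x :: C))
      fun y C D hC hCD => hg y _ _ (by simpa using hC) (hCD.cons x)]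
  | swap x y A =>
    simp only [picks_cons, List.map_cons, List.sum_cons, List.map_map, Function.comp_def]
    rw [← add_assoc, ← add_assoc, add_comm (g y _)]
    congr 2
    refine List.map_congr_left fun p hp => hg _ _ _ ?_ (List.Perm.swap _ _ _)
    have := picks_length hp
    simp
    omega
  | @trans A B C hAB hBC ih1 ih2 =>
    rw [ih1 g hg, ih2 g fun x D F hD => hg x D F (by rwa [hAB.length_eq])]

lemma pairingSum_perm {c : ι → ι → ℂ} (hc : ∀ x y, c x y = c y x) {L L' : List ι}
    (h : L.Perm L') : pairingSum c L = pairingSum c L' := by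
  induction hn : L.length using Nat.strong_induction_on generalizing L L' with
  | _ n ih =>
  induction h with
  | nil => rfl
  | @cons x A B hAB _ =>
    simp only [List.length_cons] at hn
    rw [pairingSum_cons, pairingSum_cons]
    refine sum_picks_perm hAB (fun y C => c x y * pairingSum c C) fun y C D hC hCD => ?_
    rw [ih C.length (by omega) hCD rfl]
  | swap x y A =>
    have e : ∀ x y : ι, pairingSum c (y :: x :: A) = c y x * pairingSum c A +
        ((picks A).map fun p => ((picks p.2).map fun q =>
          c y p.1 * (c x q.1 * pairingSum c q.2)).sum).sum := fun x y => by
      simp only [pairingSum_cons, picks_cons, List.map_cons, List.sum_cons, List.map_map,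
        Function.comp_def, List.sum_map_mul_left]
    rw [e, e, hc x y, picks_swap fun p q l => c y p * (c x q * pairingSum c l)]
    simp only [mul_left_comm]
  | @trans A B C hAB hBC ih1 ih2 =>
    rw [ih1 hn, ih2 (by rw [← hAB.length_eq, hn])]

/-- A pairing sum whose contractions are bounded by a rank-one kernel: `n` fields have
`(n - 1)‼ ≤ √n!` pairings. -/
lemma norm_pairingSum_le {c : ι → ι → ℂ} {v : ι → ℝ} (hv : ∀ x, 0 ≤ v x)
    (hc : ∀ x y, ‖c x y‖ ≤ v x * v y) (L : List ι) :
    ‖pairingSum c L‖ ≤ √(L.length.factorial) * (L.map v).prod := by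
  induction L using picks_induction with
  | nil => simp [pairingSum_nil]
  | cons x L ih ih' =>
    rw [pairingSum_cons]
    rcases Nat.eq_zero_or_pos L.length with h0 | h0
    · rw [List.length_eq_zero_iff] at h0
      subst h0
      simpa [picks] using hv x
    obtain ⟨n, hn⟩ : ∃ n, L.length = n + 1 := ⟨L.length - 1, by omega⟩
    have hpos : 0 ≤ (L.map v).prod := List.prod_nonneg (by simpa using fun y _ => hv y)
    have h1 : ∀ y ∈ (picks L).map fun p => ‖c x p.1 * pairingSum c p.2‖,
        y ≤ √(n.factorial) * (v x * (L.map v).prod) := by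
      intro y hy
      obtain ⟨p, hp, rfl⟩ := List.mem_map.1 hy
      have hl := picks_length hp
      have hl' : p.2.length = n := by omega
      rw [norm_mul]
      calc _ ≤ (v x * v p.1) * (√(p.2.length.factorial) * (p.2.map v).prod) :=
            mul_le_mul (hc _ _) (ih' p hp) (norm_nonneg _) (mul_nonneg (hv _) (hv _))
        _ = _ := by
            rw [hl', ← ((picks_perm hp).map v).prod_eq, List.map_cons, List.prod_cons]
            ring
    have h2 : ‖((picks L).map fun p => c x p.1 * pairingSum c p.2).sum‖ ≤
        ((picks L).map fun p => ‖c x p.1 * pairingSum c p.2‖).sum := by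
      generalize picks L = l
      induction l with
      | nil => simp
      | cons p l ihl =>
        simp only [List.map_cons, List.sum_cons]
        exact (norm_add_le _ _).trans (add_le_add_right ihl _)
    refine h2.trans ((List.sum_le_card_nsmul _ _ h1).trans ?_)
    have h3 : ((n : ℝ) + 1) * √(n.factorial) ≤ √((n + 2).factorial) := by
      refine Real.le_sqrt_of_sq_le ?_
      rw [mul_pow, Real.sq_sqrt (by positivity), Nat.factorial_succ, Nat.factorial_succ]
      push_cast
      nlinarith [(by positivity : (0 : ℝ) ≤ n.factorial * (n + 1))]
    simp only [List.length_map, List.length_cons, List.map_cons, List.prod_cons, nsmul_eq_mul]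
    rw [show (picks L).length = n + 1 by simp [picks, hn], hn, ← mul_assoc]
    push_cast
    exact mul_le_mul_of_nonneg_right h3 (mul_nonneg (hv x) hpos)

end PairingSum

/-! ### Fields of products of Wick symbols -/

lemma wickLegs_one : wickLegs 1 = [] := rfl

lemma wickLegs_mul (A B : FreeMonoid WickSymbol) :
    wickLegs (A * B) = wickLegs A ++ (wickLegs B).map fun p => (A.length + p.1, p.2) := by
  simp only [wickLegs, FreeMonoid.toList_mul, List.zipIdx_append, List.flatMap_append]
  rw [List.zipIdx_eq_map_add (i := 0 + _), List.flatMap_map, List.map_flatMap]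
  congr 1
  refine List.flatMap_congr fun p _ => ?_
  simp only [List.map_map, Function.comp_def]
  refine List.map_congr_left fun l _ => ?_
  simp only [FreeMonoid.length, Prod.mk.injEq, and_true]
  rw [zero_add]

lemma wickLegs_of (Z : WickSymbol) :
    wickLegs (FreeMonoid.of Z) = Z.1.map fun l => (0, l) := by
  simp [wickLegs, FreeMonoid.toList_of]

lemma label_lt_of_mem_wickLegs {W : FreeMonoid WickSymbol} {p : ℕ × Leg} (h : p ∈ wickLegs W) :
    p.1 < W.length := by
  simp only [wickLegs, List.mem_flatMap, List.mem_map] at h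
  obtain ⟨x, hx, l, _, rfl⟩ := h
  exact List.snd_lt_of_mem_zipIdx hx

lemma exists_symbol_of_mem_wickLegs {W : FreeMonoid WickSymbol} {p : ℕ × Leg}
    (h : p ∈ wickLegs W) : ∃ Z ∈ W.toList, p.2 ∈ Z.1 := by
  simp only [wickLegs, List.mem_flatMap, List.mem_map] at h
  obtain ⟨x, hx, l, hl, rfl⟩ := h
  exact ⟨x.1, List.fst_mem_of_mem_zipIdx hx, hl⟩

/-- In a product of products, the labels of the factors are relabelled injectively. -/
lemma wickLegs_ofFn_prod {r : ℕ} (W : Fin r → FreeMonoid WickSymbol) :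
    ∃ g : Fin r → ℕ → ℕ,
      wickLegs (List.ofFn W).prod =
        (List.ofFn fun i => (wickLegs (W i)).map fun p => (g i p.1, p.2)).flatten ∧
      ∀ i j n n', n < (W i).length → n' < (W j).length → g i n = g j n' → i = j ∧ n = n' := by
  induction r with
  | zero => exact ⟨fun _ n => n, by simp [wickLegs_one], fun i => i.elim0⟩
  | succ r ih =>
    obtain ⟨g, hg, hinj⟩ := ih fun i => W i.succ
    refine ⟨Fin.cons id fun i n => (W 0).length + g i n, ?_, ?_⟩
    · simp only [List.ofFn_succ, List.prod_cons, wickLegs_mul, List.flatten_cons, hg,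
        Fin.cons_zero, Fin.cons_succ, List.map_flatten]
      congr 1
      · simp
      · rw [List.map_ofFn]
        simp [Function.comp_def]
    · intro i j n n' hn hn' h
      induction i using Fin.cases with
      | zero =>
        induction j using Fin.cases with
        | zero => exact ⟨rfl, h⟩
        | succ j =>
          simp only [Fin.cons_zero, Fin.cons_succ, id] at h
          omega
      | succ i =>
        induction j using Fin.cases with
        | zero =>
          simp only [Fin.cons_zero, Fin.cons_succ, id] at h
          omega
        | succ j =>
          simp only [Fin.cons_succ] at h
          obtain ⟨rfl, rfl⟩ := hinj i j n n' hn hn' (by omega)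
          exact ⟨rfl, rfl⟩

lemma wickExpect_single (W : FreeMonoid WickSymbol) (c : ℂ) :
    wickExpect (MonoidAlgebra.single W c) = c * pairingSum wickTwoPoint (wickLegs W) := by
  simp [wickExpect]

/-- The symbol `[z₁, …, zₙ]` as the product of Wick symbols `:[1, z₁]: ⋯ :[1, zₙ]:`. -/
def wickWord (Z : FreeMonoid ℂ) : FreeMonoid WickSymbol :=
  FreeMonoid.map (fun z => (⟨[(1, z)], List.cons_ne_nil _ _⟩ : WickSymbol)) Z

lemma wickLegs_wickWord (Z : FreeMonoid ℂ) :
    wickLegs (wickWord Z) = Z.toList.zipIdx.map fun p => (p.2, ((1 : ℕ+), p.1)) := by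
  simp only [wickLegs, wickWord, FreeMonoid.toList_map, List.zipIdx_map]
  rw [List.flatMap_map, List.map_eq_flatMap (l := Z.toList.zipIdx)]
  rfl

lemma wickWord_length (Z : FreeMonoid ℂ) : (wickWord Z).length = Z.length :=
  List.length_map _

lemma toWick_single (Z : FreeMonoid ℂ) (c : ℂ) :
    toWick (MonoidAlgebra.single Z c) = MonoidAlgebra.single (wickWord Z) c := by
  rw [toWick, MonoidAlgebra.lift_single]
  have : ∀ Z : FreeMonoid ℂ, (FreeMonoid.lift fun z : ℂ =>
      (MonoidAlgebra.single (FreeMonoid.of (⟨[(1, z)], List.cons_ne_nil _ _⟩ : WickSymbol))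
        (1 : ℂ) : UpsW)) Z = MonoidAlgebra.single (wickWord Z) 1 := by
    intro Z
    induction Z using FreeMonoid.inductionOn' with
    | one => simp [wickWord, MonoidAlgebra.one_def]
    | of_mul z Z ih =>
      rw [map_mul, ih, FreeMonoid.lift_eval_of, MonoidAlgebra.single_mul_single, wickWord, wickWord,
        map_mul, FreeMonoid.map_of, one_mul]
  rw [this]
  simp

/-- The first derivatives in a word, labelled by their positions, behave like the unlabelled ones:
fields with the same label are equal, so that `0 = twoPoint z z` is their contraction. -/
lemma wickTwoPoint_zipIdx {Z : List ℂ} {p q : ℂ × ℕ} (hp : p ∈ Z.zipIdx) (hq : q ∈ Z.zipIdx) :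
    wickTwoPoint (p.2, ((1 : ℕ+), p.1)) (q.2, ((1 : ℕ+), q.1)) = twoPoint p.1 q.1 := by
  rw [List.mem_zipIdx_iff_getElem?] at hp hq
  by_cases h : p.2 = q.2
  · rw [h, hq, Option.some_inj] at hp
    simp [wickTwoPoint, h, hp, twoPoint]
  · simp only [wickTwoPoint, h, if_false, legTwoPoint, twoPoint]
    norm_num

lemma pairingSum_wickLegs_wickWord (Z : FreeMonoid ℂ) :
    pairingSum wickTwoPoint (wickLegs (wickWord Z)) = pairingSum twoPoint Z.toList := by
  rw [wickLegs_wickWord, pairingSum_map]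
  conv_rhs => rw [← List.zipIdx_map_fst 0 Z.toList, pairingSum_map]
  exact pairingSum_congr (s := {p | p ∈ Z.toList.zipIdx})
    (fun p hp q hq => wickTwoPoint_zipIdx hp hq) _ fun p hp => hp

lemma wickProd_wickLegs_wickWord {R : Type*} [CommRing R] [Algebra ℂ R] (u : Leg → R)
    (Z : FreeMonoid ℂ) :
    wickProd (fun p : ℕ × Leg => u p.2) wickTwoPoint (wickLegs (wickWord Z)) =
      wickProd (fun z : ℂ => u (1, z)) twoPoint Z.toList := by
  rw [wickLegs_wickWord, wickProd_map]
  conv_rhs => rw [← List.zipIdx_map_fst 0 Z.toList, wickProd_map]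
  exact wickProd_congr (s := {p | p ∈ Z.toList.zipIdx}) (fun _ _ => rfl)
    (fun p hp q hq => wickTwoPoint_zipIdx hp hq) _ fun p hp => hp

lemma linearMap_ext_single {α M : Type*} [AddCommMonoid M] [Module ℂ M]
    {f g : MonoidAlgebra ℂ α →ₗ[ℂ] M}
    (h : ∀ a, f (MonoidAlgebra.single a 1) = g (MonoidAlgebra.single a 1)) : f = g := by
  refine LinearMap.ext fun F => ?_
  rw [← MonoidAlgebra.sum_coeff_single F, Finsupp.sum, map_sum, map_sum]
  refine Finset.sum_congr rfl fun a _ => ?_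
  have : MonoidAlgebra.single a (F.coeff a) = F.coeff a • MonoidAlgebra.single a (1 : ℂ) := by
    simp
  rw [this, map_smul, map_smul, h]

lemma wickExpect_toWick (F : Ups) : wickExpect (toWick F) = expect F := by
  have : wickExpect ∘ₗ toWick.toLinearMap = expect := by
    refine linearMap_ext_single fun Z => ?_
    simp only [LinearMap.comp_apply, AlgHom.toLinearMap_apply, toWick_single, wickExpect_single,
      expect_single, pairingSum_wickLegs_wickWord]
  exact LinearMap.congr_fun this F

/-- The action of `z ↦ a + q z` on a field, without its weight. -/
def affLeg (a q : ℂ) (l : Leg) : Leg := (l.1, a + q * l.2)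

/-- The action of `z ↦ a + q z` on a Wick symbol, without its weight. -/
def affSymbol (a q : ℂ) (Z : WickSymbol) : WickSymbol :=
  ⟨Z.1.map (affLeg a q), by simpa using Z.2⟩

lemma wickLegs_map_affSymbol (a q : ℂ) (W : FreeMonoid WickSymbol) :
    wickLegs (FreeMonoid.map (affSymbol a q) W) =
      (wickLegs W).map fun p => (p.1, affLeg a q p.2) := by
  simp only [wickLegs, FreeMonoid.toList_map, List.zipIdx_map, List.flatMap_map, List.map_flatMap]
  refine List.flatMap_congr fun p _ => ?_
  simp [affSymbol, Function.comp_def]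

lemma J_single (a q : ℂ) (W : FreeMonoid WickSymbol) (c : ℂ) :
    J a q (MonoidAlgebra.single W c) = MonoidAlgebra.single (FreeMonoid.map (affSymbol a q) W)
      (c * ((wickLegs W).map fun p => q ^ (p.2.1 : ℕ)).prod) := by
  rw [J, MonoidAlgebra.lift_single]
  have : ∀ W : FreeMonoid WickSymbol, (FreeMonoid.lift fun Z : WickSymbol =>
      (MonoidAlgebra.single
        (FreeMonoid.of (⟨Z.1.map fun l => (l.1, a + q * l.2), by simpa using Z.2⟩ : WickSymbol))
        (Z.1.map fun l => q ^ (l.1 : ℕ)).prod : UpsW)) W =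
      MonoidAlgebra.single (FreeMonoid.map (affSymbol a q) W)
        ((wickLegs W).map fun p => q ^ (p.2.1 : ℕ)).prod := by
    intro W
    induction W using FreeMonoid.inductionOn' with
    | one => simp [wickLegs_one, MonoidAlgebra.one_def]
    | of_mul Z W ih =>
      rw [map_mul, ih, FreeMonoid.lift_eval_of, MonoidAlgebra.single_mul_single, wickLegs_mul,
        wickLegs_of, map_mul, FreeMonoid.map_of]
      simp only [List.map_append, List.map_map, List.prod_append, Function.comp_def]
      rfl
  rw [this]
  simp

lemma legTwoPoint_symm (p q : Leg) : legTwoPoint p q = legTwoPoint q p := by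
  simp only [legTwoPoint]
  rw [add_comm (q.1 : ℕ), ← neg_sub p.2 q.2, neg_pow (p.2 - q.2), pow_add (-1 : ℂ)]
  rcases neg_one_pow_eq_or ℂ (p.1 : ℕ) with hp | hp <;>
    rcases neg_one_pow_eq_or ℂ (q.1 : ℕ) with hq | hq <;> simp [hp, hq, div_neg, neg_div]

lemma wickTwoPoint_symm (p q : ℕ × Leg) : wickTwoPoint p q = wickTwoPoint q p := by
  simp only [wickTwoPoint, eq_comm, legTwoPoint_symm p.2]

/-! ### One-particle vectors -/

/-- The norm `√((k + 1) / 2) k!` of the one-particle vector of the field `∂^(k+1) X(0)`. -/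
def legScale (k : ℕ) : ℝ := √(((k : ℝ) + 1) / 2) * k.factorial

lemma legScale_pos (k : ℕ) : 0 < legScale k := by
  unfold legScale
  positivity

lemma legScale_ne_zero (k : ℕ) : (legScale k : ℂ) ≠ 0 :=
  Complex.ofReal_ne_zero.2 (legScale_pos k).ne'

/-- The one-particle vector of the field `∂^m X(z)`: the `(m - 1)`-st derivative of `coeffVec` at
`z`. -/
def legVec (l : Leg) (k : ℕ) : ℂ :=
  if (l.1 : ℕ) ≤ k + 1 then
    legScale k * (l.2 ^ (k + 1 - (l.1 : ℕ)) / ((k + 1 - (l.1 : ℕ)).factorial : ℂ))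
  else 0

lemma legVec_one (z : ℂ) : legVec (1, z) = coeffVec z := by
  ext k
  have : (k.factorial : ℂ) ≠ 0 := by exact_mod_cast k.factorial_ne_zero
  simp only [legVec, PNat.one_coe, le_add_iff_nonneg_left, zero_le, if_true, Nat.add_sub_cancel,
    coeffVec, legScale]
  push_cast
  field_simp

lemma legVec_zero (k j : ℕ) :
    legVec (k.succPNat, 0) j = if j = k then (legScale k : ℂ) else 0 := by
  simp only [legVec, Nat.succPNat_coe, Nat.succ_eq_add_one]
  by_cases h : j = k
  · simp [h]
  · by_cases h' : k ≤ j
    · have : j - k ≠ 0 := by omega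
      simp [h, this]
    · simp [h, h']

lemma legVec_shift (m : ℕ+) (z : ℂ) (j : ℕ) : legVec (m, z) (j + ((m : ℕ) - 1)) =
    legScale (j + ((m : ℕ) - 1)) * (z ^ j / (j.factorial : ℂ)) := by
  have hm := m.pos
  have e : j + ((m : ℕ) - 1) + 1 - (m : ℕ) = j := by omega
  rw [legVec, if_pos (by simp only; omega)]
  simp only [e]

lemma summable_norm_legVec {l : Leg} (hl : ‖l.2‖ < 1) : Summable fun k => ‖legVec l k‖ := by
  obtain ⟨m, z⟩ := l
  have hm := m.pos
  rw [← summable_nat_add_iff ((m : ℕ) - 1)]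
  have hs := (summable_descFactorial_mul_geometric_of_norm_lt_one (R := ℝ) (m : ℕ)
    (r := ‖z‖) (by simpa using hl))
  refine Summable.of_nonneg_of_le (fun _ => norm_nonneg _) (fun j => ?_) hs
  rw [legVec_shift]
  have e : j + ((m : ℕ) - 1) + 1 = j + m := by omega
  have h1 : legScale (j + ((m : ℕ) - 1)) ≤ ((j + m : ℕ).factorial : ℝ) := by
    rw [legScale, ← e, Nat.factorial_succ]
    push_cast
    refine mul_le_mul_of_nonneg_right ?_ (by positivity)
    refine Real.sqrt_le_iff.2 ⟨by positivity, ?_⟩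
    nlinarith [(by positivity : (0 : ℝ) ≤ (j : ℝ) + ((m - 1 : ℕ) : ℝ))]
  have h2 : ((j + m : ℕ).factorial : ℝ) = j.factorial * ((j + m).descFactorial m : ℕ) := by
    rw [← Nat.factorial_mul_descFactorial (Nat.le_add_left (m : ℕ) j), Nat.add_sub_cancel]
    push_cast
    rfl
  have hj : (0 : ℝ) < j.factorial := by positivity
  rw [norm_mul, norm_div, norm_pow, Complex.norm_real, Real.norm_of_nonneg (legScale_pos _).le,
    Complex.norm_natCast, ← mul_div_assoc, div_le_iff₀ hj]
  calc _ ≤ ((j + m : ℕ).factorial : ℝ) * ‖z‖ ^ j := by gcongr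
    _ = _ := by rw [h2]; ring

lemma summable_mul_legVec {l l' : Leg} (hl : ‖l.2‖ < 1) (hl' : ‖l'.2‖ < 1) :
    Summable fun k => conj (legVec l k) * legVec l' k := by
  have h := (summable_norm_legVec hl).mul_norm (summable_norm_legVec hl')
  have h' := h.comp_injective (i := fun k : ℕ => (k, k)) fun a b hab => (Prod.mk.inj hab).1
  refine Summable.of_norm ?_
  simpa [Function.comp_def] using h'

/-- The contraction of a reflected field with a field. -/
lemma hasSum_legVec {z : ℂ} (hz0 : z ≠ 0) (hz : ‖z‖ < 1) {l : Leg} (hl : ‖l.2‖ < 1) :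
    HasSum (fun k => conj (coeffVec z k) * legVec l k)
      (-1 / (conj z) ^ 2 * legTwoPoint (1, 1 / conj z) l) := by
  obtain ⟨m, w⟩ := l
  have hm := m.pos
  have hz' : conj z ≠ 0 := by simpa using hz0
  have hzw : ‖conj z * w‖ < 1 := by
    rw [norm_mul, RCLike.norm_conj]
    exact mul_lt_one_of_nonneg_of_lt_one_left (norm_nonneg _) hz hl.le
  have hne : 1 - conj z * w ≠ 0 := fun h => by
    rw [sub_eq_zero] at h
    simp [← h] at hzw
  have h0 : ∑ k ∈ Finset.range ((m : ℕ) - 1), conj (coeffVec z k) * legVec (m, w) k = 0 := by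
    refine Finset.sum_eq_zero fun k hk => ?_
    rw [Finset.mem_range] at hk
    rw [legVec, if_neg (by simp only; omega), mul_zero]
  have hs := (hasSum_choose_mul_geometric_of_norm_lt_one (m : ℕ) hzw).mul_left
    (1 / 2 * ((m : ℕ).factorial : ℂ) * conj z ^ ((m : ℕ) - 1))
  rw [← hasSum_nat_add_iff' ((m : ℕ) - 1), h0, sub_zero]
  obtain ⟨n, hn⟩ : ∃ n, (m : ℕ) = n + 1 := ⟨(m : ℕ) - 1, by omega⟩
  have hf : ∀ j, conj (coeffVec z (j + ((m : ℕ) - 1))) * legVec (m, w) (j + ((m : ℕ) - 1)) =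
      1 / 2 * ((m : ℕ).factorial : ℂ) * conj z ^ ((m : ℕ) - 1) *
        (((j + m).choose m : ℕ) * (conj z * w) ^ j) := by
    intro j
    rw [legVec_shift]
    have hj : (j.factorial : ℂ) ≠ 0 := by exact_mod_cast j.factorial_ne_zero
    have hsq : ((√((((j + ((m : ℕ) - 1) : ℕ) : ℝ) + 1) / 2) : ℝ) : ℂ) *
        legScale (j + ((m : ℕ) - 1)) = 1 / 2 * ((j + m : ℕ).factorial : ℂ) := by
      rw [legScale, ← Complex.ofReal_mul, ← mul_assoc, Real.mul_self_sqrt (by positivity)]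
      rw [show j + (m : ℕ) = (j + ((m : ℕ) - 1)) + 1 by omega, Nat.factorial_succ]
      push_cast
      ring
    have hch : ((j + m : ℕ).factorial : ℂ) =
        ((j + m).choose m : ℂ) * ((m : ℕ).factorial : ℂ) * (j.factorial : ℂ) := by
      rw [← Nat.add_choose_mul_factorial_mul_factorial j m, ← Nat.choose_symm_add]
      push_cast
      ring
    simp only [coeffVec, map_mul, Complex.conj_ofReal, map_pow]
    calc _ = (((√((((j + ((m : ℕ) - 1) : ℕ) : ℝ) + 1) / 2) : ℝ) : ℂ) *
        legScale (j + ((m : ℕ) - 1))) * (conj z ^ (j + ((m : ℕ) - 1)) * (w ^ j / j.factorial)) := by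
          ring
      _ = _ := by
          rw [hsq, hch, pow_add]
          field_simp
          ring
  have hv : -1 / (conj z) ^ 2 * legTwoPoint (1, 1 / conj z) (m, w) =
      1 / 2 * ((m : ℕ).factorial : ℂ) * conj z ^ ((m : ℕ) - 1) *
        (1 / (1 - conj z * w) ^ ((m : ℕ) + 1)) := by
    simp only [legTwoPoint, PNat.one_coe, hn, Nat.add_sub_cancel]
    rw [show 1 / conj z - w = (1 - conj z * w) / conj z by field_simp, div_pow,
      show 1 + (n + 1) - 1 = n + 1 by omega, show 1 + (n + 1) = n + 1 + 1 by omega]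
    field_simp
    ring
  rw [hv, funext hf]
  exact hs

/-! ### Fock vectors as square-summable functions of multi-indices -/

section FockCoeff

variable {ι : Type*}

lemma coeff_oneVec_mul (N : ℕ) (b : ℕ → ℂ) (p : MvPolynomial ℕ ℂ) (α : ℕ →₀ ℕ) :
    (oneVec N b * p).coeff α =
      ∑ k ∈ α.support with k < N, b k * p.coeff (α - Finsupp.single k 1) := by
  classical
  rw [oneVec, Finset.sum_mul, MvPolynomial.coeff_sum]
  simp only [smul_mul_assoc, MvPolynomial.coeff_smul, MvPolynomial.coeff_X_mul', smul_eq_mul,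
    mul_ite, mul_zero]
  rw [← Finset.sum_filter]
  refine Finset.sum_congr ?_ fun _ _ => rfl
  ext k
  simp [and_comm]

lemma coeff_list_sum {σ τ : Type*} (l : List τ) (f : τ → MvPolynomial σ ℂ) (α : σ →₀ ℕ) :
    ((l.map f).sum).coeff α = (l.map fun x => (f x).coeff α).sum := by
  induction l with
  | nil => simp
  | cons x l ih => simp [ih]

lemma coeff_fockVec_cons (N : ℕ) (b : ι → ℕ → ℂ) (c : ι → ι → ℂ) (x : ι) (L : List ι)
    (α : ℕ →₀ ℕ) : (fockVec N b c (x :: L)).coeff α =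
      (∑ k ∈ α.support with k < N, b x k * (fockVec N b c L).coeff (α - Finsupp.single k 1)) +
      ((picks L).map fun p => c x p.1 * (fockVec N b c p.2).coeff α).sum := by
  rw [fockVec_cons, MvPolynomial.coeff_add, coeff_oneVec_mul, coeff_list_sum]
  simp only [MvPolynomial.coeff_smul, smul_eq_mul]

lemma coeff_fockVec_eq_zero (N : ℕ) (b : ι → ℕ → ℂ) (c : ι → ι → ℂ) (L : List ι) {α : ℕ →₀ ℕ}
    (hα : ¬ ∀ k ∈ α.support, k < N) : (fockVec N b c L).coeff α = 0 := by
  classical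
  induction L using picks_induction generalizing α with
  | nil =>
    rw [fockVec, MvPolynomial.coeff_one, if_neg]
    rintro rfl
    simp at hα
  | cons x L ih ih' =>
    rw [coeff_fockVec_cons, Finset.sum_eq_zero, List.sum_eq_zero, add_zero]
    · intro y hy
      obtain ⟨p, hp, rfl⟩ := List.mem_map.1 hy
      rw [ih' p hp hα, mul_zero]
    · intro k hk
      rw [ih, mul_zero]
      push Not at hα ⊢
      obtain ⟨j, hj, hjN⟩ := hα
      refine ⟨j, ?_, hjN⟩
      have : k ≠ j := by
        rintro rfl
        have := (Finset.mem_filter.1 hk).2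
        omega
      simpa [Finsupp.single_apply, this] using hj

lemma lt_of_mem_support_tsub {N k : ℕ} {α : ℕ →₀ ℕ} (hα : ∀ k ∈ α.support, k < N) :
    ∀ j ∈ (α - Finsupp.single k 1).support, j < N := fun j hj =>
  hα j (Finsupp.support_tsub hj)

lemma coeff_fockVec_stable {N N' : ℕ} (b : ι → ℕ → ℂ) (c : ι → ι → ℂ) (L : List ι) {α : ℕ →₀ ℕ}
    (hα : ∀ k ∈ α.support, k < N) (hα' : ∀ k ∈ α.support, k < N') :
    (fockVec N b c L).coeff α = (fockVec N' b c L).coeff α := by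
  classical
  induction L using picks_induction generalizing α with
  | nil => rw [fockVec, fockVec]
  | cons x L ih ih' =>
    rw [coeff_fockVec_cons, coeff_fockVec_cons, Finset.filter_true_of_mem hα,
      Finset.filter_true_of_mem hα']
    congr 1
    · exact Finset.sum_congr rfl fun k _ => by
        rw [ih (lt_of_mem_support_tsub hα) (lt_of_mem_support_tsub hα')]
    · congr 1
      exact List.map_congr_left fun p hp => by rw [ih' p hp hα hα']

/-- The coefficient at `X ^ α` of the Fock vector of a product of fields, without truncation: it
is the same for all truncations that contain the indices in `α`. -/
def fockCoeff (b : ι → ℕ → ℂ) (c : ι → ι → ℂ) (L : List ι) (α : ℕ →₀ ℕ) : ℂ :=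
  (fockVec (α.support.sup Nat.succ) b c L).coeff α

lemma lt_sup_succ (α : ℕ →₀ ℕ) : ∀ k ∈ α.support, k < α.support.sup Nat.succ := fun _ hk =>
  Nat.lt_of_succ_le (Finset.le_sup (f := Nat.succ) hk)

open Classical in
lemma coeff_fockVec (N : ℕ) (b : ι → ℕ → ℂ) (c : ι → ι → ℂ) (L : List ι) (α : ℕ →₀ ℕ) :
    (fockVec N b c L).coeff α =
      if ∀ k ∈ α.support, k < N then fockCoeff b c L α else 0 := by
  split_ifs with h
  · exact coeff_fockVec_stable b c L h (lt_sup_succ α)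
  · exact coeff_fockVec_eq_zero N b c L h

lemma fockCoeff_cons (b : ι → ℕ → ℂ) (c : ι → ι → ℂ) (x : ι) (L : List ι) (α : ℕ →₀ ℕ) :
    fockCoeff b c (x :: L) α =
      (∑ k ∈ α.support, b x k * fockCoeff b c L (α - Finsupp.single k 1)) +
      ((picks L).map fun p => c x p.1 * fockCoeff b c p.2 α).sum := by
  rw [fockCoeff, coeff_fockVec_cons, Finset.filter_true_of_mem (lt_sup_succ α)]
  congr 1
  exact Finset.sum_congr rfl fun k _ => by
    rw [fockCoeff, coeff_fockVec_stable b c L (lt_of_mem_support_tsub (lt_sup_succ α))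
      (lt_sup_succ _)]

lemma fockCoeff_nil (b : ι → ℕ → ℂ) (c : ι → ι → ℂ) (α : ℕ →₀ ℕ) :
    fockCoeff b c [] α = if α = 0 then 1 else 0 := by
  rw [fockCoeff, fockVec, MvPolynomial.coeff_one]
  simp only [eq_comm]

lemma fockCoeff_eq_zero_of_length_lt (b : ι → ℕ → ℂ) (c : ι → ι → ℂ) (L : List ι) {α : ℕ →₀ ℕ}
    (h : L.length < α.degree) : fockCoeff b c L α = 0 := by
  induction L using picks_induction generalizing α with
  | nil =>
    rw [fockCoeff_nil, if_neg]
    rintro rfl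
    simp at h
  | cons x L ih ih' =>
    rw [List.length_cons] at h
    rw [fockCoeff_cons, Finset.sum_eq_zero, List.sum_eq_zero, add_zero]
    · intro y hy
      obtain ⟨p, hp, rfl⟩ := List.mem_map.1 hy
      have := picks_length hp
      rw [ih' p hp (by omega), mul_zero]
    · intro k hk
      rw [ih, mul_zero]
      have h1 : Finsupp.single k 1 ≤ α := by
        rw [Finsupp.single_le_iff]
        exact Nat.one_le_iff_ne_zero.2 (Finsupp.mem_support_iff.1 hk)
      have h2 := congrArg Finsupp.degree (tsub_add_cancel_of_le h1)
      rw [map_add, Finsupp.degree_single] at h2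
      omega

open Classical in
lemma fockInner_eq_tsum (N : ℕ) (b : ι → ℕ → ℂ) (c : ι → ι → ℂ) (L L' : List ι) :
    fockInner (fockVec N b c L) (fockVec N b c L') = ∑' α : ℕ →₀ ℕ,
      if ∀ k ∈ α.support, k < N then
        (multiFact α : ℂ) * (conj (fockCoeff b c L α) * fockCoeff b c L' α) else 0 := by
  rw [fockInner, tsum_eq_sum (s := (fockVec N b c L).support)]
  · refine Finset.sum_congr rfl fun α _ => ?_
    rw [coeff_fockVec, coeff_fockVec]
    split_ifs <;> simp
  · intro α hα
    rw [MvPolynomial.notMem_support_iff, coeff_fockVec] at hα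
    split_ifs with h
    · rw [if_pos h] at hα
      simp [hα]
    · rfl

/-- The norms of the truncated Fock vectors increase to the norm of the Fock vector. -/
lemma summable_fockCoeff {b : ι → ℕ → ℂ} {c : ι → ι → ℂ} {L : List ι} {K : ℂ}
    (h : Filter.Tendsto (fun N => fockInner (fockVec N b c L) (fockVec N b c L)) Filter.atTop
      (nhds K)) : Summable fun α => multiFact α * ‖fockCoeff b c L α‖ ^ 2 := by
  classical
  obtain ⟨C, hC⟩ := ((Complex.continuous_re.tendsto _).comp h).bddAbove_range
  refine summable_of_sum_le (c := C)
    (fun α => mul_nonneg (multiFact_nonneg α) (by positivity)) fun S => ?_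
  let N := S.sup fun α => α.support.sup Nat.succ
  have hN : ∀ α ∈ S, ∀ k ∈ α.support, k < N := fun α hα k hk =>
    (lt_sup_succ α k hk).trans_le (Finset.le_sup (f := fun α => α.support.sup Nat.succ) hα)
  have hre : ∀ z : ℂ, (conj z * z).re = ‖z‖ ^ 2 := fun z => by
    rw [← Complex.normSq_eq_conj_mul_self, Complex.ofReal_re, Complex.normSq_eq_norm_sq]
  calc _ = ∑ α ∈ S, multiFact α * ‖(fockVec N b c L).coeff α‖ ^ 2 :=
        Finset.sum_congr rfl fun α hα => by rw [coeff_fockVec, if_pos (hN α hα)]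
    _ ≤ ∑ α ∈ S ∪ (fockVec N b c L).support, multiFact α * ‖(fockVec N b c L).coeff α‖ ^ 2 :=
        Finset.sum_le_sum_of_subset_of_nonneg Finset.subset_union_left
          fun α _ _ => mul_nonneg (multiFact_nonneg α) (by positivity)
    _ = (fockInner (fockVec N b c L) (fockVec N b c L)).re := by
        rw [fockInner_eq _ (Finset.subset_union_right (s₁ := S)), Complex.re_sum]
        refine Finset.sum_congr rfl fun α _ => ?_
        rw [Complex.re_ofReal_mul, hre]
    _ ≤ C := hC ⟨N, rfl⟩

lemma tendsto_fockInner {b : ι → ℕ → ℂ} {c : ι → ι → ℂ} {L L' : List ι}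
    (hL : Summable fun α => multiFact α * ‖fockCoeff b c L α‖ ^ 2)
    (hL' : Summable fun α => multiFact α * ‖fockCoeff b c L' α‖ ^ 2) :
    Filter.Tendsto (fun N => fockInner (fockVec N b c L) (fockVec N b c L')) Filter.atTop
      (nhds (∑' α, (multiFact α : ℂ) * (conj (fockCoeff b c L α) * fockCoeff b c L' α))) := by
  classical
  simp only [fockInner_eq_tsum]
  refine tendsto_tsum_of_dominated_convergence (hL.add hL') (fun α => ?_)
    (Filter.Eventually.of_forall fun N α => ?_)
  · refine tendsto_const_nhds.congr' ?_
    filter_upwards [Filter.eventually_ge_atTop (α.support.sup Nat.succ)] with N hN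
    rw [if_pos fun k hk => (lt_sup_succ α k hk).trans_le hN]
  · have h0 := multiFact_nonneg α
    have : ‖(multiFact α : ℂ) * (conj (fockCoeff b c L α) * fockCoeff b c L' α)‖ ≤
        multiFact α * ‖fockCoeff b c L α‖ ^ 2 + multiFact α * ‖fockCoeff b c L' α‖ ^ 2 := by
      rw [norm_mul, norm_mul, RCLike.norm_conj, Complex.norm_real, Real.norm_of_nonneg h0,
        ← mul_add]
      refine mul_le_mul_of_nonneg_left ?_ h0
      nlinarith [sq_nonneg (‖fockCoeff b c L α‖ - ‖fockCoeff b c L' α‖),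
        sq_nonneg ‖fockCoeff b c L α‖, sq_nonneg ‖fockCoeff b c L' α‖]
    split_ifs
    · exact this
    · rw [norm_zero]
      positivity

end FockCoeff

/-! ### The Fock space and the vectors of Wick products -/

/-- The bosonic Fock space over `ℓ²(ℕ)`, in its occupation number basis. -/
abbrev Fock : Type := lp (fun _ : ℕ →₀ ℕ => ℂ) 2

/-- The coefficient of `:Z¹: ⋯ :Zʳ:` at `X ^ α`. -/
def wordCoeff (W : FreeMonoid WickSymbol) (α : ℕ →₀ ℕ) : ℂ :=
  fockCoeff (fun p : ℕ × Leg => legVec p.2) wickTwoPoint (wickLegs W) α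

lemma legTwoPoint_one (z w : ℂ) : legTwoPoint (1, z) (1, w) = twoPoint z w := by
  simp only [legTwoPoint, twoPoint]
  norm_num

lemma memℓp_two_iff {ι : Type*} {f : ι → ℂ} : Memℓp f 2 ↔ Summable fun i => ‖f i‖ ^ 2 := by
  rw [memℓp_gen_iff (by norm_num)]
  simp

open Classical in
/-- The Fock vector of `:Z¹: ⋯ :Zʳ:`, in the orthonormal basis of the normalized monomials
`X ^ α / √α!` (it is zero if the coefficients are not square summable, which does not happen for
points in the unit disc). -/
def wordVec (W : FreeMonoid WickSymbol) : Fock :=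
  if h : Memℓp (fun α => (√(multiFact α) : ℂ) * wordCoeff W α) 2 then ⟨_, h⟩ else 0

lemma normSq_weighted (α : ℕ →₀ ℕ) (z : ℂ) :
    ‖(√(multiFact α) : ℂ) * z‖ ^ 2 = multiFact α * ‖z‖ ^ 2 := by
  rw [norm_mul, Complex.norm_real, Real.norm_of_nonneg (Real.sqrt_nonneg _), mul_pow,
    Real.sq_sqrt (multiFact_nonneg α)]

lemma summable_wordCoeff {W : FreeMonoid WickSymbol} (hW : ∀ p ∈ wickLegs W, ‖p.2.2‖ < 1) :
    Summable fun α => multiFact α * ‖wordCoeff W α‖ ^ 2 := by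
  let h : ℕ × Leg → ℕ × Leg → ℂ := fun x y => ∑' k, conj (legVec x.2 k) * legVec y.2 k
  let c' : (ℕ × Leg) ⊕ (ℕ × Leg) → (ℕ × Leg) ⊕ (ℕ × Leg) → ℂ := fun x y =>
    match x, y with
    | .inl z, .inl w => conj (wickTwoPoint z w)
    | .inl z, .inr w => h z w
    | .inr w, .inl z => h z w
    | .inr z, .inr w => wickTwoPoint z w
  have hh : ∀ x y : ℕ × Leg, ‖x.2.2‖ < 1 → ‖y.2.2‖ < 1 → Filter.Tendsto
      (fun N => ∑ k ∈ Finset.range N, conj (legVec x.2 k) * legVec y.2 k) Filter.atTop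
      (nhds (h x y)) := fun x y hx hy => (summable_mul_legVec hx hy).hasSum.tendsto_sum_nat
  refine summable_fockCoeff (K := pairingSum c'
    ((wickLegs W).map Sum.inl ++ (wickLegs W).map Sum.inr)) ?_
  simp only [fockInner_fockVec]
  refine tendsto_pairingSum (s := {x | ‖(Sum.elim id id x : ℕ × Leg).2.2‖ < 1}) ?_ _ ?_
  · rintro (z | z) hz (w | w) hw
    · exact tendsto_const_nhds
    · exact hh z w hz hw
    · exact hh w z hw hz
    · exact tendsto_const_nhds
  · intro x hx
    simp only [List.mem_append, List.mem_map] at hx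
    rcases hx with ⟨z, hz, rfl⟩ | ⟨z, hz, rfl⟩ <;> exact hW z hz

lemma wordVec_apply {W : FreeMonoid WickSymbol} (hW : ∀ p ∈ wickLegs W, ‖p.2.2‖ < 1)
    (α : ℕ →₀ ℕ) : wordVec W α = (√(multiFact α) : ℂ) * wordCoeff W α := by
  have h : Memℓp (fun α => (√(multiFact α) : ℂ) * wordCoeff W α) 2 := by
    rw [memℓp_two_iff]
    simpa only [normSq_weighted] using summable_wordCoeff hW
  rw [wordVec, dif_pos h]

lemma inner_wordVec {W W' : FreeMonoid WickSymbol} (hW : ∀ p ∈ wickLegs W, ‖p.2.2‖ < 1)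
    (hW' : ∀ p ∈ wickLegs W', ‖p.2.2‖ < 1) : inner ℂ (wordVec W) (wordVec W') =
      ∑' α, (multiFact α : ℂ) * (conj (wordCoeff W α) * wordCoeff W' α) := by
  rw [lp.inner_eq_tsum]
  refine tsum_congr fun α => ?_
  rw [wordVec_apply hW, wordVec_apply hW', RCLike.inner_apply, map_mul, Complex.conj_ofReal]
  have : (√(multiFact α) : ℂ) * √(multiFact α) = multiFact α := by
    rw [← Complex.ofReal_mul, Real.mul_self_sqrt (multiFact_nonneg α)]
  rw [← this]
  ring

lemma norm_lt_of_mem_discWickWords {W : FreeMonoid WickSymbol} (hW : W ∈ discWickWords) :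
    ∀ p ∈ wickLegs W, ‖p.2.2‖ < 1 := fun _ hp =>
  let ⟨Z, hZ, hl⟩ := exists_symbol_of_mem_wickLegs hp
  hW.1 Z hZ _ hl

lemma mem_wickLegs_wickWord {Z : FreeMonoid ℂ} {p : ℕ × Leg} (hp : p ∈ wickLegs (wickWord Z)) :
    p.1 < Z.length ∧ p.2.1 = 1 ∧ p.2.2 ∈ Z.toList := by
  refine ⟨wickWord_length Z ▸ label_lt_of_mem_wickLegs hp, ?_⟩
  rw [wickLegs_wickWord] at hp
  obtain ⟨x, hx, rfl⟩ := List.mem_map.1 hp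
  exact ⟨rfl, List.fst_mem_of_mem_zipIdx hx⟩

lemma norm_lt_of_mem_puncturedWords {Z : FreeMonoid ℂ} (hZ : Z ∈ puncturedWords) :
    ∀ p ∈ wickLegs (wickWord Z), ‖p.2.2‖ < 1 := fun _ hp =>
  (hZ.2 _ (mem_wickLegs_wickWord hp).2.2).2

/-- The inner product of Fock vectors computes the correlation with the reflected word. -/
lemma inner_wordVec_wickWord {Z : FreeMonoid ℂ} {W : FreeMonoid WickSymbol}
    (hZ : Z ∈ puncturedWords) (hW : ∀ p ∈ wickLegs W, ‖p.2.2‖ < 1) :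
    inner ℂ (wordVec (wickWord Z)) (wordVec W) = (Z.toList.map fun z => -1 / (conj z) ^ 2).prod *
      pairingSum wickTwoPoint (wickLegs (wickWord (Z.map fun z => 1 / conj z) * W)) := by
  have hZ' := norm_lt_of_mem_puncturedWords hZ
  rw [inner_wordVec hZ' hW]
  refine tendsto_nhds_unique (tendsto_fockInner (summable_wordCoeff hZ') (summable_wordCoeff hW)) ?_
  let pt : (ℕ × Leg) ⊕ (ℕ × Leg) → ℕ × Leg := Sum.elim (fun p => (p.1, (p.2.1, 1 / conj p.2.2)))
    fun p => (Z.length + p.1, p.2)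
  let wt : (ℕ × Leg) ⊕ (ℕ × Leg) → ℂ := Sum.elim (fun p => -1 / (conj p.2.2) ^ 2) fun _ => 1
  have hlist : wickLegs (wickWord (Z.map fun z => 1 / conj z) * W) =
      ((wickLegs (wickWord Z)).map Sum.inl ++ (wickLegs W).map Sum.inr).map pt := by
    rw [wickLegs_mul, List.map_append, List.map_map, List.map_map, wickLegs_wickWord,
      wickLegs_wickWord, FreeMonoid.toList_map, List.zipIdx_map, List.map_map, List.map_map,
      wickWord_length]
    congr 1
    simp only [pt, Function.comp_def, Sum.elim_inr, FreeMonoid.length, FreeMonoid.toList_map,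
      List.length_map]
  have hwt : (Z.toList.map fun z => -1 / (conj z) ^ 2).prod =
      (((wickLegs (wickWord Z)).map Sum.inl ++ (wickLegs W).map Sum.inr).map wt).prod := by
    simp only [wickLegs_wickWord, wt, List.map_append, List.map_map, List.prod_append,
      Function.comp_def, Sum.elim_inl, Sum.elim_inr, List.map_const', List.prod_replicate, one_pow,
      mul_one]
    conv_lhs => rw [← List.zipIdx_map_fst 0 Z.toList, List.map_map]
    rfl
  rw [hlist, hwt, pairingSum_map, ← pairingSum_weight]
  simp only [fockInner_fockVec]
  refine tendsto_pairingSum (s := {x | Sum.elim (fun p : ℕ × Leg => p.1 < Z.length ∧ p.2.1 = 1 ∧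
    p.2.2 ≠ 0 ∧ ‖p.2.2‖ < 1) (fun p : ℕ × Leg => ‖p.2.2‖ < 1) x}) ?_ _ ?_
  · have key : ∀ p q : ℕ × Leg, p.1 < Z.length ∧ p.2.1 = 1 ∧ p.2.2 ≠ 0 ∧ ‖p.2.2‖ < 1 →
        ‖q.2.2‖ < 1 → Filter.Tendsto
          (fun N => ∑ k ∈ Finset.range N, conj (legVec p.2 k) * legVec q.2 k) Filter.atTop
          (nhds (wt (.inl p) * wt (.inr q) * wickTwoPoint (pt (.inl p)) (pt (.inr q)))) := by
      rintro ⟨i, m, z⟩ ⟨j, l⟩ ⟨hi, hm, hz0, hz1⟩ hl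
      simp only at hi hm hz0 hz1 hl
      subst hm
      have hij : i ≠ Z.length + j := by omega
      simp only [pt, wt, Sum.elim_inl, Sum.elim_inr, wickTwoPoint, hij, if_false, mul_one,
        legVec_one]
      exact (hasSum_legVec hz0 hz1 hl).tendsto_sum_nat
    rintro (p | p) hp (q | q) hq
    · obtain ⟨i, m, z⟩ := p
      obtain ⟨j, n, w⟩ := q
      obtain ⟨-, hm, hz, -⟩ := hp
      obtain ⟨-, hn, hw, -⟩ := hq
      simp only at hm hn hz hw
      subst hm hn
      have hz' : conj z ≠ 0 := by simpa using hz
      have hw' : conj w ≠ 0 := by simpa using hw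
      have : conj (wickTwoPoint (i, 1, z) (j, 1, w)) = -1 / (conj z) ^ 2 * (-1 / (conj w) ^ 2) *
          wickTwoPoint (i, 1, 1 / conj z) (j, 1, 1 / conj w) := by
        by_cases hij : i = j
        · simp [wickTwoPoint, hij]
        simp only [wickTwoPoint, hij, if_false, legTwoPoint_one, twoPoint]
        rw [show 1 / conj z - 1 / conj w = -(conj z - conj w) / (conj z * conj w) by
          field_simp; ring]
        simp only [map_div₀, map_neg, map_one, map_pow, map_sub, map_ofNat]
        by_cases h : conj z - conj w = 0
        · simp [h]
        · field_simp
      simp only [mixed, wt, pt, Sum.elim_inl, this]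
      exact tendsto_const_nhds
    · exact key p q hp hq
    · rw [mul_comm (wt _), wickTwoPoint_symm]
      exact key q p hq hp
    · simp only [mixed, wt, pt, Sum.elim_inr, one_mul, wickTwoPoint, add_right_inj]
      exact tendsto_const_nhds
  · intro x hx
    simp only [List.mem_append, List.mem_map] at hx
    rcases hx with ⟨p, hp, rfl⟩ | ⟨p, hp, rfl⟩
    · have h := mem_wickLegs_wickWord hp
      exact ⟨h.1, h.2.1, hZ.2 _ h.2.2⟩
    · exact hW p hp

/-- The linear map that sends a product of Wick symbols to its Fock vector. -/
def fockMap : UpsW →ₗ[ℂ] Fock :=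
  Finsupp.linearCombination ℂ wordVec ∘ₗ (MonoidAlgebra.coeffLinearEquiv ℂ).toLinearMap

lemma fockMap_single (W : FreeMonoid WickSymbol) (c : ℂ) :
    fockMap (MonoidAlgebra.single W c) = c • wordVec W := by
  simp [fockMap]

lemma Theta_single (Z : FreeMonoid ℂ) (c : ℂ) : Theta (MonoidAlgebra.single Z c) =
    MonoidAlgebra.single (Z.map fun z => 1 / conj z)
      (conj c * (Z.toList.map fun z => -1 / (conj z) ^ 2).prod) := by
  simp [Theta]

lemma Theta_sum {τ : Type*} (s : Finset τ) (f : τ → Ups) :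
    Theta (∑ i ∈ s, f i) = ∑ i ∈ s, Theta (f i) := by
  classical
  induction s using Finset.induction_on with
  | empty => simp [Theta]
  | insert a s ha ih => rw [Finset.sum_insert ha, Theta_add, ih, Finset.sum_insert ha]

lemma inner_fockMap {G : Ups} (hG : G ∈ upsPunctured) {F : UpsW} (hF : F ∈ upsWDisc) :
    inner ℂ (fockMap (toWick G)) (fockMap F) = wickExpect (toWick (Theta G) * F) := by
  rw [← MonoidAlgebra.sum_coeff_single G, ← MonoidAlgebra.sum_coeff_single F, Finsupp.sum,
    Finsupp.sum, Theta_sum, map_sum, map_sum, map_sum, map_sum, sum_inner, Finset.sum_mul, map_sum]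
  refine Finset.sum_congr rfl fun Z hZ => ?_
  rw [inner_sum, Finset.mul_sum, map_sum]
  refine Finset.sum_congr rfl fun W hW => ?_
  rw [toWick_single, Theta_single, toWick_single, MonoidAlgebra.single_mul_single,
    wickExpect_single, fockMap_single, fockMap_single, inner_smul_left, inner_smul_right,
    inner_wordVec_wickWord (hG hZ) (norm_lt_of_mem_discWickWords (hF hW))]
  ring

lemma wickWord_mem_discWickWords {Z : FreeMonoid ℂ} (hZ : Z ∈ puncturedWords) :
    wickWord Z ∈ discWickWords := by
  constructor
  · intro S hS l hl
    obtain ⟨z, hz, rfl⟩ := List.mem_map.1 hS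
    rw [List.mem_singleton.1 hl]
    exact (hZ.2 z hz).2
  · rw [wickWord, FreeMonoid.toList_map, List.pairwise_map]
    refine hZ.1.imp fun {a b} hab l hl l' hl' => ?_
    rw [List.mem_singleton.1 hl, List.mem_singleton.1 hl']
    exact hab

lemma toWick_mem_upsWDisc {G : Ups} (hG : G ∈ upsPunctured) : toWick G ∈ upsWDisc := by
  rw [← MonoidAlgebra.sum_coeff_single G, Finsupp.sum, map_sum]
  refine Submodule.sum_mem _ fun Z hZ => ?_
  rw [toWick_single]
  intro W hW
  have := Finsupp.support_single_subset hW
  rw [Finset.mem_singleton.1 this]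
  exact wickWord_mem_discWickWords (hG hZ)

/-! ### Cyclicity of the vacuum: products of first derivatives span a dense subspace -/

/-- A power series that converges absolutely at some `ρ > 0` and vanishes near the origin has
vanishing coefficients. -/
lemma eq_zero_of_hasSum_pow {a : ℕ → ℂ} {ρ : ℝ} (hρ : 0 < ρ)
    (ha : Summable fun k => ‖a k‖ * ρ ^ k)
    (h : ∀ᶠ z in nhdsWithin (0 : ℂ) {0}ᶜ, HasSum (fun k => a k * z ^ k) 0) (n : ℕ) : a n = 0 := by
  induction n using Nat.strong_induction_on with
  | _ n ih =>
  have hsmall : ∀ᶠ z in nhdsWithin (0 : ℂ) {0}ᶜ, ‖z‖ ≤ ρ := by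
    have : ∀ᶠ z in nhds (0 : ℂ), ‖z‖ ≤ ρ := by
      filter_upwards [Metric.closedBall_mem_nhds (0 : ℂ) hρ] with z hz
      simpa using hz
    exact this.filter_mono nhdsWithin_le_nhds
  have hbd : Summable fun k => ‖a (k + n)‖ * ρ ^ k := by
    have := ((summable_nat_add_iff n).2 ha).mul_right ((ρ ^ n)⁻¹)
    refine this.congr fun k => ?_
    rw [pow_add]
    field_simp
  have h1 : Filter.Tendsto (fun z : ℂ => ∑' k, a (k + n) * z ^ k) (nhdsWithin (0 : ℂ) {0}ᶜ)
      (nhds (∑' k, a (k + n) * (0 : ℂ) ^ k)) := by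
    refine tendsto_tsum_of_dominated_convergence hbd (fun k => ?_) ?_
    · have : Continuous fun z : ℂ => a (k + n) * z ^ k := by fun_prop
      exact (this.tendsto 0).mono_left nhdsWithin_le_nhds
    · filter_upwards [hsmall] with z hz k
      rw [norm_mul, norm_pow]
      gcongr
  have h2 : (fun z : ℂ => ∑' k, a (k + n) * z ^ k) =ᶠ[nhdsWithin (0 : ℂ) {0}ᶜ] fun _ => 0 := by
    filter_upwards [h, self_mem_nhdsWithin] with z hz hz0
    have hz0' : z ^ n ≠ 0 := pow_ne_zero _ hz0
    have := (hasSum_nat_add_iff' n).2 hz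
    rw [Finset.sum_eq_zero fun k hk => by rw [ih k (Finset.mem_range.1 hk), zero_mul],
      sub_zero] at this
    have := (this.mul_right (z ^ n)⁻¹).tsum_eq
    rw [zero_mul] at this
    rw [← this]
    refine tsum_congr fun k => ?_
    rw [pow_add]
    field_simp
  have h3 := tendsto_nhds_unique h1 (tendsto_const_nhds.congr' h2.symm)
  rw [tsum_eq_single 0 fun k hk => by simp [hk]] at h3
  simpa using h3

lemma hasSum_list_sum_zero {τ κ : Type*} (l : List τ) (F : τ → κ → ℂ)
    (h : ∀ x ∈ l, HasSum (F x) 0) : HasSum (fun α => (l.map fun x => F x α).sum) 0 := by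
  induction l with
  | nil => simp
  | cons x l ih =>
    have h1 := (h x List.mem_cons_self).add (ih fun y hy => h y (List.mem_cons_of_mem _ hy))
    simpa using h1

/-- Induction over multi-indices by adding one unit at a time. -/
lemma multiIndex_induction {P : (ℕ →₀ ℕ) → Prop} (zero : P 0)
    (step : ∀ β k, P β → P (β + Finsupp.single k 1)) (β : ℕ →₀ ℕ) : P β := by
  induction h : β.degree using Nat.strong_induction_on generalizing β with
  | _ n ih =>
  by_cases hβ : β = 0
  · rwa [hβ]
  obtain ⟨k, hk⟩ := Finsupp.support_nonempty_iff.2 hβ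
  have h1 : Finsupp.single k 1 ≤ β := by
    rw [Finsupp.single_le_iff]
    exact Nat.one_le_iff_ne_zero.2 (Finsupp.mem_support_iff.1 hk)
  rw [← tsub_add_cancel_of_le h1]
  refine step _ _ (ih (β - Finsupp.single k 1).degree ?_ _ rfl)
  have h2 := congrArg Finsupp.degree (tsub_add_cancel_of_le h1)
  rw [map_add, Finsupp.degree_single] at h2
  omega

lemma apply_le_degree (α : ℕ →₀ ℕ) (k : ℕ) : α k ≤ α.degree := by
  by_cases h : k ∈ α.support
  · exact Finset.single_le_sum (f := fun i => α i) (fun _ _ => Nat.zero_le _) h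
  · simp [Finsupp.notMem_support_iff.1 h]

/-- The creation operator of `∑ b k e_k`, moved to the other side: if it is applied to `f`, the sum
against `u` becomes the sum over `k` of `b k` times the sum of `f` against a translate of `u`. -/
lemma hasSum_creation {u f : (ℕ →₀ ℕ) → ℂ} {b : ℕ → ℂ} {C : ℝ}
    (hb : Summable fun k => ‖b k‖)
    (hs : ∀ k, Summable fun α => ‖u (α + Finsupp.single k 1) * f α‖)
    (hC : ∀ k, ∑' α, ‖u (α + Finsupp.single k 1) * f α‖ ≤ C) :
    HasSum (fun α => u α * ∑ k ∈ α.support, b k * f (α - Finsupp.single k 1))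
      (∑' k, b k * ∑' α, u (α + Finsupp.single k 1) * f α) := by
  classical
  let Φ : ℕ × (ℕ →₀ ℕ) → ℂ := fun x => b x.1 * (u (x.2 + Finsupp.single x.1 1) * f x.2)
  let Ψ : (ℕ →₀ ℕ) × ℕ → ℂ := fun x =>
    if x.2 ∈ x.1.support then u x.1 * (b x.2 * f (x.1 - Finsupp.single x.2 1)) else 0
  let i : ℕ × (ℕ →₀ ℕ) → (ℕ →₀ ℕ) × ℕ := fun x => (x.2 + Finsupp.single x.1 1, x.1)
  have hi : Function.Injective i := by
    rintro ⟨k, α⟩ ⟨k', α'⟩ h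
    simp only [i, Prod.mk.injEq] at h
    obtain ⟨h, rfl⟩ := h
    rw [add_right_cancel h]
  have hΨi : Ψ ∘ i = Φ := by
    ext ⟨k, α⟩
    simp only [Function.comp_apply, Ψ, Φ, i]
    rw [if_pos (by simp), add_tsub_cancel_right]
    ring
  have hΨ0 : ∀ x ∉ Set.range i, Ψ x = 0 := by
    rintro ⟨α, k⟩ hx
    refine if_neg fun hk => hx ⟨(k, α - Finsupp.single k 1), ?_⟩
    have h1 : Finsupp.single k 1 ≤ α := by
      rw [Finsupp.single_le_iff]
      exact Nat.one_le_iff_ne_zero.2 (Finsupp.mem_support_iff.1 hk)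
    simp only [i, tsub_add_cancel_of_le h1]
  have hΦ : Summable Φ := by
    refine Summable.of_norm ?_
    rw [summable_prod_of_nonneg fun _ => norm_nonneg _]
    simp only [Φ, norm_mul (b _)]
    refine ⟨fun k => (hs k).mul_left _, ?_⟩
    refine Summable.of_nonneg_of_le (fun k => tsum_nonneg fun _ => by positivity) (fun k => ?_)
      (hb.mul_right C)
    rw [tsum_mul_left]
    exact mul_le_mul_of_nonneg_left (hC k) (norm_nonneg _)
  have hsum : HasSum Ψ (∑' k, b k * ∑' α, u (α + Finsupp.single k 1) * f α) := by
    rw [← hi.hasSum_iff hΨ0, hΨi]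
    have := hΦ.hasSum
    rw [hΦ.tsum_prod] at this
    simpa only [Φ, tsum_mul_left] using this
  refine hsum.prod_fiberwise fun α => ?_
  rw [Finset.mul_sum]
  have : ∀ k ∈ α.support, u α * (b k * f (α - Finsupp.single k 1)) = Ψ (α, k) := fun k hk => by
    simp only [Ψ]
    rw [if_pos hk]
  rw [Finset.sum_congr rfl this]
  exact hasSum_sum_of_ne_finset_zero fun k hk => by
    simp only [Ψ]
    rw [if_neg hk]

lemma wordCoeff_wickWord (Z : FreeMonoid ℂ) :
    wordCoeff (wickWord Z) = fockCoeff coeffVec twoPoint Z.toList := by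
  ext α
  simp only [wordCoeff, fockCoeff, fockVec_eq_wickProd]
  rw [wickProd_wickLegs_wickWord fun l => oneVec (α.support.sup Nat.succ) (legVec l)]
  simp only [legVec_one]

lemma multiFact_pos (α : ℕ →₀ ℕ) : 0 < multiFact α :=
  Finset.prod_pos fun _ _ => by positivity

/-- A Fock vector orthogonal to all products of first derivatives at distinct points vanishes. The
inner product with a product that contains `∂X(z)` is, up to contractions that contribute inner
products of the same kind, a power series in `z`; its coefficients are the inner products in which
`∂X(z)` is replaced by the normalized mode `k`. So the modes can be reached one at a time. -/
lemma eq_zero_of_forall_inner_wordVec {v : Fock}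
    (hv : ∀ Z ∈ puncturedWords, inner ℂ (wordVec (wickWord Z)) v = 0) : v = 0 := by
  let f : List ℂ → (ℕ →₀ ℕ) → ℂ := fockCoeff coeffVec twoPoint
  let u : (ℕ →₀ ℕ) → ℂ := fun α => (√(multiFact α) : ℂ) * conj (v α)
  let good : List ℂ → Prop := fun L => L.Nodup ∧ ∀ z ∈ L, z ≠ 0 ∧ ‖z‖ < 1
  have hv2 : Summable fun α => ‖v α‖ ^ 2 := memℓp_two_iff.1 (lp.memℓp v)
  -- `u (α + β)` in place of `u α` stands for the product with the modes `β` added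
  have key : ∀ β : ℕ →₀ ℕ, ∀ L, good L →
      (Summable fun α => multiFact (α + β) * ‖f L α‖ ^ 2) ∧
      HasSum (fun α => u (α + β) * f L α) 0 := by
    intro β
    induction β using multiIndex_induction with
    | zero =>
      intro L hL
      have hZ : FreeMonoid.ofList L ∈ puncturedWords := hL
      have hc : wordCoeff (wickWord (FreeMonoid.ofList L)) = f L :=
        wordCoeff_wickWord (FreeMonoid.ofList L)
      have hZ' := norm_lt_of_mem_puncturedWords hZ
      constructor
      · simpa only [add_zero, hc] using summable_wordCoeff hZ'
      · have h1 := lp.hasSum_inner (𝕜 := ℂ) (wordVec (wickWord (FreeMonoid.ofList L))) v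
        rw [hv _ hZ] at h1
        have h2 := Complex.hasSum_conj'.2 h1
        rw [map_zero] at h2
        refine h2.congr_fun fun α => ?_
        rw [wordVec_apply hZ', hc, RCLike.inner_apply, map_mul, Complex.conj_conj, add_zero]
        simp only [u]
        ring
    | step β k ih =>
      intro L hL
      obtain ⟨hS, -⟩ := ih L hL
      have hle : ∀ j α, multiFact (α + (β + Finsupp.single j 1)) * ‖f L α‖ ^ 2 ≤
          ((L.length : ℝ) + β.degree + 1) * (multiFact (α + β) * ‖f L α‖ ^ 2) := by
        intro j α
        -- only `α` of degree at most the number of fields contribute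
        by_cases hα : L.length < α.degree
        · simp [f, fockCoeff_eq_zero_of_length_lt _ _ _ hα]
        have h1 : (α + β) j ≤ L.length + β.degree :=
          (apply_le_degree (α + β) j).trans (by rw [map_add]; omega)
        have h2 : (((α + β) j : ℕ) : ℝ) ≤ (L.length : ℝ) + β.degree := by exact_mod_cast h1
        rw [← add_assoc, multiFact_add_single]
        have h3 := mul_nonneg (multiFact_nonneg (α + β)) (sq_nonneg ‖f L α‖)
        nlinarith
      have hSj : ∀ j, Summable fun α => multiFact (α + (β + Finsupp.single j 1)) * ‖f L α‖ ^ 2 :=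
        fun j => Summable.of_nonneg_of_le
          (fun α => mul_nonneg (multiFact_nonneg _) (sq_nonneg _)) (hle j) (hS.mul_left _)
      refine ⟨hSj k, ?_⟩
      set C : ℝ := ∑' α, ‖v α‖ ^ 2 +
        ((L.length : ℝ) + β.degree + 1) * ∑' α, multiFact (α + β) * ‖f L α‖ ^ 2 with hCdef
      have hinj : ∀ j, Function.Injective fun α : ℕ →₀ ℕ => α + (β + Finsupp.single j 1) :=
        fun j => add_left_injective _
      have hterm : ∀ j α, ‖u (α + (β + Finsupp.single j 1)) * f L α‖ ≤
          ‖v (α + (β + Finsupp.single j 1))‖ ^ 2 +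
            multiFact (α + (β + Finsupp.single j 1)) * ‖f L α‖ ^ 2 := by
        intro j α
        rw [← normSq_weighted]
        simp only [u, norm_mul, RCLike.norm_conj]
        nlinarith [sq_nonneg (‖v (α + (β + Finsupp.single j 1))‖ -
          ‖(√(multiFact (α + (β + Finsupp.single j 1))) : ℂ)‖ * ‖f L α‖),
          sq_nonneg ‖v (α + (β + Finsupp.single j 1))‖,
          sq_nonneg (‖(√(multiFact (α + (β + Finsupp.single j 1))) : ℂ)‖ * ‖f L α‖)]
      have hvj : ∀ j, Summable fun α => ‖v (α + (β + Finsupp.single j 1))‖ ^ 2 := fun j =>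
        hv2.comp_injective (hinj j)
      have hsj : ∀ j, Summable fun α => ‖u (α + (β + Finsupp.single j 1)) * f L α‖ := fun j =>
        Summable.of_nonneg_of_le (fun _ => norm_nonneg _) (hterm j) ((hvj j).add (hSj j))
      have hCj : ∀ j, ∑' α, ‖u (α + (β + Finsupp.single j 1)) * f L α‖ ≤ C := by
        intro j
        refine ((hsj j).tsum_le_tsum (hterm j) ((hvj j).add (hSj j))).trans ?_
        rw [(hvj j).tsum_add (hSj j), hCdef, ← tsum_mul_left]
        refine add_le_add ?_ ((hSj j).tsum_le_tsum (hle j) (hS.mul_left _))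
        exact tsum_comp_le_tsum_of_inj hv2 (fun _ => sq_nonneg _) (hinj j)
      -- the inner product with the mode `j` added; `g k = 0` is the claim
      let g : ℕ → ℂ := fun j => ∑' α, u (α + (β + Finsupp.single j 1)) * f L α
      have hg : ∀ j, ‖g j‖ ≤ C := fun j =>
        (norm_tsum_le_tsum_norm (hsj j)).trans (hCj j)
      have hzero : ∀ᶠ z in nhdsWithin (0 : ℂ) {0}ᶜ,
          HasSum (fun j => coeffVec 1 j * g j * z ^ j) 0 := by
        have h1 : ∀ᶠ z in nhds (0 : ℂ), ‖z‖ < 1 ∧ z ∉ L := by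
          have ha : ∀ᶠ z in nhds (0 : ℂ), ‖z‖ < 1 := by
            filter_upwards [Metric.ball_mem_nhds (0 : ℂ) one_pos] with z hz
            simpa using hz
          have hb : ∀ᶠ z in nhds (0 : ℂ), z ∉ L := by
            have hcl : IsClosed {z : ℂ | z ∈ L} := (List.finite_toSet L).isClosed
            exact hcl.isOpen_compl.mem_nhds fun h => (hL.2 0 h).1 rfl
          exact ha.and hb
        filter_upwards [h1.filter_mono nhdsWithin_le_nhds, self_mem_nhdsWithin] with z hz hz0
        have hzL : good (z :: L) := by
          refine ⟨List.nodup_cons.2 ⟨hz.2, hL.1⟩, fun w hw => ?_⟩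
          rcases List.mem_cons.1 hw with rfl | hw
          · exact ⟨hz0, hz.1⟩
          · exact hL.2 w hw
        have hb : Summable fun j => ‖coeffVec z j‖ := by
          rw [← legVec_one]
          exact summable_norm_legVec hz.1
        have hcre := hasSum_creation (u := fun α => u (α + β)) (f := f L) hb
          (fun j => by simpa only [add_assoc, add_comm β] using hsj j)
          (fun j => by simpa only [add_assoc, add_comm β] using hCj j)
        have hpk : HasSum (fun α => ((picks L).map fun p =>
            u (α + β) * (twoPoint z p.1 * f p.2 α)).sum) 0 := by
          refine hasSum_list_sum_zero (picks L)
            (fun p α => u (α + β) * (twoPoint z p.1 * f p.2 α)) fun p hp => ?_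
          have hsub : p.2.Sublist L := by
            obtain ⟨i, _, rfl⟩ := List.mem_map.1 hp
            exact List.eraseIdx_sublist _ _
          have := ((ih p.2 ⟨hL.1.sublist hsub, fun w hw => hL.2 w (hsub.subset hw)⟩).2).mul_left
            (twoPoint z p.1)
          rw [mul_zero] at this
          refine this.congr_fun fun α => ?_
          ring
        have htot := (ih (z :: L) hzL).2
        have hsplit := htot.sub hpk
        have hG : ∑' j, coeffVec z j * g j = 0 := by
          rw [sub_zero] at hsplit
          refine HasSum.unique ?_ hsplit
          have e : ∀ (j : ℕ) (α : ℕ →₀ ℕ), α + Finsupp.single j 1 + β =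
              α + (β + Finsupp.single j 1) := fun j α => by rw [add_assoc, add_comm β]
          simp only [e] at hcre
          refine hcre.congr_fun fun α => ?_
          simp only [f, fockCoeff_cons, List.sum_map_mul_left]
          ring
        have hsum : Summable fun j => coeffVec z j * g j := by
          refine Summable.of_norm (Summable.of_nonneg_of_le (fun _ => norm_nonneg _) (fun j => ?_)
            (hb.mul_right C))
          rw [norm_mul]
          exact mul_le_mul_of_nonneg_left (hg j) (norm_nonneg _)
        have := hsum.hasSum
        rw [hG] at this
        refine this.congr_fun fun j => ?_
        simp only [coeffVec, one_pow, mul_one]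
        ring
      have hhalf : Summable fun j => ‖coeffVec 1 j * g j‖ * (1 / 2 : ℝ) ^ j := by
        have hb : Summable fun j => ‖coeffVec (1 / 2) j‖ := by
          rw [← legVec_one]
          exact summable_norm_legVec (by norm_num)
        refine Summable.of_nonneg_of_le (fun _ => by positivity) (fun j => ?_) (hb.mul_right C)
        have e : ‖coeffVec (1 / 2) j‖ = ‖coeffVec 1 j‖ * (1 / 2 : ℝ) ^ j := by
          simp [coeffVec]
        rw [e, norm_mul, mul_right_comm]
        exact mul_le_mul_of_nonneg_left (hg j) (by positivity)
      have hk := eq_zero_of_hasSum_pow (by norm_num) hhalf hzero k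
      have hk' : coeffVec 1 k ≠ 0 := by
        simp only [coeffVec, one_pow, mul_one]
        exact Complex.ofReal_ne_zero.2 (Real.sqrt_pos.2 (by positivity)).ne'
      have := (hsj k).of_norm.hasSum
      rwa [show ∑' α, u (α + (β + Finsupp.single k 1)) * f L α = 0 from
        (mul_eq_zero.1 hk).resolve_left hk'] at this
  ext β
  have h1 := (key β [] ⟨List.nodup_nil, by simp⟩).2
  have h2 : HasSum (fun α => u (α + β) * f [] α) (u β) := by
    have := hasSum_single (f := fun α => u (α + β) * f [] α) 0 fun α hα => by
      simp [f, fockCoeff_nil, hα]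
    simpa [f, fockCoeff_nil] using this
  have h3 := h2.unique h1
  have h4 : (√(multiFact β) : ℂ) ≠ 0 :=
    Complex.ofReal_ne_zero.2 (Real.sqrt_pos.2 (multiFact_pos β)).ne'
  simpa [u, h4] using h3

/-! ### The Hilbert space as a Fock space -/

lemma denseRange_nu0 : DenseRange nu0 := by
  have h1 : DenseRange ((↑) : SeparationQuotient PreHilb → Hilb) :=
    UniformSpace.Completion.denseRange_coe
  have h2 : Function.Surjective (SeparationQuotient.mk : PreHilb → SeparationQuotient PreHilb) :=
    SeparationQuotient.surjective_mk
  exact h1.comp h2.denseRange (UniformSpace.Completion.continuous_coe _)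

/-- The Fock vector of an element of the pre-Hilbert space. -/
def fockPre : PreHilb →ₗ[ℂ] Fock := fockMap ∘ₗ toWick.toLinearMap ∘ₗ PreHilb.val

lemma fockPre_apply (G : PreHilb) : fockPre G = fockMap (toWick G.val) := rfl

lemma PreHilb.val_mem (G : PreHilb) : G.val ∈ upsPunctured := G.2

lemma inner_fockPre (G F : PreHilb) :
    inner ℂ (fockPre G) (fockPre F) = inner ℂ (nu0 G) (nu0 F) := by
  rw [fockPre_apply, fockPre_apply, inner_fockMap G.val_mem (toWick_mem_upsWDisc F.val_mem),
    ← map_mul, wickExpect_toWick, inner_nu0]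

lemma norm_fockPre (G : PreHilb) : ‖fockPre G‖ = ‖nu0 G‖ := by
  rw [@norm_eq_sqrt_re_inner ℂ, @norm_eq_sqrt_re_inner ℂ, inner_fockPre]

lemma denseRange_fockPre : DenseRange fockPre := by
  have h : (LinearMap.range fockPre).topologicalClosure = ⊤ := by
    rw [Submodule.topologicalClosure_eq_top_iff, Submodule.eq_bot_iff]
    intro v hv
    refine eq_zero_of_forall_inner_wordVec fun Z hZ => ?_
    have hmem : MonoidAlgebra.single Z (1 : ℂ) ∈ upsPunctured := fun W hW => by
      rw [Finset.mem_singleton.1 (Finsupp.support_single_subset hW)]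
      exact hZ
    let G : PreHilb := ⟨MonoidAlgebra.single Z 1, hmem⟩
    have h1 : fockPre G = wordVec (wickWord Z) := by
      rw [fockPre_apply, show G.val = MonoidAlgebra.single Z 1 from rfl,
        toWick_single, fockMap_single, one_smul]
    rw [← h1]
    exact (Submodule.mem_orthogonal _ _).1 hv _ (LinearMap.mem_range_self _ _)
  rw [DenseRange, ← LinearMap.coe_range]
  exact Submodule.dense_iff_topologicalClosure_eq_top.2 h

/-- The isometry between the Hilbert space and the Fock space. -/
def fockIso : Hilb ≃ₗᵢ[ℂ] Fock :=
  (LinearEquiv.refl ℂ PreHilb).extendOfIsometry nu0 fockPre denseRange_nu0 denseRange_fockPre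
    norm_fockPre

lemma fockIso_nu0 (G : PreHilb) : fockIso (nu0 G) = fockPre G :=
  LinearEquiv.extendOfIsometry_eq _ _ _ _ _ _ _

lemma represents_fockIso_symm {F : UpsW} (hF : F ∈ upsWDisc) :
    Represents F (fockIso.symm (fockMap F)) := fun G => by
  rw [← fockIso.inner_map_map, fockIso_nu0, LinearIsometryEquiv.apply_symm_apply, fockPre_apply,
    inner_fockMap G.val_mem hF]

lemma Represents.unique {F : UpsW} {v w : Hilb} (hv : Represents F v) (hw : Represents F w) :
    v = w :=
  denseRange_nu0.eq_of_inner_right ℂ fun G => (hv G).trans (hw G).symm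

lemma single_mem_upsWDisc {W : FreeMonoid WickSymbol} (hW : W ∈ discWickWords) (c : ℂ) :
    MonoidAlgebra.single W c ∈ upsWDisc := fun W' hW' => by
  rw [Finset.mem_singleton.1 (Finsupp.support_single_subset hW')]
  exact hW

lemma nuWord_eq {W : FreeMonoid WickSymbol} (hW : W ∈ discWickWords) :
    nuWord W = fockIso.symm (wordVec W) := by
  have h1 := represents_fockIso_symm (single_mem_upsWDisc hW 1)
  rw [fockMap_single, one_smul] at h1
  have h : ∃ v, Represents (MonoidAlgebra.single W 1) v := ⟨_, h1⟩
  rw [nuWord, dif_pos h]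
  exact h.choose_spec.unique h1

lemma fockIso_nu (F : upsWDisc) : fockIso (nu F) = fockMap (F : UpsW) := by
  have h1 : nu F = ∑ W ∈ (F : UpsW).coeff.support, (F : UpsW).coeff W • nuWord W := rfl
  have h2 : fockMap (F : UpsW) =
    ∑ W ∈ (F : UpsW).coeff.support, (F : UpsW).coeff W • wordVec W := rfl
  rw [h1, h2, map_sum]
  refine Finset.sum_congr rfl fun W hW => ?_
  rw [nuWord_eq (F.2 hW), map_smul, LinearIsometryEquiv.apply_symm_apply]

lemma nu_represents (F : upsWDisc) : Represents F (nu F) := by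
  rw [← fockIso.symm_apply_apply (nu F), fockIso_nu]
  exact represents_fockIso_symm F.2

lemma nu0_mem_dom (G : PreHilb) : nu0 G ∈ dom := by
  refine ⟨⟨toWick G.val, toWick_mem_upsWDisc G.val_mem⟩, fockIso.injective ?_⟩
  rw [fockIso_nu, fockIso_nu0, fockPre_apply]

lemma dense_dom : Dense (dom : Set Hilb) :=
  denseRange_nu0.mono (Set.range_subset_iff.2 nu0_mem_dom)

/-- The occupation number basis of the Hilbert space. -/
def occBasis : HilbertBasis (ℕ →₀ ℕ) ℂ Hilb := HilbertBasis.ofRepr fockIso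

lemma inner_occBasis (α : ℕ →₀ ℕ) (x : Hilb) : inner ℂ (occBasis α) x = fockIso x α :=
  (occBasis.repr_apply_apply x α).symm

/-- The fields of the normal ordered product with `α k` fields `∂^(k+1) X(0)`. -/
def modeLegs (α : ℕ →₀ ℕ) : List Leg := α.toMultiset.toList.map fun k => (k.succPNat, 0)

/-- The normal ordered product with `α k` fields `∂^(k+1) X(0)`. -/
def modeWord (α : ℕ →₀ ℕ) : FreeMonoid WickSymbol :=
  if h : modeLegs α = [] then 1 else FreeMonoid.of ⟨modeLegs α, h⟩

lemma wickLegs_modeWord (α : ℕ →₀ ℕ) :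
    wickLegs (modeWord α) = (modeLegs α).map fun l => (0, l) := by
  unfold modeWord
  split_ifs with h
  · rw [h, wickLegs_one, List.map_nil]
  · rw [wickLegs_of]

lemma modeWord_mem_discWickWords (α : ℕ →₀ ℕ) : modeWord α ∈ discWickWords := by
  unfold modeWord
  split_ifs with h
  · exact ⟨by simp, by simp⟩
  · refine ⟨fun Z hZ l hl => ?_, by simp [FreeMonoid.toList_of]⟩
    rw [FreeMonoid.toList_of, List.mem_singleton] at hZ
    subst hZ
    obtain ⟨k, -, rfl⟩ := List.mem_map.1 hl
    simp

lemma wickProd_zero {ι R : Type*} [CommRing R] [Algebra ℂ R] (u : ι → R) (L : List ι) :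
    wickProd u (fun _ _ => 0) L = (L.map u).prod := by
  induction L with
  | nil => simp [wickProd_nil]
  | cons x L ih => simp [wickProd_cons, ih]

lemma wordCoeff_modeWord (α β : ℕ →₀ ℕ) : wordCoeff (modeWord α) β =
    if α = β then (α.toMultiset.toList.map fun k => (legScale k : ℂ)).prod else 0 := by
  classical
  let N := max (α.support.sup Nat.succ) (β.support.sup Nat.succ)
  have hN : ∀ k ∈ β.support, k < N := fun k hk =>
    (lt_sup_succ β k hk).trans_le (le_max_right _ _)
  have hone : ∀ k ∈ α.toMultiset.toList,
      oneVec N (legVec (k.succPNat, 0)) =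
        MvPolynomial.monomial (Finsupp.single k 1) (legScale k : ℂ) := by
    intro k hk
    have hk' : k < N := by
      rw [Multiset.mem_toList, Finsupp.mem_toMultiset] at hk
      exact (lt_sup_succ α k hk).trans_le (le_max_left _ _)
    simp only [oneVec, legVec_zero]
    rw [Finset.sum_eq_single k]
    · simp [MvPolynomial.X, MvPolynomial.smul_monomial]
    · intro j _ hj
      simp [hj]
    · intro h
      exact absurd (Finset.mem_range.2 hk') h
  have hmon : ∀ l : List ℕ, (l.map fun k => MvPolynomial.monomial (Finsupp.single k 1)
      (legScale k : ℂ)).prod = MvPolynomial.monomial (Multiset.toFinsupp (l : Multiset ℕ))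
        (l.map fun k => (legScale k : ℂ)).prod := by
    intro l
    induction l with
    | nil => simp
    | cons k l ih =>
      rw [List.map_cons, List.prod_cons, ih, MvPolynomial.monomial_mul, List.map_cons,
        List.prod_cons, ← Multiset.cons_coe, ← Multiset.singleton_add, map_add,
        Multiset.toFinsupp_singleton]
  have h1 : wordCoeff (modeWord α) β = (fockVec N (fun p : ℕ × Leg => legVec p.2) wickTwoPoint
      (wickLegs (modeWord α))).coeff β := by
    rw [coeff_fockVec, if_pos hN, wordCoeff]
  have h2 : ∀ L : List Leg, wickProd (fun x : Leg => oneVec N (legVec x))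
      (fun x y => wickTwoPoint (0, x) (0, y)) L = (L.map fun x => oneVec N (legVec x)).prod := by
    intro L
    simp only [wickTwoPoint, if_true]
    exact wickProd_zero _ L
  rw [h1, fockVec_eq_wickProd, wickLegs_modeWord, wickProd_map, h2, modeLegs, List.map_map,
    Function.comp_def, List.map_congr_left hone, hmon, MvPolynomial.coeff_monomial,
    Multiset.coe_toList, Finsupp.toMultiset_toFinsupp]

lemma occBasis_mem_dom (α : ℕ →₀ ℕ) : occBasis α ∈ dom := by
  classical
  set c : ℂ := (√(multiFact α) : ℂ) * (α.toMultiset.toList.map fun k => (legScale k : ℂ)).prod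
    with hc
  have hc0 : c ≠ 0 := by
    refine mul_ne_zero (Complex.ofReal_ne_zero.2 (Real.sqrt_pos.2 (multiFact_pos α)).ne')
      (List.prod_ne_zero ?_)
    intro h
    obtain ⟨k, -, hk⟩ := List.mem_map.1 h
    exact legScale_ne_zero k hk
  have h1 : wordVec (modeWord α) = c • lp.single 2 α (1 : ℂ) := by
    ext β
    rw [wordVec_apply (norm_lt_of_mem_discWickWords (modeWord_mem_discWickWords α)),
      wordCoeff_modeWord]
    by_cases h : α = β
    · subst h
      simp [hc]
    · simp [h, lp.single_apply, Ne.symm h]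
  have h2 : nu ⟨_, single_mem_upsWDisc (modeWord_mem_discWickWords α) c⁻¹⟩ = occBasis α := by
    apply fockIso.injective
    rw [fockIso_nu, fockMap_single, h1, smul_smul, inv_mul_cancel₀ hc0, one_smul]
    exact (occBasis.repr_self α).symm
  rw [← h2]
  exact LinearMap.mem_range_self _ _

/-! ### Hilbert–Schmidt functionals on a Hilbert space -/

section HilbertSchmidt

variable {H : Type*} [NormedAddCommGroup H] [InnerProductSpace ℂ H]

lemma hasSum_sq_iff_tsum_enorm {κ : Type*} {g : κ → ℂ} {s : ℝ} (hs : 0 ≤ s) :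
    HasSum (fun x => ‖g x‖ ^ 2) s ↔ ∑' x, ‖g x‖ₑ ^ 2 = ENNReal.ofReal s := by
  have e : ∀ x, ‖g x‖ₑ ^ 2 = ENNReal.ofReal (‖g x‖ ^ 2) := fun x => by
    rw [ENNReal.ofReal_pow (norm_nonneg _), ofReal_norm]
  constructor
  · intro h
    simp only [e]
    rw [← ENNReal.ofReal_tsum_of_nonneg (fun _ => sq_nonneg _) h.summable, h.tsum_eq]
  · intro h
    have hne : ∑' x, ‖g x‖ₑ ^ 2 ≠ ⊤ := h ▸ ENNReal.ofReal_ne_top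
    have h1 := ENNReal.hasSum_toReal hne
    rw [← ENNReal.tsum_toReal_eq (ENNReal.ne_top_of_tsum_ne_top hne), h,
      ENNReal.toReal_ofReal hs] at h1
    refine h1.congr_fun fun x => ?_
    rw [e, ENNReal.toReal_ofReal (sq_nonneg _)]

/-- Parseval's identity. -/
lemma tsum_enorm_inner_sq {ι : Type*} (b : HilbertBasis ι ℂ H) (x : H) :
    ∑' i, ‖inner ℂ (b i) x‖ₑ ^ 2 = ‖x‖ₑ ^ 2 := by
  have h := Complex.hasSum_re (b.hasSum_inner_mul_inner x x)
  have h' : HasSum (fun i => ‖inner ℂ (b i) x‖ ^ 2) (‖x‖ ^ 2) := by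
    have e : (inner ℂ x x).re = ‖x‖ ^ 2 := inner_self_eq_norm_sq (𝕜 := ℂ) x
    rw [e] at h
    refine h.congr_fun fun i => ?_
    rw [← inner_conj_symm x (b i), ← Complex.normSq_eq_conj_mul_self, Complex.ofReal_re,
      Complex.normSq_eq_norm_sq]
  rw [(hasSum_sq_iff_tsum_enorm (sq_nonneg _)).1 h', ENNReal.ofReal_pow (norm_nonneg _),
    ofReal_norm]

lemma tsum_enorm_apply_sq [CompleteSpace H] {ι κ : Type*} (b : HilbertBasis ι ℂ H)
    (c : HilbertBasis κ ℂ H) (f : H →L[ℂ] ℂ) : ∑' i, ‖f (b i)‖ₑ ^ 2 = ∑' j, ‖f (c j)‖ₑ ^ 2 := by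
  obtain ⟨y, rfl⟩ := (InnerProductSpace.toDual ℂ H).surjective f
  have e : ∀ x : H, ‖InnerProductSpace.toDual ℂ H y x‖ₑ = ‖inner ℂ x y‖ₑ := fun x => by
    rw [InnerProductSpace.toDual_apply_apply, ← inner_conj_symm, RCLike.enorm_conj]
  simp only [e, tsum_enorm_inner_sq]

lemma tsum_fin_succ {ι : Type*} {r : ℕ} (f : (Fin (r + 1) → ι) → ENNReal) :
    ∑' α, f α = ∑' (t : ι) (α : Fin r → ι), f (Fin.cons t α) := by
  rw [← (Fin.consEquiv fun _ : Fin (r + 1) => ι).tsum_eq, ENNReal.tsum_prod']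
  rfl

lemma tsum_enorm_curryLeft {ι : Type*} (b : ι → H) {r : ℕ}
    (B : ContinuousMultilinearMap ℂ (fun _ : Fin (r + 1) => H) ℂ) :
    ∑' α : Fin (r + 1) → ι, ‖B fun i => b (α i)‖ₑ ^ 2 =
      ∑' (t : ι) (α : Fin r → ι), ‖B.curryLeft (b t) fun i => b (α i)‖ₑ ^ 2 := by
  rw [tsum_fin_succ]
  refine tsum_congr fun t => tsum_congr fun α => ?_
  rw [ContinuousMultilinearMap.curryLeft_apply]
  congr 3
  ext i
  refine Fin.cases ?_ (fun i => ?_) i <;> simp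

/-- The Hilbert–Schmidt norm does not depend on the orthonormal basis: the bases can be exchanged
in one slot after the other. -/
lemma tsum_enorm_multilinear_sq [CompleteSpace H] {ι κ : Type*} (b : HilbertBasis ι ℂ H)
    (c : HilbertBasis κ ℂ H) {r : ℕ} (B : ContinuousMultilinearMap ℂ (fun _ : Fin r => H) ℂ) :
    ∑' α : Fin r → ι, ‖B fun i => b (α i)‖ₑ ^ 2 = ∑' α : Fin r → κ, ‖B fun i => c (α i)‖ₑ ^ 2 := by
  induction r with
  | zero =>
    rw [tsum_fintype, tsum_fintype, Fintype.sum_unique, Fintype.sum_unique]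
    congr 3
    ext i
    exact i.elim0
  | succ r ih =>
    rw [tsum_enorm_curryLeft, tsum_enorm_curryLeft, tsum_congr fun t => ih (B.curryLeft (b t)),
      ENNReal.tsum_comm]
    conv_rhs => rw [ENNReal.tsum_comm]
    refine tsum_congr fun α => ?_
    have h := tsum_enorm_apply_sq b c
      (B.toContinuousLinearMap (Fin.cons 0 fun i => c (α i)) 0)
    simpa [ContinuousMultilinearMap.curryLeft_apply, Fin.update_cons_zero] using h

lemma tsum_prod_eq_prod_tsum {ι : Type*} {r : ℕ} (f : Fin r → ι → ENNReal) :
    ∑' α : Fin r → ι, ∏ i, f i (α i) = ∏ i, ∑' t, f i t := by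
  induction r with
  | zero => simp
  | succ r ih =>
    rw [tsum_fin_succ, Fin.prod_univ_succ, ← ih fun i => f i.succ, ← ENNReal.tsum_mul_right]
    refine tsum_congr fun t => ?_
    rw [← ENNReal.tsum_mul_left]
    refine tsum_congr fun α => ?_
    rw [Fin.prod_univ_succ]
    simp

/-- The product of the coordinates of `r` vectors, as a multilinear functional. -/
def coordProd {ι : Type*} (b : HilbertBasis ι ℂ H) {r : ℕ} (α : Fin r → ι) :
    MultilinearMap ℂ (fun _ : Fin r => H) ℂ :=
  (MultilinearMap.mkPiAlgebra ℂ (Fin r) ℂ).compLinearMap fun i => (innerSL ℂ (b (α i))).toLinearMap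

lemma coordProd_apply {ι : Type*} (b : HilbertBasis ι ℂ H) {r : ℕ} (α : Fin r → ι)
    (x : Fin r → H) : coordProd b α x = ∏ i, inner ℂ (b (α i)) (x i) := by
  simp [coordProd]

lemma hasSum_norm_coordProd_sq {ι : Type*} (b : HilbertBasis ι ℂ H) {r : ℕ} (x : Fin r → H) :
    HasSum (fun α => ‖coordProd b α x‖ ^ 2) ((∏ i, ‖x i‖) ^ 2) := by
  rw [hasSum_sq_iff_tsum_enorm (sq_nonneg _)]
  have e : ∀ α : Fin r → ι, ‖coordProd b α x‖ₑ ^ 2 = ∏ i, ‖inner ℂ (b (α i)) (x i)‖ₑ ^ 2 := by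
    intro α
    rw [coordProd_apply, Finset.prod_pow, ← ofReal_norm, norm_prod,
      ENNReal.ofReal_prod_of_nonneg fun _ _ => norm_nonneg _]
    simp only [ofReal_norm]
  simp only [e]
  rw [tsum_prod_eq_prod_tsum fun i t => ‖inner ℂ (b t) (x i)‖ₑ ^ 2]
  simp only [tsum_enorm_inner_sq]
  rw [← Finset.prod_pow, ENNReal.ofReal_prod_of_nonneg fun _ _ => sq_nonneg _]
  refine Finset.prod_congr rfl fun i _ => ?_
  rw [ENNReal.ofReal_pow (norm_nonneg _), ofReal_norm]

/-- The coordinates of the tensor `x₁ ⊗ ⋯ ⊗ x_r`. -/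
def tensorCoords {ι : Type*} (b : HilbertBasis ι ℂ H) (r : ℕ) :
    MultilinearMap ℂ (fun _ : Fin r => H) (lp (fun _ : Fin r → ι => ℂ) 2) where
  toFun x := ⟨fun α => coordProd b α x,
    memℓp_two_iff.2 (hasSum_norm_coordProd_sq b x).summable⟩
  map_update_add' x i y z := by
    ext α
    exact (coordProd b α).map_update_add x i y z
  map_update_smul' x i a y := by
    ext α
    exact (coordProd b α).map_update_smul x i a y

lemma norm_lp_two_sq {κ : Type*} (x : lp (fun _ : κ => ℂ) 2) :
    HasSum (fun k => ‖x k‖ ^ 2) (‖x‖ ^ 2) := by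
  have := lp.hasSum_norm (p := 2) (by norm_num) x
  simpa using this

lemma norm_tensorCoords {ι : Type*} (b : HilbertBasis ι ℂ H) {r : ℕ} (x : Fin r → H) :
    ‖tensorCoords b r x‖ = ∏ i, ‖x i‖ := by
  have h := (norm_lp_two_sq (tensorCoords b r x)).unique (hasSum_norm_coordProd_sq b x)
  exact (sq_eq_sq₀ (norm_nonneg _) (Finset.prod_nonneg fun _ _ => norm_nonneg _)).1 h

/-- Square summable coefficients define a Hilbert–Schmidt functional. -/
lemma exists_hilbertSchmidt [CompleteSpace H] {ι : Type*} (b : HilbertBasis ι ℂ H) {r : ℕ}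
    {A : (Fin r → ι) → ℂ} (hA : Summable fun α => ‖A α‖ ^ 2) :
    ∃ (B : ContinuousMultilinearMap ℂ (fun _ : Fin r => H) ℂ) (N : ℝ), 0 ≤ N ∧
      (∀ x, HasSum (fun α => A α * ∏ i, inner ℂ (b (α i)) (x i)) (B x)) ∧
      (∀ x, ‖B x‖ ≤ N * ∏ i, ‖x i‖) ∧
      ∀ {κ : Type} (c : HilbertBasis κ ℂ H),
        HasSum (fun α : Fin r → κ => ‖B fun i => c (α i)‖ ^ 2) (N ^ 2) := by
  classical
  -- the conjugate, as the inner product is antilinear in the first argument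
  let A' : lp (fun _ : Fin r → ι => ℂ) 2 :=
    ⟨fun α => conj (A α), memℓp_two_iff.2 (by simpa only [RCLike.norm_conj] using hA)⟩
  let B₀ : MultilinearMap ℂ (fun _ : Fin r => H) ℂ :=
    (innerSL ℂ A').toLinearMap.compMultilinearMap (tensorCoords b r)
  have hB₀ : ∀ x, ‖B₀ x‖ ≤ ‖A'‖ * ∏ i, ‖x i‖ := fun x => by
    rw [← norm_tensorCoords b x]
    exact norm_inner_le_norm A' _
  have hsum : ∀ x, HasSum (fun α => A α * ∏ i, inner ℂ (b (α i)) (x i)) (B₀ x) := fun x => by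
    refine (lp.hasSum_inner (𝕜 := ℂ) A' (tensorCoords b r x)).congr_fun fun α => ?_
    rw [RCLike.inner_apply, ← coordProd_apply]
    change _ = coordProd b α x * conj (conj (A α))
    rw [Complex.conj_conj, mul_comm]
  refine ⟨B₀.mkContinuous ‖A'‖ hB₀, ‖A'‖, norm_nonneg _, hsum, hB₀, fun {κ} c => ?_⟩
  have hb : ∀ α : Fin r → ι, B₀ (fun i => b (α i)) = A α := by
    intro α
    have h1 := hasSum_single (f := fun β => A β * ∏ i, inner ℂ (b (β i)) (b (α i))) α ?_
    · rw [(hsum _).unique h1]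
      simp [b.orthonormal.1]
    · intro β hβ
      obtain ⟨i, hi⟩ := Function.ne_iff.1 hβ
      rw [Finset.prod_eq_zero (Finset.mem_univ i) (b.orthonormal.2 hi), mul_zero]
  rw [hasSum_sq_iff_tsum_enorm (sq_nonneg _), tsum_enorm_multilinear_sq c b,
    ← hasSum_sq_iff_tsum_enorm (sq_nonneg _)]
  refine (norm_lp_two_sq A').congr_fun fun α => ?_
  rw [MultilinearMap.coe_mkContinuous, hb]
  change _ = ‖conj (A α)‖ ^ 2
  rw [RCLike.norm_conj]

end HilbertSchmidt

/-! ### Gaussian functionals on polynomials -/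

section Gaussian

variable {σ : Type*}

/-- The Gaussian moment of `X ^ β` with covariance `M`. -/
def gaussMoment (M : σ → σ → ℂ) (β : σ →₀ ℕ) : ℂ := pairingSum M β.toMultiset.toList

/-- The Gaussian functional with covariance `M` on polynomials. -/
def gaussFun (M : σ → σ → ℂ) : MvPolynomial σ ℂ →ₗ[ℂ] ℂ :=
  (MvPolynomial.basisMonomials σ ℂ).constr ℂ (gaussMoment M)

lemma gaussFun_monomial (M : σ → σ → ℂ) (β : σ →₀ ℕ) (a : ℂ) :
    gaussFun M (MvPolynomial.monomial β a) = a * gaussMoment M β := by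
  have h := (MvPolynomial.basisMonomials σ ℂ).constr_basis ℂ (gaussMoment M) β
  rw [MvPolynomial.coe_basisMonomials] at h
  rw [show MvPolynomial.monomial β a = a • MvPolynomial.monomial β (1 : ℂ) by
    rw [MvPolynomial.smul_monomial, smul_eq_mul, mul_one], map_smul, gaussFun, h, smul_eq_mul]

lemma gaussMoment_single_add {M : σ → σ → ℂ} (hM : ∀ x y, M x y = M y x) (x : σ) (β : σ →₀ ℕ) :
    gaussMoment M (Finsupp.single x 1 + β) =
      ∑ y ∈ β.support, (β y : ℂ) * (M x y * gaussMoment M (β - Finsupp.single y 1)) := by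
  classical
  have h1 : gaussMoment M (Finsupp.single x 1 + β) = pairingSum M (x :: β.toMultiset.toList) := by
    refine pairingSum_perm hM (Multiset.coe_eq_coe.1 ?_)
    rw [Multiset.coe_toList, ← Multiset.cons_coe, Multiset.coe_toList, map_add,
      Finsupp.toMultiset_single, one_smul, Multiset.singleton_add]
  have h2 : ∀ p ∈ picks β.toMultiset.toList,
      M x p.1 * pairingSum M p.2 = M x p.1 * gaussMoment M (β - Finsupp.single p.1 1) := by
    intro p hp
    congr 1
    refine pairingSum_perm hM (Multiset.coe_eq_coe.1 ?_)
    have h3 := Multiset.coe_eq_coe.2 (picks_perm hp)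
    rw [Multiset.coe_toList, ← Multiset.cons_coe] at h3
    have h4 : Finsupp.single p.1 1 ≤ β := by
      rw [Finsupp.single_le_iff, ← Finsupp.count_toMultiset, ← h3]
      simp
    rw [Multiset.coe_toList, ← Multiset.cons_inj_right p.1, h3]
    conv_lhs => rw [← add_tsub_cancel_of_le h4]
    rw [map_add, Finsupp.toMultiset_single, one_smul, Multiset.singleton_add]
  have h5 : ∀ (l : List σ) (g : σ → ℂ), ((picks l).map fun p => g p.1).sum = (l.map g).sum := by
    intro l g
    congr 1
    refine List.ext_get (by simp [picks]) fun n hn hn' => ?_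
    simp [picks]
  rw [h1, pairingSum_cons, List.map_congr_left h2,
    h5 _ fun y => M x y * gaussMoment M (β - Finsupp.single y 1), ← Multiset.sum_coe,
    ← Multiset.map_coe, Multiset.coe_toList, Finset.sum_multiset_map_count,
    Finsupp.toFinset_toMultiset]
  simp only [Finsupp.count_toMultiset, nsmul_eq_mul]

/-- Integration by parts for the Gaussian functional. -/
lemma gaussFun_X_mul {M : σ → σ → ℂ} (hM : ∀ x y, M x y = M y x) {S : Finset σ}
    (hS : ∀ x, ∀ y ∉ S, M x y = 0) (x : σ) (p : MvPolynomial σ ℂ) :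
    gaussFun M (MvPolynomial.X x * p) = ∑ y ∈ S, M x y * gaussFun M (MvPolynomial.pderiv y p) := by
  classical
  induction p using MvPolynomial.induction_on' with
  | add p q hp hq => simp only [mul_add, map_add, hp, hq, Finset.sum_add_distrib]
  | monomial β a =>
    rw [MvPolynomial.X, MvPolynomial.monomial_mul, one_mul, gaussFun_monomial,
      gaussMoment_single_add hM, Finset.mul_sum]
    simp only [MvPolynomial.pderiv_monomial, gaussFun_monomial]
    rw [Finset.sum_subset (Finset.subset_union_left (s₂ := S)),
      Finset.sum_subset (Finset.subset_union_right (s₁ := β.support) (s₂ := S))]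
    · exact Finset.sum_congr rfl fun y _ => by ring
    · intro y _ hy
      rw [hS x y hy, zero_mul]
    · intro y _ hy
      rw [Finsupp.notMem_support_iff.1 hy]
      simp

lemma derivation_sum_apply {τ R : Type*} [CommRing R] [Algebra ℂ R] (s : Finset τ)
    (D : τ → Derivation ℂ R R) (p : R) : (∑ i ∈ s, D i) p = ∑ i ∈ s, D i p := by
  classical
  induction s using Finset.induction_on with
  | empty => simp
  | insert a s ha ih => rw [Finset.sum_insert ha, Finset.sum_insert ha, Derivation.add_apply, ih]

/-- Wick's theorem for linear combinations of finitely many Gaussian variables. -/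
lemma gaussFun_wickProd {ι : Type*} {M : σ → σ → ℂ} (hM : ∀ x y, M x y = M y x) {S : Finset σ}
    (hS : ∀ x, ∀ y ∉ S, M x y = 0) (w : ι → σ → ℂ) (c : ι → ι → ℂ) (L : List ι) :
    gaussFun M (wickProd (fun x => ∑ s ∈ S, w x s • MvPolynomial.X s) c L) =
      pairingSum (fun x y => c x y + ∑ s ∈ S, ∑ t ∈ S, w x s * w y t * M s t) L := by
  classical
  refine gaussian_wickProd (gaussFun M) ?_
    (fun x => ∑ s ∈ S, w x s • ∑ t ∈ S, M s t • MvPolynomial.pderiv t) ?_ ?_ c L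
  · have := gaussFun_monomial M 0 1
    simpa [gaussMoment, pairingSum_nil] using this
  · intro x y
    have h : ∀ t ∈ S, MvPolynomial.pderiv t (∑ s ∈ S, w y s • MvPolynomial.X s) =
        (MvPolynomial.C (w y t) : MvPolynomial σ ℂ) := by
      intro t ht
      rw [map_sum, Finset.sum_eq_single t]
      · simp [MvPolynomial.smul_eq_C_mul]
      · intro j _ hj
        simp [MvPolynomial.pderiv_X_of_ne hj]
      · exact fun h => absurd ht h
    rw [derivation_sum_apply, map_sum]
    refine Finset.sum_congr rfl fun s _ => ?_
    rw [Derivation.smul_apply, derivation_sum_apply, Finset.smul_sum, map_sum]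
    refine Finset.sum_congr rfl fun t ht => ?_
    rw [Derivation.smul_apply, h t ht, MvPolynomial.algebraMap_eq, MvPolynomial.smul_eq_C_mul,
      MvPolynomial.smul_eq_C_mul, ← map_mul, ← map_mul]
    congr 1
    ring
  · intro x p
    rw [Finset.sum_mul, map_sum, derivation_sum_apply, map_sum]
    refine Finset.sum_congr rfl fun s _ => ?_
    rw [smul_mul_assoc, map_smul, gaussFun_X_mul hM hS, Derivation.smul_apply, map_smul,
      derivation_sum_apply, map_sum]
    congr 1
    refine Finset.sum_congr rfl fun t _ => ?_
    rw [Derivation.smul_apply, map_smul, smul_eq_mul]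

lemma gaussMoment_congr {M M' : σ → σ → ℂ} {β : σ →₀ ℕ}
    (h : ∀ x ∈ β.support, ∀ y ∈ β.support, M x y = M' x y) :
    gaussMoment M β = gaussMoment M' β := by
  refine pairingSum_congr (s := {x | x ∈ β.support}) h _ fun x hx => ?_
  rwa [Multiset.mem_toList, Finsupp.mem_toMultiset] at hx

lemma norm_gaussMoment_sq_le {M : σ → σ → ℂ} {v : σ → ℝ} (hv : ∀ x, 0 ≤ v x)
    (hM : ∀ x y, ‖M x y‖ ≤ v x * v y) (β : σ →₀ ℕ) :
    ‖gaussMoment M β‖ ^ 2 ≤ β.degree.factorial * β.prod fun x n => (v x ^ 2) ^ n := by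
  classical
  have h := norm_pairingSum_le hv hM β.toMultiset.toList
  have h1 : β.toMultiset.toList.length = β.degree := by
    rw [Multiset.length_toList, Finsupp.card_toMultiset]
    rfl
  have h2 : (β.toMultiset.toList.map v).prod = β.prod fun x n => v x ^ n := by
    rw [← Multiset.prod_coe, ← Multiset.map_coe, Multiset.coe_toList,
      Finset.prod_multiset_map_count, Finsupp.toFinset_toMultiset, Finsupp.prod]
    simp only [Finsupp.count_toMultiset]
  rw [h1, h2] at h
  refine (pow_le_pow_left₀ (norm_nonneg _) h 2).trans_eq ?_
  rw [mul_pow, Real.sq_sqrt (by positivity), Finsupp.prod, Finsupp.prod, ← Finset.prod_pow]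
  simp only [← pow_mul, mul_comm]

end Gaussian

/-! ### Gaussian contraction of Fock vectors -/

/-- The multi-index on `Fin r × ℕ` whose restriction to `{i} × ℕ` is `α i`. -/
def totIndex {r : ℕ} (α : Fin r → ℕ →₀ ℕ) : Fin r × ℕ →₀ ℕ :=
  ∑ i, (α i).mapDomain (Prod.mk i)

lemma totIndex_apply {r : ℕ} (α : Fin r → ℕ →₀ ℕ) (i : Fin r) (k : ℕ) :
    totIndex α (i, k) = α i k := by
  classical
  rw [totIndex, Finsupp.finsetSum_apply, Finset.sum_eq_single i]
  · rw [Finsupp.mapDomain_apply (Prod.mk_right_injective i)]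
  · intro j _ hj
    refine Finsupp.mapDomain_of_notMem_range _ _ ?_
    rintro ⟨l, hl⟩
    exact hj (Prod.mk.inj hl).1
  · simp

open Classical in
/-- A covariance, restricted to a finite set of variables. -/
def truncCov {σ : Type*} (S : Finset σ) (M : σ → σ → ℂ) (s t : σ) : ℂ :=
  if s ∈ S ∧ t ∈ S then M s t else 0

lemma gaussFun_prod_rename {r : ℕ} (M : Fin r × ℕ → Fin r × ℕ → ℂ)
    (p : Fin r → MvPolynomial ℕ ℂ) :
    gaussFun M (∏ i, MvPolynomial.rename (Prod.mk i) (p i)) =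
      ∑ α ∈ Fintype.piFinset fun i => (p i).support,
        (∏ i, (p i).coeff (α i)) * gaussMoment M (totIndex α) := by
  have h : ∀ i, MvPolynomial.rename (Prod.mk i) (p i) = ∑ α ∈ (p i).support,
      MvPolynomial.monomial (α.mapDomain (Prod.mk i)) ((p i).coeff α) := by
    intro i
    conv_lhs => rw [(p i).as_sum]
    rw [map_sum]
    simp only [MvPolynomial.rename_monomial]
  simp only [h]
  rw [Finset.prod_univ_sum, map_sum]
  refine Finset.sum_congr rfl fun α _ => ?_
  rw [← MvPolynomial.monomial_sum_prod, gaussFun_monomial]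
  rfl

/-- The Gaussian contraction of the Fock vectors of `r` products of fields is the sum over all
pairings of all fields, where the fields of different factors `x`, `y` are contracted through
`κ x y = ∑ k l, b x k * b y l * M (x, k) (y, l)`. The identity holds for finitely many
modes by Wick's theorem, and the number of modes tends to infinity. -/
lemma tsum_gaussMoment_fockCoeff {ι : Type*} {r : ℕ} {b : ι → ℕ → ℂ} {c : ι → ι → ℂ}
    {L : Fin r → List ι} {M : Fin r × ℕ → Fin r × ℕ → ℂ} (hM : ∀ x y, M x y = M y x)
    (hdiag : ∀ i k l, M (i, k) (i, l) = 0) {s : Set ι} (hL : ∀ i, ∀ x ∈ L i, x ∈ s)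
    {κ : Fin r × ι → Fin r × ι → ℂ}
    (hκ : ∀ x y, x.2 ∈ s → y.2 ∈ s → x.1 ≠ y.1 → Filter.Tendsto
      (fun N => ∑ k ∈ Finset.range N, ∑ l ∈ Finset.range N,
        b x.2 k * b y.2 l * M (x.1, k) (y.1, l)) Filter.atTop (nhds (κ x y)))
    (hsum : Summable fun α : Fin r → ℕ →₀ ℕ =>
      ‖(∏ i, fockCoeff b c (L i) (α i)) * gaussMoment M (totIndex α)‖) :
    ∑' α : Fin r → ℕ →₀ ℕ, (∏ i, fockCoeff b c (L i) (α i)) * gaussMoment M (totIndex α) =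
      pairingSum (fun x y => if x.1 = y.1 then c x.2 y.2 else κ x y)
        (List.ofFn fun i => (L i).map (Prod.mk i)).flatten := by
  classical
  let S : ℕ → Finset (Fin r × ℕ) := fun N => Finset.univ ×ˢ Finset.range N
  have hS : ∀ N (x : Fin r × ℕ), x ∈ S N ↔ x.2 < N := fun N x => by simp [S]
  let w : Fin r × ι → Fin r × ℕ → ℂ := fun x s => if x.1 = s.1 then b x.2 s.2 else 0
  let cc : Fin r × ι → Fin r × ι → ℂ := fun x y => if x.1 = y.1 then c x.2 y.2 else 0
  let Λ : List (Fin r × ι) := (List.ofFn fun i => (L i).map (Prod.mk i)).flatten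
  -- the contraction with `N` modes
  let E : ℕ → ℂ := fun N => gaussFun (truncCov (S N) M)
    (∏ i, MvPolynomial.rename (Prod.mk i) (fockVec N b c (L i)))
  have hE1 : ∀ N, E N = pairingSum (fun x y => cc x y + ∑ k ∈ Finset.range N,
      ∑ l ∈ Finset.range N, b x.2 k * b y.2 l * M (x.1, k) (y.1, l)) Λ := by
    intro N
    have hsymm : ∀ x y, truncCov (S N) M x y = truncCov (S N) M y x := fun x y => by
      simp only [truncCov, and_comm, hM x y]
    have hzero : ∀ x, ∀ y ∉ S N, truncCov (S N) M x y = 0 := fun x y hy =>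
      if_neg fun h => hy h.2
    have h1 : ∀ i, MvPolynomial.rename (Prod.mk i) (fockVec N b c (L i)) =
        wickProd (fun x => ∑ s ∈ S N, w x s • MvPolynomial.X s) cc ((L i).map (Prod.mk i)) := by
      intro i
      rw [fockVec_eq_wickProd, map_wickProd, wickProd_map]
      congr 1
      · ext1 x
        simp only [oneVec, S, w, Finset.sum_product, map_sum, map_smul, MvPolynomial.rename_X]
        rw [Finset.sum_eq_single i]
        · simp
        · intro j _ hj
          simp [Ne.symm hj]
        · simp
      · simp [cc]
    have h2 : ∏ i, MvPolynomial.rename (Prod.mk i) (fockVec N b c (L i)) =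
        wickProd (fun x => ∑ s ∈ S N, w x s • MvPolynomial.X s) cc Λ := by
      rw [wickProd_flatten, List.map_ofFn, List.prod_ofFn]
      · exact Finset.prod_congr rfl fun i _ => h1 i
      · rw [List.pairwise_ofFn]
        intro i j hij x hx y hy
        obtain ⟨x, -, rfl⟩ := List.mem_map.1 hx
        obtain ⟨y, -, rfl⟩ := List.mem_map.1 hy
        exact if_neg hij.ne
    simp only [E]
    rw [h2, gaussFun_wickProd hsymm hzero]
    congr 1
    ext x y
    congr 1
    simp only [S, Finset.sum_product, w]
    rw [Finset.sum_eq_single x.1]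
    · refine Finset.sum_congr rfl fun k hk => ?_
      rw [Finset.sum_eq_single y.1]
      · refine Finset.sum_congr rfl fun l hl => ?_
        simp only [if_true, truncCov]
        rw [if_pos]
        exact ⟨(hS N _).2 (Finset.mem_range.1 hk), (hS N _).2 (Finset.mem_range.1 hl)⟩
      · intro j _ hj
        simp [Ne.symm hj]
      · simp
    · intro j _ hj
      simp [Ne.symm hj]
    · simp
  have hE2 : ∀ N, E N = ∑' α : Fin r → ℕ →₀ ℕ, if ∀ i, ∀ k ∈ (α i).support, k < N then
      (∏ i, fockCoeff b c (L i) (α i)) * gaussMoment M (totIndex α) else 0 := by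
    intro N
    simp only [E]
    rw [gaussFun_prod_rename,
      tsum_eq_sum (s := Fintype.piFinset fun i => (fockVec N b c (L i)).support)]
    · refine Finset.sum_congr rfl fun α hα => ?_
      have hα' : ∀ i, ∀ k ∈ (α i).support, k < N := by
        intro i
        by_contra h
        have := MvPolynomial.mem_support_iff.1 (Fintype.mem_piFinset.1 hα i)
        exact this (coeff_fockVec_eq_zero N b c (L i) h)
      rw [if_pos hα']
      congr 1
      · exact Finset.prod_congr rfl fun i _ => by rw [coeff_fockVec, if_pos (hα' i)]
      · have hm : ∀ x ∈ (totIndex α).support, x ∈ S N := by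
          rintro ⟨i, k⟩ hx
          rw [Finsupp.mem_support_iff, totIndex_apply] at hx
          exact (hS N _).2 (hα' i k (Finsupp.mem_support_iff.2 hx))
        exact gaussMoment_congr fun x hx y hy => if_pos ⟨hm x hx, hm y hy⟩
    · intro α hα
      split_ifs with h
      · rw [Fintype.mem_piFinset] at hα
        push Not at hα
        obtain ⟨i, hi⟩ := hα
        rw [MvPolynomial.notMem_support_iff, coeff_fockVec, if_pos (h i)] at hi
        rw [Finset.prod_eq_zero (Finset.mem_univ i) hi, zero_mul]
      · rfl
  have hlim1 : Filter.Tendsto E Filter.atTop (nhds (pairingSum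
      (fun x y => if x.1 = y.1 then c x.2 y.2 else κ x y) Λ)) := by
    simp only [funext hE1]
    refine tendsto_pairingSum (s := {x | x.2 ∈ s}) ?_ Λ ?_
    · rintro ⟨i, x⟩ hx ⟨j, y⟩ hy
      by_cases hij : i = j
      · subst hij
        simp [cc, hdiag]
      · simpa [cc, hij] using hκ (i, x) (j, y) hx hy hij
    · intro x hx
      obtain ⟨l, hl, hx⟩ := List.mem_flatten.1 hx
      obtain ⟨i, rfl⟩ := List.mem_ofFn.1 hl
      obtain ⟨y, hy, rfl⟩ := List.mem_map.1 hx
      exact hL i y hy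
  have hlim2 : Filter.Tendsto E Filter.atTop (nhds (∑' α : Fin r → ℕ →₀ ℕ,
      (∏ i, fockCoeff b c (L i) (α i)) * gaussMoment M (totIndex α))) := by
    simp only [funext hE2]
    refine tendsto_tsum_of_dominated_convergence hsum (fun α => ?_)
      (Filter.Eventually.of_forall fun N α => ?_)
    · refine tendsto_const_nhds.congr' ?_
      filter_upwards [Filter.eventually_ge_atTop
        (Finset.univ.sup fun i => (α i).support.sup Nat.succ)] with N hN
      rw [if_pos fun i k hk => (lt_sup_succ (α i) k hk).trans_le ((Finset.le_sup
        (f := fun i => (α i).support.sup Nat.succ) (Finset.mem_univ i)).trans hN)]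
    · split_ifs
      · exact le_rfl
      · rw [norm_zero]
        exact norm_nonneg _
  exact tendsto_nhds_unique hlim2 hlim1

/-! ### The covariance between different discs -/

/-- The Taylor series of `h! / (1 - (X + Y)) ^ (h + 1)` in two variables. -/
lemma hasSum_taylor_two {h : ℕ} {X Y : ℂ} (hXY : ‖X‖ + ‖Y‖ < 1) :
    HasSum (fun p : ℕ × ℕ => ((h + p.1 + p.2).factorial : ℂ) /
      (p.1.factorial * p.2.factorial) * (X ^ p.1 * Y ^ p.2))
      (h.factorial / (1 - (X + Y)) ^ (h + 1)) := by
  -- the terms of total degree `n`; real `x`, `y` serve for the absolute convergence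
  have anti : ∀ {K : Type} [RCLike K] (x y : K) (n : ℕ),
      ∑ p ∈ Finset.HasAntidiagonal.antidiagonal n,
      ((h + p.1 + p.2).factorial : K) / (p.1.factorial * p.2.factorial) * (x ^ p.1 * y ^ p.2) =
        (h.factorial : K) * (((n + h).choose h : ℕ) * (x + y) ^ n) := by
    intro K _ x y n
    rw [(Commute.all x y).add_pow', Finset.mul_sum, Finset.mul_sum]
    refine Finset.sum_congr rfl fun p hp => ?_
    obtain ⟨u, v⟩ := p
    rw [Finset.HasAntidiagonal.mem_antidiagonal] at hp
    simp only at hp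
    subst hp
    have hu : (u.factorial : K) ≠ 0 := by exact_mod_cast u.factorial_ne_zero
    have hv : (v.factorial : K) ≠ 0 := by exact_mod_cast v.factorial_ne_zero
    have h1 : ((h + u + v).factorial : K) = ((u + v + h).choose h : ℕ) *
        ((u + v).factorial : K) * (h.factorial : K) := by
      have e := Nat.add_choose_mul_factorial_mul_factorial (u + v) h
      rw [show h + u + v = u + v + h by omega, ← e]
      push_cast
      ring
    have h2 : ((u + v).factorial : K) = ((u + v).choose u : ℕ) * (u.factorial : K) *
        (v.factorial : K) := by
      rw [← Nat.add_choose_mul_factorial_mul_factorial u v, ← Nat.choose_symm_add]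
      push_cast
      ring
    rw [h1, h2, nsmul_eq_mul]
    field_simp
  have hsummable : Summable fun p : ℕ × ℕ => ((h + p.1 + p.2).factorial : ℂ) /
      (p.1.factorial * p.2.factorial) * (X ^ p.1 * Y ^ p.2) := by
    refine Summable.of_norm ?_
    rw [← Finset.HasAntidiagonal.sigmaAntidiagonalEquivProd.summable_iff]
    refine (summable_sigma_of_nonneg fun _ => norm_nonneg _).2
      ⟨fun n => (hasSum_fintype _).summable, ?_⟩
    have hn : ‖(‖X‖ + ‖Y‖ : ℝ)‖ < 1 := by
      rwa [Real.norm_of_nonneg (by positivity)]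
    refine ((summable_choose_mul_geometric_of_norm_lt_one h hn).mul_left
      (h.factorial : ℝ)).congr fun n => ?_
    rw [← anti ‖X‖ ‖Y‖ n, tsum_fintype, Finset.univ_eq_attach,
      ← Finset.sum_attach (Finset.HasAntidiagonal.antidiagonal n)]
    refine Finset.sum_congr rfl fun p _ => ?_
    simp [Finset.HasAntidiagonal.sigmaAntidiagonalEquivProd]
  have h1 := Finset.HasAntidiagonal.sigmaAntidiagonalEquivProd.hasSum_iff.2 hsummable.hasSum
  have h2 := h1.sigma fun n => hasSum_fintype _
  have hn : ‖X + Y‖ < 1 := (norm_add_le _ _).trans_lt hXY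
  have h3 := (hasSum_choose_mul_geometric_of_norm_lt_one h hn).mul_left (h.factorial : ℂ)
  have h4 := h2.unique (h3.congr_fun fun n => by
    rw [← anti X Y n, Finset.univ_eq_attach,
      ← Finset.sum_attach (Finset.HasAntidiagonal.antidiagonal n)]
    rfl)
  have h5 := hsummable.hasSum
  rw [h4, mul_one_div] at h5
  exact h5

/-- The covariance of the normalized modes of the discs `z ↦ a i + q i z`; modes of the same disc
are not contracted. -/
def discCov {r : ℕ} (a q : Fin r → ℂ) (x y : Fin r × ℕ) : ℂ :=
  if x.1 = y.1 then 0 else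
    q x.1 ^ (x.2 + 1) * q y.1 ^ (y.2 + 1) *
      legTwoPoint (x.2.succPNat, a x.1) (y.2.succPNat, a y.1) / (legScale x.2 * legScale y.2)

lemma discCov_symm {r : ℕ} (a q : Fin r → ℂ) (x y : Fin r × ℕ) :
    discCov a q x y = discCov a q y x := by
  simp only [discCov, eq_comm, legTwoPoint_symm (x.2.succPNat, a x.1), mul_comm]

/-- The two-point function of fields in different discs, expanded in the modes of the discs. -/
lemma tendsto_discCov {r : ℕ} {a q : Fin r → ℂ} {i j : Fin r} (hij : i ≠ j)
    (hq : ‖q i‖ + ‖q j‖ ≤ ‖a i - a j‖) (hqi : q i ≠ 0) {l l' : Leg} (hl : ‖l.2‖ < 1)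
    (hl' : ‖l'.2‖ < 1) :
    Filter.Tendsto (fun N => ∑ k ∈ Finset.range N, ∑ n ∈ Finset.range N,
      legVec l k * legVec l' n * discCov a q (i, k) (j, n)) Filter.atTop
      (nhds (q i ^ (l.1 : ℕ) * q j ^ (l'.1 : ℕ) *
        legTwoPoint (affLeg (a i) (q i) l) (affLeg (a j) (q j) l'))) := by
  obtain ⟨m, z⟩ := l
  obtain ⟨m', z'⟩ := l'
  simp only at hl hl'
  obtain ⟨s, hs⟩ : ∃ s, (m : ℕ) = s + 1 := ⟨m - 1, by have := m.pos; omega⟩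
  obtain ⟨s', hs'⟩ : ∃ s, (m' : ℕ) = s + 1 := ⟨m' - 1, by have := m'.pos; omega⟩
  set d := a i - a j with hd
  have hqi' : 0 < ‖q i‖ := norm_pos_iff.2 hqi
  have hd0 : 0 < ‖d‖ := by linarith [norm_nonneg (q j)]
  have hd' : d ≠ 0 := norm_pos_iff.1 hd0
  -- `a i + q i z - (a j + q j z') = d (1 - (X + Y))`
  let X := -(q i * z) / d
  let Y := q j * z' / d
  have hXY : ‖X‖ + ‖Y‖ < 1 := by
    simp only [X, Y, norm_div, norm_neg, norm_mul]
    rw [← add_div, div_lt_one hd0]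
    have h1 : ‖q i‖ * ‖z‖ < ‖q i‖ := mul_lt_of_lt_one_right hqi' hl
    have h2 : ‖q j‖ * ‖z'‖ ≤ ‖q j‖ := mul_le_of_le_one_right (norm_nonneg _) hl'.le
    linarith
  have hne : 1 - (X + Y) ≠ 0 := fun h => by
    rw [sub_eq_zero] at h
    have := (norm_add_le X Y).trans_lt hXY
    rw [← h, norm_one] at this
    exact this.false
  let G : ℕ × ℕ → ℂ := fun p => legVec (m, z) p.1 * legVec (m', z') p.2 *
    discCov a q (i, p.1) (j, p.2)
  -- the mode `k` contains the power `z ^ (k + 1 - m)`, which vanishes for `k < m - 1 = s`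
  let sh : ℕ × ℕ → ℕ × ℕ := fun p => (p.1 + s, p.2 + s')
  have hsh : Function.Injective sh := by
    rintro ⟨u, v⟩ ⟨u', v'⟩ h
    simp only [sh, Prod.mk.injEq, add_left_inj] at h
    rw [h.1, h.2]
  have hG0 : ∀ p ∉ Set.range sh, G p = 0 := by
    rintro ⟨u, v⟩ hp
    have : u < s ∨ v < s' := by
      by_contra hcon
      push Not at hcon
      exact hp ⟨(u - s, v - s'), by simp only [sh, Prod.mk.injEq]; omega⟩
    rcases this with hu | hv
    · have : legVec (m, z) u = 0 := if_neg (by simp only; omega)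
      simp only [G, this, zero_mul]
    · have : legVec (m', z') v = 0 := if_neg (by simp only; omega)
      simp only [G, this, zero_mul, mul_zero]
  have hGsh : ∀ p, (G ∘ sh) p = (1 / 2 * (-1) ^ (m : ℕ) * q i ^ (m : ℕ) * q j ^ (m' : ℕ) /
      d ^ (s + s' + 2)) * (((s + s' + 1 + p.1 + p.2).factorial : ℂ) /
        (p.1.factorial * p.2.factorial) * (X ^ p.1 * Y ^ p.2)) := by
    rintro ⟨u, v⟩
    have e1 : legVec (m, z) (u + s) = legScale (u + s) * (z ^ u / (u.factorial : ℂ)) := by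
      have := legVec_shift m z u
      rwa [hs, Nat.add_sub_cancel] at this
    have e2 : legVec (m', z') (v + s') = legScale (v + s') * (z' ^ v / (v.factorial : ℂ)) := by
      have := legVec_shift m' z' v
      rwa [hs', Nat.add_sub_cancel] at this
    have h1 := legScale_ne_zero (u + s)
    have h2 := legScale_ne_zero (v + s')
    have hu : (u.factorial : ℂ) ≠ 0 := by exact_mod_cast u.factorial_ne_zero
    have hv : (v.factorial : ℂ) ≠ 0 := by exact_mod_cast v.factorial_ne_zero
    simp only [Function.comp_apply, G, sh, e1, e2, discCov, hij, if_false, legTwoPoint,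
      Nat.succPNat_coe, Nat.succ_eq_add_one, ← hd, hs, hs', X, Y, div_pow, neg_pow (q i * z),
      mul_pow]
    rw [show u + s + 1 + (v + s' + 1) - 1 = s + s' + 1 + u + v by omega,
      show u + s + 1 + (v + s' + 1) = (s + s' + 2) + u + v by omega]
    have e3 : ((-1 : ℂ)) ^ (u + s + 1) = (-1) ^ (s + 1) * (-1) ^ u := by ring
    rw [e3]
    field_simp
    ring
  have hG : HasSum G (q i ^ (m : ℕ) * q j ^ (m' : ℕ) *
      legTwoPoint (affLeg (a i) (q i) (m, z)) (affLeg (a j) (q j) (m', z'))) := by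
    rw [← hsh.hasSum_iff hG0, funext hGsh]
    have := (hasSum_taylor_two (h := s + s' + 1) hXY).mul_left
      (1 / 2 * (-1) ^ (m : ℕ) * q i ^ (m : ℕ) * q j ^ (m' : ℕ) / d ^ (s + s' + 2))
    have e : a i + q i * z - (a j + q j * z') = d * (1 - (X + Y)) := by
      simp only [X, Y]
      field_simp
      rw [hd]
      ring
    have e0 : q i ^ (m : ℕ) * q j ^ (m' : ℕ) *
        legTwoPoint (affLeg (a i) (q i) (m, z)) (affLeg (a j) (q j) (m', z')) =
        1 / 2 * (-1) ^ (m : ℕ) * q i ^ (m : ℕ) * q j ^ (m' : ℕ) / d ^ (s + s' + 2) *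
          ((s + s' + 1).factorial / (1 - (X + Y)) ^ (s + s' + 1 + 1)) := by
      simp only [legTwoPoint, affLeg, hs, hs']
      rw [e, mul_pow, show s + 1 + (s' + 1) - 1 = s + s' + 1 by omega,
        show s + 1 + (s' + 1) = s + s' + 2 by omega]
      field_simp
    rw [e0]
    exact this
  have hfin : Filter.Tendsto (fun N : ℕ => Finset.range N ×ˢ Finset.range N) Filter.atTop
      Filter.atTop := by
    refine Filter.tendsto_atTop_finset_of_monotone (fun N N' h => ?_) fun p => ?_
    · exact Finset.product_subset_product (Finset.range_mono h) (Finset.range_mono h)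
    · exact ⟨p.1 + p.2 + 1, by simp⟩
  have := hG.comp hfin
  simpa only [Function.comp_def, Finset.sum_product, G] using this

/-- The norms of the modes compensate the factorial in the two-point function up to a power of
two: with `m = k + 1`, `n = l + 1` this is `(m + n choose m) * √(m n) ≤ 2 ^ (m + n) * (m + n)`. -/
lemma factorial_le_legScale_mul (k l : ℕ) :
    1 / 2 * ((k + l + 1).factorial : ℝ) ≤ legScale k * legScale l * 2 ^ (k + l + 2) := by
  set m : ℝ := (k : ℝ) + 1 with hm
  set n : ℝ := (l : ℝ) + 1 with hn
  have hm0 : 0 < m := by positivity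
  have hn0 : 0 < n := by positivity
  set P := √(m / 2) * √(n / 2) with hP
  have hP0 : 0 < P := by positivity
  have hP2 : 4 * P ^ 2 = m * n := by
    rw [hP, mul_pow, Real.sq_sqrt (by positivity), Real.sq_sqrt (by positivity)]
    ring
  have hPm : 2 * P ≤ m + n := by
    refine abs_le_of_sq_le_sq' ?_ (by positivity) |>.2
    nlinarith
  have hscale : legScale k * legScale l = P * (k.factorial * l.factorial) := by
    simp only [legScale, hP, hm, hn]
    ring
  have hC : ((k + l + 2).choose (k + 1) : ℝ) ≤ 2 ^ (k + l + 2) := by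
    exact_mod_cast Nat.choose_le_two_pow (k + l + 2) (k + 1)
  have hfac : (m + n) * ((k + l + 1).factorial : ℝ) =
      ((k + l + 2).choose (k + 1) : ℝ) * (m * n * (k.factorial * l.factorial)) := by
    have h1 := Nat.add_choose_mul_factorial_mul_factorial (k + 1) (l + 1)
    rw [← Nat.choose_symm_add, show k + 1 + (l + 1) = k + l + 1 + 1 by omega,
      Nat.factorial_succ, Nat.factorial_succ, Nat.factorial_succ] at h1
    have h2 : (((k + l + 1 + 1).choose (k + 1) * ((k + 1) * k.factorial) *
      ((l + 1) * l.factorial) : ℕ) : ℝ) = (((k + l + 1 + 1) * (k + l + 1).factorial : ℕ) : ℝ) := by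
      rw [h1]
    push_cast at h2
    rw [hm, hn, show (k : ℝ) + 1 + (l + 1) = k + l + 1 + 1 by ring, ← h2]
    ring
  have hF : (0 : ℝ) < k.factorial * l.factorial := by positivity
  rw [hscale]
  refine le_of_mul_le_mul_left ?_ (by positivity : 0 < m + n)
  calc (m + n) * (1 / 2 * ((k + l + 1).factorial : ℝ))
      = ((k + l + 2).choose (k + 1) : ℝ) * (2 * P) * (P * (k.factorial * l.factorial)) := by
        linear_combination (1 / 2) * hfac -
          1 / 2 * ((k + l + 2).choose (k + 1) : ℝ) * (k.factorial * l.factorial) * hP2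
    _ ≤ 2 ^ (k + l + 2) * (m + n) * (P * (k.factorial * l.factorial)) := by gcongr
    _ = _ := by ring

/-- The covariance is dominated by a rank-one kernel, since `‖q i‖ ^ m ‖q j‖ ^ n` is at most
`t ^ (m + n) * ‖a i - a j‖ ^ (m + n)`. -/
lemma norm_discCov_le {r : ℕ} {a q : Fin r → ℂ} {t : ℝ} (ht : 0 ≤ t)
    (h : ∀ i j, i ≠ j → ‖q i‖ ≤ t * ‖a i - a j‖) (hq : ∀ i, q i ≠ 0) (x y : Fin r × ℕ) :
    ‖discCov a q x y‖ ≤ (2 * t) ^ (x.2 + 1) * (2 * t) ^ (y.2 + 1) := by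
  obtain ⟨i, k⟩ := x
  obtain ⟨j, l⟩ := y
  by_cases hij : i = j
  · simp only [discCov, hij, if_true, norm_zero]
    positivity
  have hi := h i j hij
  have hj := h j i (Ne.symm hij)
  rw [norm_sub_rev] at hj
  set d := ‖a i - a j‖ with hd
  have hd0 : 0 < d := by
    refine (norm_nonneg _).lt_of_ne fun h0 => ?_
    rw [← hd] at h0
    rw [← h0, mul_zero] at hi
    exact hq i (norm_le_zero_iff.1 hi)
  have hk := legScale_pos k
  have hl := legScale_pos l
  simp only [discCov, hij, if_false, legTwoPoint, Nat.succPNat_coe, Nat.succ_eq_add_one, norm_div,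
    norm_mul, norm_pow, norm_neg, norm_one, one_pow, mul_one, Complex.norm_natCast,
    Complex.norm_real, Real.norm_of_nonneg hk.le, Real.norm_of_nonneg hl.le, ← hd]
  rw [div_le_iff₀ (by positivity), show k + 1 + (l + 1) - 1 = k + l + 1 by omega]
  calc ‖q i‖ ^ (k + 1) * ‖q j‖ ^ (l + 1) *
        (1 / ‖(2 : ℂ)‖ * ((k + l + 1).factorial : ℝ) / d ^ (k + 1 + (l + 1)))
      ≤ (t * d) ^ (k + 1) * (t * d) ^ (l + 1) *
        (legScale k * legScale l * 2 ^ (k + l + 2) / d ^ (k + 1 + (l + 1))) := by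
        have := factorial_le_legScale_mul k l
        rw [Complex.norm_ofNat]
        gcongr
    _ = _ := by
        rw [mul_pow, mul_pow, mul_pow, mul_pow]
        field_simp
        ring

/-! ### Square summability of the coefficients -/

/-- The sum over all multi-indices is `∑ n, (∑ x, w x) ^ n`, by the multinomial theorem. -/
lemma summable_multinomial {σ : Type*} {w : σ → ℝ} (hw : ∀ x, 0 ≤ w x) {c : ℝ} (hc : c < 1)
    (hs : ∀ S : Finset σ, ∑ x ∈ S, w x ≤ c) :
    Summable fun β : σ →₀ ℕ => (β.degree.factorial : ℝ) * (β.prod fun x n => w x ^ n) /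
      β.prod fun _ n => (n.factorial : ℝ) := by
  classical
  have hc0 : 0 ≤ c := by simpa using hs ∅
  have hpos : ∀ β : σ →₀ ℕ, 0 ≤ (β.degree.factorial : ℝ) * (β.prod fun x n => w x ^ n) /
      β.prod fun _ n => (n.factorial : ℝ) := fun β => by
    refine div_nonneg (mul_nonneg (by positivity) ?_) ?_
    · exact Finset.prod_nonneg fun x _ => pow_nonneg (hw x) _
    · exact Finset.prod_nonneg fun x _ => by positivity
  refine summable_of_sum_le (c := (1 - c)⁻¹) hpos fun T => ?_
  let S := T.biUnion fun β => β.support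
  have hS : ∀ β ∈ T, β.support ⊆ S := fun β hβ => Finset.subset_biUnion_of_mem _ hβ
  let N := T.sup Finsupp.degree + 1
  have hN : ∀ β ∈ T, β.degree ∈ Finset.range N := fun β hβ =>
    Finset.mem_range.2 (Nat.lt_succ_of_le (Finset.le_sup (f := Finsupp.degree) hβ))
  have hterm : ∀ β ∈ T, (β.degree.factorial : ℝ) * (β.prod fun x n => w x ^ n) /
      (β.prod fun _ n => (n.factorial : ℝ)) =
        (Nat.multinomial S β : ℝ) * ∏ x ∈ S, w x ^ β x := by
    intro β hβ
    rw [Finsupp.prod_of_support_subset β (hS β hβ) _ (by simp),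
      Finsupp.prod_of_support_subset β (hS β hβ) _ (by simp)]
    have h1 : β.degree = ∑ x ∈ S, β x := by
      rw [Finsupp.degree_apply]
      exact Finset.sum_subset (hS β hβ) fun x _ hx => Finsupp.notMem_support_iff.1 hx
    have h2 : (∏ x ∈ S, ((β x).factorial : ℝ)) * Nat.multinomial S β =
        (β.degree.factorial : ℝ) := by
      rw [h1, ← Nat.multinomial_spec S β]
      push_cast
      rfl
    have h3 : (∏ x ∈ S, ((β x).factorial : ℝ)) ≠ 0 :=
      Finset.prod_ne_zero_iff.2 fun x _ => by positivity
    rw [← h2]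
    field_simp
  have hfiber : ∀ n, ∑ β ∈ T with β.degree = n, (β.degree.factorial : ℝ) *
      (β.prod fun x n => w x ^ n) / (β.prod fun _ n => (n.factorial : ℝ)) ≤ c ^ n := by
    intro n
    calc _ = ∑ β ∈ T with β.degree = n, (Nat.multinomial S β : ℝ) * ∏ x ∈ S, w x ^ β x :=
          Finset.sum_congr rfl fun β hβ => hterm β (Finset.mem_filter.1 hβ).1
      _ = ∑ k ∈ (T.filter fun β => β.degree = n).image
            (fun β : σ →₀ ℕ => (β : σ → ℕ)),
            (Nat.multinomial S k : ℝ) * ∏ x ∈ S, w x ^ k x :=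
          by
            rw [Finset.sum_image]
            exact fun β _ β' _ h => Finsupp.ext fun x => congrFun h x
      _ ≤ ∑ k ∈ S.piAntidiag n, (Nat.multinomial S k : ℝ) * ∏ x ∈ S, w x ^ k x := by
          refine Finset.sum_le_sum_of_subset_of_nonneg ?_ fun k _ _ =>
            mul_nonneg (by positivity) (Finset.prod_nonneg fun x _ => pow_nonneg (hw x) _)
          intro k hk
          obtain ⟨β, hβ, rfl⟩ := Finset.mem_image.1 hk
          obtain ⟨hβT, rfl⟩ := Finset.mem_filter.1 hβ
          rw [Finset.mem_piAntidiag]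
          refine ⟨?_, fun x hx => hS β hβT (Finsupp.mem_support_iff.2 hx)⟩
          rw [Finsupp.degree_apply]
          exact (Finset.sum_subset (hS β hβT) fun x _ hx => Finsupp.notMem_support_iff.1 hx).symm
      _ = (∑ x ∈ S, w x) ^ n := (Finset.sum_pow_eq_sum_piAntidiag S w n).symm
      _ ≤ c ^ n := pow_le_pow_left₀ (Finset.sum_nonneg fun x _ => hw x) (hs S) n
  rw [← Finset.sum_fiberwise_of_maps_to hN]
  calc _ ≤ ∑ n ∈ Finset.range N, c ^ n := Finset.sum_le_sum fun n _ => hfiber n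
    _ ≤ ∑' n, c ^ n := (summable_geometric_of_lt_one hc0 hc).sum_le_tsum _
        fun n _ => pow_nonneg hc0 n
    _ = (1 - c)⁻¹ := tsum_geometric_of_lt_one hc0 hc

lemma totIndex_injective {r : ℕ} :
    Function.Injective (totIndex : (Fin r → ℕ →₀ ℕ) → (Fin r × ℕ →₀ ℕ)) := fun α β h => by
  ext i k
  rw [← totIndex_apply α, h, totIndex_apply]

lemma prod_multiFact {r : ℕ} (α : Fin r → ℕ →₀ ℕ) :
    ∏ i, multiFact (α i) = (totIndex α).prod fun _ n => (n.factorial : ℝ) := by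
  classical
  let S := Finset.univ.biUnion fun i => (α i).support
  have hS : ∀ i, (α i).support ⊆ S := fun i =>
    Finset.subset_biUnion_of_mem (fun i => (α i).support) (Finset.mem_univ i)
  have h : (totIndex α).support ⊆ Finset.univ ×ˢ S := by
    rintro ⟨i, k⟩ hk
    rw [Finsupp.mem_support_iff, totIndex_apply] at hk
    exact Finset.mem_product.2 ⟨Finset.mem_univ _, hS i (Finsupp.mem_support_iff.2 hk)⟩
  rw [Finsupp.prod_of_support_subset _ h _ (by simp), Finset.prod_product]
  refine Finset.prod_congr rfl fun i _ => ?_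
  rw [multiFact, Finsupp.prod_of_support_subset _ (hS i) _ (by simp)]
  simp only [totIndex_apply]

/-- The coefficients of the amplitude of the discs `z ↦ a i + q i z` in the occupation number
basis, whose vectors are the normalized monomials `X ^ α / √α!`. -/
def amplitudeCoeff {r : ℕ} (a q : Fin r → ℂ) (α : Fin r → ℕ →₀ ℕ) : ℂ :=
  gaussMoment (discCov a q) (totIndex α) / ∏ i, (√(multiFact (α i)) : ℂ)

/-- The total weight `∑ (i, k), (2 t) ^ (2 (k + 1))` with `t = 1 / (4 √r)` is
`r / (4 r - 1) ≤ 1 / 3`. -/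
lemma summable_norm_amplitudeCoeff_sq {r : ℕ} (hr : 1 ≤ r) {a q : Fin r → ℂ}
    (h : ∀ i j, i ≠ j → 4 * √(r : ℝ) * ‖q i‖ ≤ ‖a i - a j‖) (hq : ∀ i, q i ≠ 0) :
    Summable fun α => ‖amplitudeCoeff a q α‖ ^ 2 := by
  have hr0 : (1 : ℝ) ≤ r := by exact_mod_cast hr
  have hsr : 0 < √(r : ℝ) := Real.sqrt_pos.2 (by linarith)
  set t : ℝ := 1 / (4 * √(r : ℝ)) with ht
  have ht0 : 0 ≤ t := by positivity
  set x : ℝ := (2 * t) ^ 2 with hx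
  have hx' : x = 1 / (4 * r) := by
    rw [hx, ht]
    field_simp
    rw [Real.sq_sqrt (by linarith)]
    ring
  have hx0 : 0 ≤ x := by positivity
  have hx1 : x ≤ 1 / 4 := by
    rw [hx', div_le_div_iff₀ (by positivity) (by norm_num)]
    linarith
  have hrx : r * x = 1 / 4 := by
    rw [hx']
    field_simp
  let v : Fin r × ℕ → ℝ := fun p => (2 * t) ^ (p.2 + 1)
  have hv : ∀ p, 0 ≤ v p := fun p => by positivity
  have hv2 : ∀ p, v p ^ 2 = x * x ^ p.2 := fun p => by
    simp only [v, hx]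
    rw [← pow_succ', ← pow_mul, ← pow_mul, mul_comm 2 (p.2 + 1)]
  have hM := norm_gaussMoment_sq_le hv (norm_discCov_le (a := a) ht0 (fun i j hij => by
    have := h i j hij
    rw [ht, one_div_mul_eq_div, le_div_iff₀ (by positivity)]
    linarith) hq)
  have hsum : ∀ S : Finset (Fin r × ℕ), ∑ p ∈ S, v p ^ 2 ≤ 1 / 3 := by
    intro S
    classical
    have hsub : S ⊆ Finset.univ ×ˢ S.image Prod.snd := fun p hp =>
      Finset.mem_product.2 ⟨Finset.mem_univ _, Finset.mem_image_of_mem _ hp⟩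
    have hx1' : x < 1 := by linarith
    calc ∑ p ∈ S, v p ^ 2 ≤ ∑ p ∈ Finset.univ ×ˢ S.image Prod.snd, v p ^ 2 :=
          Finset.sum_le_sum_of_subset_of_nonneg hsub fun p _ _ => sq_nonneg _
      _ = r * x * ∑ k ∈ S.image Prod.snd, x ^ k := by
          simp only [hv2, Finset.sum_product, Finset.sum_const, Finset.card_univ, Fintype.card_fin,
            ← Finset.mul_sum, nsmul_eq_mul]
          ring
      _ ≤ r * x * (1 - x)⁻¹ := by
          gcongr
          rw [← tsum_geometric_of_lt_one hx0 hx1']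
          exact (summable_geometric_of_lt_one hx0 hx1').sum_le_tsum _ fun n _ => pow_nonneg hx0 n
      _ ≤ 1 / 3 := by
          rw [hrx, ← div_eq_mul_inv, div_le_div_iff₀ (by linarith) (by norm_num)]
          linarith
  refine Summable.of_nonneg_of_le (fun _ => sq_nonneg _) (fun α => ?_)
    ((summable_multinomial (fun p => sq_nonneg (v p)) (by norm_num) hsum).comp_injective
      totIndex_injective)
  have e : ‖∏ i, (√(multiFact (α i)) : ℂ)‖ ^ 2 =
      (totIndex α).prod fun _ n => (n.factorial : ℝ) := by
    rw [← prod_multiFact, norm_prod, ← Finset.prod_pow]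
    refine Finset.prod_congr rfl fun i _ => ?_
    rw [Complex.norm_real, Real.norm_of_nonneg (Real.sqrt_nonneg _),
      Real.sq_sqrt (multiFact_nonneg _)]
  rw [amplitudeCoeff, norm_div, div_pow, e]
  refine div_le_div_of_nonneg_right (hM _) (Finset.prod_nonneg fun _ _ => by positivity)

/-! ### The amplitude -/

lemma list_prod_single {r : ℕ} (V : Fin r → FreeMonoid WickSymbol) (c : Fin r → ℂ) :
    (List.ofFn fun i => MonoidAlgebra.single (V i) (c i)).prod =
      MonoidAlgebra.single (List.ofFn V).prod (∏ i, c i) := by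
  induction r with
  | zero => simp [MonoidAlgebra.one_def]
  | succ r ih =>
    rw [List.ofFn_succ, List.prod_cons, ih, MonoidAlgebra.single_mul_single, List.ofFn_succ,
      List.prod_cons, Fin.prod_univ_succ]

/-- The correlation of products of Wick symbols in the discs `z ↦ a i + q i z` as a pairing sum.
Fields of the same disc are contracted as in the unit disc, since the factors `q ^ m` compensate
the scaling of the two-point function. -/
lemma correlation_single {r : ℕ} (a : Fin r → ℂ) {q : Fin r → ℂ} (hq : ∀ i, q i ≠ 0)
    (W : Fin r → FreeMonoid WickSymbol) :
    correlation a q (fun i => MonoidAlgebra.single (W i) 1) =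
      pairingSum (fun x y : Fin r × ℕ × Leg => if x.1 = y.1 then wickTwoPoint x.2 y.2 else
        q x.1 ^ (x.2.2.1 : ℕ) * q y.1 ^ (y.2.2.1 : ℕ) *
          legTwoPoint (affLeg (a x.1) (q x.1) x.2.2) (affLeg (a y.1) (q y.1) y.2.2))
        (List.ofFn fun i => (wickLegs (W i)).map (Prod.mk i)).flatten := by
  obtain ⟨g, hg, hinj⟩ := wickLegs_ofFn_prod fun i => FreeMonoid.map (affSymbol (a i) (q i)) (W i)
  let pt : Fin r × ℕ × Leg → ℕ × Leg := fun x => (g x.1 x.2.1, affLeg (a x.1) (q x.1) x.2.2)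
  let wt : Fin r × ℕ × Leg → ℂ := fun x => q x.1 ^ (x.2.2.1 : ℕ)
  set L := (List.ofFn fun i => (wickLegs (W i)).map (Prod.mk i)).flatten with hL
  have hlist : wickLegs (List.ofFn fun i => FreeMonoid.map (affSymbol (a i) (q i)) (W i)).prod =
      L.map pt := by
    rw [hg, hL, List.map_flatten, List.map_ofFn]
    simp only [wickLegs_map_affSymbol, List.map_map, Function.comp_def, pt]
  have hwt : ∏ i, 1 * ((wickLegs (W i)).map fun p => q i ^ (p.2.1 : ℕ)).prod =
      (L.map wt).prod := by
    rw [hL, List.map_flatten, List.prod_flatten, List.map_ofFn, List.map_ofFn, List.prod_ofFn]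
    simp only [List.map_map, Function.comp_def, wt, one_mul]
  simp only [correlation, J_single]
  rw [list_prod_single, wickExpect_single, hlist, hwt, pairingSum_map, ← pairingSum_weight]
  refine pairingSum_congr (s := {x | x.2.1 < (W x.1).length}) ?_ L fun x hx => ?_
  · rintro ⟨i, n, m, z⟩ hx ⟨j, n', m', z'⟩ hy
    simp only [Set.mem_ofPred_eq] at hx hy
    have hlen : ∀ i, (FreeMonoid.map (affSymbol (a i) (q i)) (W i)).length = (W i).length :=
      fun i => by simp [FreeMonoid.length]
    have h := hinj i j n n' (by rwa [hlen]) (by rwa [hlen])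
    by_cases hij : i = j
    · subst hij
      simp only [wickTwoPoint, pt, wt, if_true]
      -- fields of one Wick symbol have one label before and after the relabelling
      by_cases hn : n = n'
      · simp [hn]
      have hg' : g i n ≠ g i n' := fun e => hn (h e).2
      simp only [hg', hn, if_false, legTwoPoint, affLeg]
      rw [show a i + q i * z - (a i + q i * z') = q i * (z - z') by ring, mul_pow, pow_add (q i)]
      have := hq i
      field_simp
    · have hg' : g i n ≠ g j n' := fun e => hij (h e).1
      simp only [wickTwoPoint, pt, wt, hg', hij, if_false]
  · simp only [hL, List.mem_flatten, List.mem_ofFn] at hx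
    obtain ⟨_, ⟨i, rfl⟩, hx⟩ := hx
    obtain ⟨p, hp, rfl⟩ := List.mem_map.1 hx
    exact label_lt_of_mem_wickLegs hp

lemma amplitudeCoeff_mul_inner {r : ℕ} (a q : Fin r → ℂ) {W : Fin r → FreeMonoid WickSymbol}
    (hW : ∀ i, W i ∈ discWickWords) (α : Fin r → ℕ →₀ ℕ) :
    amplitudeCoeff a q α * ∏ i, inner ℂ (occBasis (α i)) (nuWord (W i)) =
      (∏ i, wordCoeff (W i) (α i)) * gaussMoment (discCov a q) (totIndex α) := by
  have h : ∀ i, inner ℂ (occBasis (α i)) (nuWord (W i)) =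
      (√(multiFact (α i)) : ℂ) * wordCoeff (W i) (α i) := fun i => by
    rw [inner_occBasis, nuWord_eq (hW i), LinearIsometryEquiv.apply_symm_apply,
      wordVec_apply (norm_lt_of_mem_discWickWords (hW i))]
  have h0 : ∏ i, (√(multiFact (α i)) : ℂ) ≠ 0 := Finset.prod_ne_zero_iff.2 fun i _ =>
    Complex.ofReal_ne_zero.2 (Real.sqrt_pos.2 (multiFact_pos _)).ne'
  simp only [h, Finset.prod_mul_distrib, amplitudeCoeff]
  field_simp

/-- The sum over the occupation number basis reproduces the correlation of products of Wick
symbols. -/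
lemma correlation_single_eq {r : ℕ} {a q : Fin r → ℂ} (hq : ∀ i, q i ≠ 0)
    (hsep : ∀ i j, i ≠ j → ‖q i‖ + ‖q j‖ ≤ ‖a i - a j‖) {W : Fin r → FreeMonoid WickSymbol}
    (hW : ∀ i, W i ∈ discWickWords) {v : ℂ}
    (hv : HasSum (fun α => amplitudeCoeff a q α * ∏ i, inner ℂ (occBasis (α i)) (nuWord (W i))) v) :
    v = correlation a q (fun i => MonoidAlgebra.single (W i) 1) := by
  simp only [amplitudeCoeff_mul_inner a q hW] at hv
  rw [correlation_single a hq, ← hv.tsum_eq]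
  exact tsum_gaussMoment_fockCoeff (discCov_symm a q) (fun i k l => if_pos rfl)
    (s := {p | ‖p.2.2‖ < 1}) (fun i => norm_lt_of_mem_discWickWords (hW i))
    (fun x y hx hy hxy => tendsto_discCov hxy (hsep _ _ hxy) (hq _) (by exact hx) (by exact hy))
    hv.summable.norm

/-- The correlation as a multilinear functional. -/
def correlationMap {r : ℕ} (a q : Fin r → ℂ) : MultilinearMap ℂ (fun _ : Fin r => UpsW) ℂ :=
  (wickExpect.compMultilinearMap (MultilinearMap.mkPiAlgebraFin ℂ r UpsW)).compLinearMap
    fun i => (J (a i) (q i)).toLinearMap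

lemma correlationMap_apply {r : ℕ} (a q : Fin r → ℂ) (F : Fin r → UpsW) :
    correlationMap a q F = correlation a q F := rfl

/-- A multilinear functional on the Hilbert space that reproduces the correlations of products of
Wick symbols reproduces all correlations. -/
lemma apply_nu_eq_correlation {r : ℕ} {a q : Fin r → ℂ}
    (B : MultilinearMap ℂ (fun _ : Fin r => Hilb) ℂ)
    (hB : ∀ W : Fin r → FreeMonoid WickSymbol, (∀ i, W i ∈ discWickWords) →
      B (fun i => nuWord (W i)) = correlation a q (fun i => MonoidAlgebra.single (W i) 1))
    (F : Fin r → upsWDisc) : B (fun i => nu (F i)) = correlation a q (fun i => (F i : UpsW)) := by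
  classical
  have h1 : ∀ i, nu (F i) = ∑ W ∈ (F i : UpsW).coeff.support, (F i : UpsW).coeff W • nuWord W :=
    fun i => rfl
  have h2 : ∀ i, (F i : UpsW) = ∑ W ∈ (F i : UpsW).coeff.support,
      (F i : UpsW).coeff W • MonoidAlgebra.single W (1 : ℂ) := fun i => by
    conv_lhs => rw [← MonoidAlgebra.sum_coeff_single (F i : UpsW), Finsupp.sum]
    simp
  rw [← correlationMap_apply, funext h1, show (fun i => (F i : UpsW)) = _ from funext h2,
    MultilinearMap.map_sum_finset, MultilinearMap.map_sum_finset]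
  refine Finset.sum_congr rfl fun W hW => ?_
  rw [MultilinearMap.map_smul_univ, MultilinearMap.map_smul_univ, correlationMap_apply,
    hB W fun i => (F i).2 (Fintype.mem_piFinset.1 hW i)]

lemma sqrt_mul_le_dist {r : ℕ} {a : Fin r → ℂ} {R : Fin r → ℝ}
    (hd : ENNReal.ofReal (4 * √(r : ℝ)) < minDist a / maxRadius R) {i j : Fin r} (hij : i ≠ j) :
    4 * √(r : ℝ) * R i ≤ ‖a i - a j‖ := by
  have h1 : ENNReal.ofReal (R i) ≤ maxRadius R := le_iSup (fun i => ENNReal.ofReal (R i)) i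
  have h2 : minDist a ≤ edist (a i) (a j) := iInf_le_of_le i (iInf_le_of_le j (iInf_le _ hij))
  have h4 : ENNReal.ofReal (4 * √(r : ℝ)) * maxRadius R ≤ minDist a :=
    ENNReal.mul_le_of_le_div hd.le
  have h5 : ENNReal.ofReal (4 * √(r : ℝ) * R i) ≤ edist (a i) (a j) := by
    rw [ENNReal.ofReal_mul (by positivity)]
    exact (mul_le_mul_right h1 _).trans (h4.trans h2)
  rw [edist_dist, dist_eq_norm, ENNReal.ofReal_le_ofReal_iff (norm_nonneg _)] at h5
  exact h5

end BosonSphere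
end

theorem mainTheorem1 (r : ℕ) (hr : 1 ≤ r) (a q : Fin r → ℂ) (R : Fin r → ℝ)
    (hR : ∀ i, 0 < R i) (hq : ∀ i, ‖q i‖ = R i)
    (hdisj : Pairwise fun i j => Disjoint (Metric.ball (a i) (R i)) (Metric.ball (a j) (R j)))
    (hd : ENNReal.ofReal (4 * √(r : ℝ)) < BosonSphere.minDist a / BosonSphere.maxRadius R) :
    -- `ν` is well defined and its range `𝒟` is dense
    (∀ (G : BosonSphere.PreHilb) (F : BosonSphere.upsWDisc),
      inner ℂ (BosonSphere.nu0 G) (BosonSphere.nu F) =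
        BosonSphere.wickExpect (BosonSphere.toWick (BosonSphere.Theta G.val) * F)) ∧
    Dense (BosonSphere.dom : Set BosonSphere.Hilb) ∧
    -- the functional is well defined on `𝒟 × ⋯ × 𝒟` and Hilbert–Schmidt
    ∃ A : MultilinearMap ℂ (fun _ : Fin r => BosonSphere.dom) ℂ,
      (∀ F : Fin r → BosonSphere.upsWDisc,
        A (fun i => BosonSphere.nu.rangeRestrict (F i)) =
          BosonSphere.correlation a q fun i => (F i : BosonSphere.UpsW)) ∧
      ∃ N : ℝ, BosonSphere.HasHilbertSchmidtNorm A N ∧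
        (∀ x : Fin r → BosonSphere.dom, ‖A x‖ ≤ N * ∏ i, ‖x i‖) ∧
        -- it extends to a bounded, still Hilbert–Schmidt, functional on the Hilbert space
        ∃ B : ContinuousMultilinearMap ℂ (fun _ : Fin r => BosonSphere.Hilb) ℂ,
          (∀ x : Fin r → BosonSphere.dom, B (fun i => (x i : BosonSphere.Hilb)) = A x) ∧
          (∀ x : Fin r → BosonSphere.Hilb, ‖B x‖ ≤ N * ∏ i, ‖x i‖) ∧
          ∀ (ι : Type) (φ : HilbertBasis ι ℂ BosonSphere.Hilb),
            HasSum (fun α : Fin r → ι => ‖B fun i => φ (α i)‖ ^ 2) (N ^ 2) := by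
  have hq0 : ∀ i, q i ≠ 0 := fun i => norm_pos_iff.1 (hq i ▸ hR i)
  have hdist : ∀ i j, i ≠ j → 4 * √(r : ℝ) * ‖q i‖ ≤ ‖a i - a j‖ := fun i j hij =>
    hq i ▸ BosonSphere.sqrt_mul_le_dist hd hij
  have hsep : ∀ i j, i ≠ j → ‖q i‖ + ‖q j‖ ≤ ‖a i - a j‖ := fun i j hij => by
    have h1 := hdist i j hij
    have h2 := hdist j i hij.symm
    rw [norm_sub_rev] at h2
    have hr1 : 1 ≤ √(r : ℝ) := Real.one_le_sqrt.2 (by exact_mod_cast hr)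
    nlinarith [norm_nonneg (q i), norm_nonneg (q j)]
  obtain ⟨B, N, hN, hsum, hbound, hHS⟩ := BosonSphere.exists_hilbertSchmidt BosonSphere.occBasis
    (BosonSphere.summable_norm_amplitudeCoeff_sq hr hdist hq0)
  refine ⟨fun G F => BosonSphere.nu_represents F G, BosonSphere.dense_dom,
    B.toMultilinearMap.compLinearMap fun _ => BosonSphere.dom.subtype, fun F => ?_, N,
    ⟨hN, _, BosonSphere.occBasis, BosonSphere.occBasis_mem_dom, hHS BosonSphere.occBasis⟩,
    fun x => hbound fun i => x i, B, fun x => rfl, hbound, fun ι φ => hHS φ⟩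
  exact BosonSphere.apply_nu_eq_correlation B.toMultilinearMap
    (fun W hW => BosonSphere.correlation_single_eq hq0 hsep hW (hsum _)) F
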